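/- **Theorem (proper learning of decision trees with polynomial sample and memory).** There is a single algorithm with the following property. Let $n\ge 0$ and $s\ge 1$ be integers, let $\varepsilon,\delta>0$, and let $f:\{0,1\}^n\to\{\pm1\}$ be any function computable by a decision tree of size (number of leaves) at most $s$. Given $n$, $s$, $\lceil 1/\varepsilon\rceil$ and $\max(0,\lceil\log_2(1/\delta)\rceil)$, and access to independent random examples $(x,f(x))$ with $x$ uniform on $\{0,1\}^n$, the algorithm - runs in time $\mathrm{poly}(n^{\log_2 s},\,1/\varepsilon,\,\log(1/\delta))$, - requires memory $\mathrm{poly}(s,\,\log n,\,1/\varepsilon,\,\log(1/\delta))$, - uses $\mathrm{poly}(s,\,\log n,\,1/\varepsilon,\,\log(1/\delta))$ random examples, where these bounds hold for every outcome of the random examples, and with probability at least $1-\delta$ over the random examples it returns a decision tree $T$ that is an $\varepsilon$-approximation of $f$, i.e. $\Pr_{x\sim\{0,1\}^n}[T(x)\ne f(x)]\le\varepsilon$. Here $\mathrm{poly}(a_1,\dots,a_k)$ means at most $C(1+a_1+\dots+a_k)^C$ for an absolute constant $C$; $\log(1/\delta)$ is read as $0$ if $\delta\ge1$, and $\log n$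 as $0$ if $n=0$. The algorithm is a program of a random access machine with unit-cost elementary operations (constants, loads, stores, addition, truncated subtraction, halving, tests for zero, drawing an example, reading one bit or the label of a stored example, writing one output token). Memory is the maximum over time of the number of stored examples (one unit per example; stored examples are read-only and can be accessed bit by bit), plus the number of bits of address and content of all nonzero memory cells, plus the number of bits and of tokens of the output. -/

import Mathlib

namespace DTLearn

/-- Points of the Boolean cube with `n` coordinates. -/
abbrev Cube (n : ℕ) : Type := Fin n → Bool

/-! ### Decision trees

The two output labels (`+1` and `-1`) are represented by `true` and `false`. -/

/-- Decision trees over `n` Boolean variables. -/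
inductive DTree (n : ℕ) : Type
  | leaf (b : Bool) : DTree n
  | node (v : Fin n) (t0 t1 : DTree n) : DTree n

namespace DTree

/-- The function computed by a tree: at a node go to `t0` if the queried variable is `0`
and to `t1` if it is `1`. -/
def eval {n : ℕ} : DTree n → Cube n → Bool
  | leaf b, _ => b
  | node v t0 t1, x => if x v = true then t1.eval x else t0.eval x

/-- The size of a tree is its number of leaves. -/
def size {n : ℕ} : DTree n → ℕ
  | leaf _ => 1
  | node _ t0 t1 => t0.size + t1.size

/-- The code of a tree as a list of numbers, in preorder: a leaf is one token, `0` or `1`;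
an inner node is the token `v + 2` followed by the codes of its two subtrees. -/
def code {n : ℕ} : DTree n → List ℕ
  | leaf b => [b.toNat]
  | node v t0 t1 => ((v : ℕ) + 2) :: (t0.code ++ t1.code)

end DTree

/-- `f` is computable by a decision tree of size (at most) `s`. -/
def ComputableBySize {n : ℕ} (f : Cube n → Bool) (s : ℕ) : Prop :=
  ∃ T : DTree n, T.size ≤ s ∧ ∀ x, T.eval x = f x

/-- `error(g, f)`: the probability that `g(x) ≠ f(x)` for a uniformly random point `x`. -/
noncomputable def error {n : ℕ} (g f : Cube n → Bool) : ℝ :=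
  (ProbabilityTheory.uniformOn (Set.univ : Set (Cube n))).real {x | g x ≠ f x}

/-! ### The machine model

Programs of a random access machine.  The machine has

* read/write memory cells, addressed by natural numbers and holding natural numbers;
* a store of labelled examples.  The instruction `draw` appends a fresh random example to it.
  Drawn examples can be read by random access, one bit at a time, but not altered;
* a write-only output, to which `emit` appends a number.

There is no multiplication, so a unit charge for every elementary operation is polynomially
equivalent to charging for bit operations. -/

/-- Expressions. -/
inductive Expr : Type
  /-- a constant -/
  | const (k : ℕ) : Expr
  /-- the content of the memory cell whose address is the value of `a` -/
  | load (a : Expr) : Expr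
  /-- sum -/
  | plus (a b : Expr) : Expr
  /-- difference, truncated at `0` -/
  | minus (a b : Expr) : Expr
  /-- half, rounded down -/
  | half (a : Expr) : Expr
  /-- coordinate number `j` of stored example number `i` (both counted from `0`) -/
  | coord (i j : Expr) : Expr
  /-- the label of stored example number `i` -/
  | label (i : Expr) : Expr

/-- Programs. -/
inductive Prog : Type
  /-- do nothing -/
  | skip : Prog
  /-- write the value of `e` into the memory cell whose address is the value of `a` -/
  | store (a e : Expr) : Prog
  /-- draw a fresh random example and append it to the stored ones -/
  | draw : Prog
  /-- append the value of `e` to the output -/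
  | emit (e : Expr) : Prog
  /-- sequential composition -/
  | seq (p r : Prog) : Prog
  /-- run `p` if the value of `c` is not `0`, and `r` otherwise -/
  | ite (c : Expr) (p r : Prog) : Prog
  /-- run `p` as long as the value of `c` is not `0` -/
  | loop (c : Expr) (p : Prog) : Prog

/-- States of the machine. -/
structure State : Type where
  /-- contents of the memory cells (all but finitely many are `0`) -/
  mem : ℕ →₀ ℕ
  /-- the number of examples drawn so far -/
  drawn : ℕ
  /-- the output written so far -/
  out : List ℕ

/-- The memory in use: one unit for every stored example, the number of bits of address and
content for every nonzero memory cell, and the number of bits plus one for every token of the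
output. -/
def State.space (σ : State) : ℕ :=
  σ.drawn + (σ.mem.sum fun i v => Nat.size i + Nat.size v)
    + (σ.out.map fun k => Nat.size k + 1).sum

/-- The initial state: the four input numbers are in the cells `0`, `1`, `2`, `3`. -/
noncomputable def State.start (a b c d : ℕ) : State where
  mem := Finsupp.single 0 a + Finsupp.single 1 b + Finsupp.single 2 c + Finsupp.single 3 d
  drawn := 0
  out := []

/-- A finite sequence of examples labelled by `f`. -/
def labelled {n q : ℕ} (f : Cube n → Bool) (X : Fin q → Cube n) : Fin q → Cube n × Bool :=
  fun i => (X i, f (X i))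

/-- Coordinate `j` of example `i`, as a number; `0` if there is no such coordinate, or if the
example has not been drawn (that is, `i` is not below `k`). -/
def coordVal {n q : ℕ} (S : Fin q → Cube n × Bool) (k i j : ℕ) : ℕ :=
  if h : i < q ∧ j < n then (if i < k then ((S ⟨i, h.1⟩).1 ⟨j, h.2⟩).toNat else 0) else 0

/-- The label of example `i`, as a number; `0` if the example has not been drawn. -/
def labelVal {n q : ℕ} (S : Fin q → Cube n × Bool) (k i : ℕ) : ℕ :=
  if h : i < q then (if i < k then (S ⟨i, h⟩).2.toNat else 0) else 0

namespace Expr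

/-- The value of an expression in a state; `S` is the sequence of examples which are handed out
by `draw`. -/
def eval {n q : ℕ} (S : Fin q → Cube n × Bool) (σ : State) : Expr → ℕ
  | const k => k
  | load a => σ.mem (a.eval S σ)
  | plus a b => a.eval S σ + b.eval S σ
  | minus a b => a.eval S σ - b.eval S σ
  | half a => a.eval S σ / 2
  | coord i j => coordVal S σ.drawn (i.eval S σ) (j.eval S σ)
  | label i => labelVal S σ.drawn (i.eval S σ)

/-- The number of elementary operations in the evaluation of an expression. -/
def cost : Expr → ℕ
  | const _ => 1
  | load a => a.cost + 1
  | plus a b => a.cost + b.cost + 1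
  | minus a b => a.cost + b.cost + 1
  | half a => a.cost + 1
  | coord i j => i.cost + j.cost + 1
  | label i => i.cost + 1

end Expr

/-- `Exec S P σ σ' t m`: when the examples handed out by `draw` are those of the sequence `S`,
in this order, the program `P` started in the state `σ` halts in the state `σ'` after `t` steps,
and the maximum of the memory in use during the run is `m`.  If `S` is exhausted, then `draw` is
stuck, so a program that halts has drawn at most `q` examples. -/
inductive Exec {n q : ℕ} (S : Fin q → Cube n × Bool) :
    Prog → State → State → ℕ → ℕ → Prop
  | skip (σ : State) : Exec S Prog.skip σ σ 1 σ.space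
  | store (a e : Expr) (σ σ' : State)
      (h : σ' = { σ with mem := σ.mem.update (a.eval S σ) (e.eval S σ) }) :
      Exec S (Prog.store a e) σ σ' (a.cost + e.cost + 1) (max σ.space σ'.space)
  | draw (σ σ' : State) (hq : σ.drawn < q) (h : σ' = { σ with drawn := σ.drawn + 1 }) :
      Exec S Prog.draw σ σ' 1 (max σ.space σ'.space)
  | emit (e : Expr) (σ σ' : State) (h : σ' = { σ with out := σ.out ++ [e.eval S σ] }) :
      Exec S (Prog.emit e) σ σ' (e.cost + 1) (max σ.space σ'.space)
  | seq {p r : Prog} {σ σ' σ'' : State} {t t' m m' : ℕ}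
      (hp : Exec S p σ σ' t m) (hr : Exec S r σ' σ'' t' m') :
      Exec S (Prog.seq p r) σ σ'' (t + t') (max m m')
  | ite_true {c : Expr} {p r : Prog} {σ σ' : State} {t m : ℕ}
      (hc : c.eval S σ ≠ 0) (hp : Exec S p σ σ' t m) :
      Exec S (Prog.ite c p r) σ σ' (c.cost + 1 + t) m
  | ite_false {c : Expr} {p r : Prog} {σ σ' : State} {t m : ℕ}
      (hc : c.eval S σ = 0) (hr : Exec S r σ σ' t m) :
      Exec S (Prog.ite c p r) σ σ' (c.cost + 1 + t) m
  | loop_stop {c : Expr} {p : Prog} {σ : State} (hc : c.eval S σ = 0) :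
      Exec S (Prog.loop c p) σ σ (c.cost + 1) σ.space
  | loop_step {c : Expr} {p : Prog} {σ σ' σ'' : State} {t t' m m' : ℕ}
      (hc : c.eval S σ ≠ 0) (hp : Exec S p σ σ' t m)
      (hl : Exec S (Prog.loop c p) σ' σ'' t' m') :
      Exec S (Prog.loop c p) σ σ'' (c.cost + 1 + t + t') (max m m')

/-! ### Learning -/

/-- The input of a learning program: `n`, `s`, and the parameters `ε`, `δ` presented by the
natural numbers `⌈1/ε⌉` and `⌈log₂ (1/δ)⌉`. -/
noncomputable def learnStart (n s : ℕ) (ε δ : ℝ) : State :=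
  State.start n s ⌈1 / ε⌉₊ ⌈Real.logb 2 (1 / δ)⌉₊

/-- On the sample `X`, labelled by `f`, the program `P` halts after at most `t` steps and with at
most `m` units of memory in use at any time. -/
def RunsWithin (P : Prog) {n q : ℕ} (s : ℕ) (ε δ : ℝ) (f : Cube n → Bool)
    (X : Fin q → Cube n) (t m : ℝ) : Prop :=
  ∃ (σ : State) (t' m' : ℕ),
    Exec (labelled f X) P (learnStart n s ε δ) σ t' m' ∧ (t' : ℝ) ≤ t ∧ (m' : ℝ) ≤ m

/-- On the sample `X`, labelled by `f`, the program `P` halts and its output is a decision tree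
that is an `ε`-approximation of `f`. -/
def Succeeds (P : Prog) {n q : ℕ} (s : ℕ) (ε δ : ℝ) (f : Cube n → Bool)
    (X : Fin q → Cube n) : Prop :=
  ∃ (σ : State) (t' m' : ℕ) (T : DTree n),
    Exec (labelled f X) P (learnStart n s ε δ) σ t' m' ∧ σ.out = T.code ∧ error T.eval f ≤ ε

/-- The quantity `C * (1 + n ^ (log₂ s) + 1/ε + log⁺ (1/δ)) ^ C`; a function of the parameters
is `poly(n ^ (log s), 1/ε, log (1/δ))` iff it is at most this for some constant `C`. -/
noncomputable def timeBound (C n s : ℕ) (ε δ : ℝ) : ℝ :=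
  C * (1 + (n : ℝ) ^ Real.logb 2 s + 1 / ε + Real.posLog (1 / δ)) ^ C

/-- The quantity `C * (1 + s + log n + 1/ε + log⁺ (1/δ)) ^ C`; a function of the parameters
is `poly(s, log n, 1/ε, log (1/δ))` iff it is at most this for some constant `C`. -/
noncomputable def spaceBound (C n s : ℕ) (ε δ : ℝ) : ℝ :=
  C * (1 + s + Real.log n + 1 / ε + Real.posLog (1 / δ)) ^ C

end DTLearn

open DTLearn

/-! The learner draws one sample and grows a tree guided by it. Call a set of examples mixed if both
labels occur in it, and let `splitCost` be the least number of mixed leaves of a tree of depth `h`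
all of whose inner nodes split the given examples into two nonempty parts. If `f` has a tree of size
`s`, then pruning that tree to the examples and cutting it off at depth `h` shows that this cost is
at most `s`, whatever `h` is (`splitCost_le_size`).

Both children of a queried node contain examples, so no variable is queried twice on a path, and a
leaf at depth `r` has weight exactly `2^(-r)` under the uniform distribution. The tree is grown in
blocks of `2l` levels, where `s ≤ 2^l`; inside a block each query is the root of an optimal tree for
the rest of the block. One block multiplies the number of mixed leaves by at most `s ≤ 2^l` and the
weight of each by `2^(-2l)`. After `k` blocks the mixed leaves have total weight at most `2^(-lk)`
(`card_none_mul_le`, `card_none_mul_two_pow_le`), which is made at most `1/(2E)` with `E = ⌈1/ε⌉`.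

For the other leaves an Occam argument is used. Regard the learnt function as undefined at mixed
leaves. It then never contradicts an example (`learntPartial_sample`), and it belongs to a class of
at most `(n+3)^(2^(r+1))` partial functions that does not depend on the sample. A union bound
excludes the members with wrong weight above `1/(2E)` (`prob_error_learnt_le`).

The depth is `2 log₂(2E)`, up to rounding, rounded up to a multiple of `2l`, so that `2^depth` is
polynomial in `s` and `E`; this bounds the size of the output and of the sample. Memory stays small
because no set of examples is stored: the set at a node is determined by the path to it, which lies
on a stack, and is found again by scanning the sample. The search for an optimal tree of depth `2l`
tries all variables recursively, in about `(4n+1)^(2l)` scans, which is polynomial in `n^(log₂ s)`.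
The recursions are run as flat loops with an explicit stack (`cost_reach`, `grow_reach`), verified
in a small program logic that bounds time and memory at once. -/

namespace DTLearn

/-! ### Resource limits -/

/-- Limits on the addresses, the cell contents, the number of stored examples and the length of
the output. -/
structure Lim where
  addr : ℕ
  val : ℕ
  draws : ℕ
  len : ℕ

/-- The memory that a state within the limits can use. -/
def Lim.cap (B : Lim) : ℕ :=
  B.draws + B.addr * (Nat.size B.addr + Nat.size B.val) + B.len * (Nat.size B.val + 1)

structure State.Within (σ : State) (B : Lim) : Prop where
  addr : ∀ a, B.addr ≤ a → σ.mem a = 0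
  val : ∀ a, σ.mem a ≤ B.val
  draws : σ.drawn ≤ B.draws
  len : σ.out.length ≤ B.len
  tok : ∀ k ∈ σ.out, k ≤ B.val

/-- Nonzero cells lie below `B.addr`, and every number involved has a bounded bit length. Hence
memory need not be followed step by step: the peak is bounded as soon as all intermediate states are
within the limits. -/
theorem State.Within.space_le {σ : State} {B : Lim} (h : σ.Within B) : σ.space ≤ B.cap := by
  have hs : σ.mem.support ⊆ Finset.range B.addr := by
    intro a ha
    rw [Finset.mem_range]
    by_contra hc
    exact (Finsupp.mem_support_iff.1 ha) (h.addr a (not_lt.1 hc))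
  have h1 : (σ.mem.sum fun i v => Nat.size i + Nat.size v)
      ≤ B.addr * (Nat.size B.addr + Nat.size B.val) := by
    unfold Finsupp.sum
    calc _ ≤ ∑ i ∈ σ.mem.support, (Nat.size B.addr + Nat.size B.val) := by
          refine Finset.sum_le_sum fun i hi => ?_
          exact Nat.add_le_add (Nat.size_le_size (Finset.mem_range.1 (hs hi)).le)
            (Nat.size_le_size (h.val i))
      _ ≤ _ := by
          rw [Finset.sum_const, smul_eq_mul]
          exact Nat.mul_le_mul_right _ (by simpa using Finset.card_le_card hs)
  have h2 : (σ.out.map fun k => Nat.size k + 1).sum ≤ B.len * (Nat.size B.val + 1) := by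
    calc _ ≤ (σ.out.map fun k => Nat.size k + 1).length • (Nat.size B.val + 1) := by
          refine List.sum_le_card_nsmul _ _ fun x hx => ?_
          obtain ⟨k, hk, rfl⟩ := List.mem_map.1 hx
          exact Nat.succ_le_succ (Nat.size_le_size (h.tok k hk))
      _ ≤ _ := by
          rw [List.length_map, smul_eq_mul]
          exact Nat.mul_le_mul_right _ h.len
  have := h.draws
  unfold State.space Lim.cap
  omega

/-! ### A program logic -/

section Logic
variable {n q : ℕ} (S : Fin q → Cube n × Bool) (B : Lim)

/-- From the state `σ` the program `P` halts within `t` steps and within the limits `B`, in a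
state with property `Q`. -/
def Ensures (P : Prog) (σ : State) (t : ℕ) (Q : State → Prop) : Prop :=
  ∃ σ' t' m', Exec S P σ σ' t' m' ∧ t' ≤ t ∧ m' ≤ B.cap ∧ σ'.Within B ∧ Q σ'

/-- From the state `σ` the loop reaches a state with property `Q`, after finitely many rounds
which take at most `t` steps and stay within the limits `B`. -/
def Reach (c : Expr) (p : Prog) (σ : State) (t : ℕ) (Q : State → Prop) : Prop :=
  ∃ σ', σ'.Within B ∧ Q σ' ∧ ∀ σ'' t'' m'', Exec S (Prog.loop c p) σ' σ'' t'' m'' →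
    ∃ t' m', Exec S (Prog.loop c p) σ σ'' t' m' ∧ t' ≤ t + t'' ∧ m' ≤ max B.cap m''

/-- The weakest precondition of a program without loops. -/
def wp : Prog → (State → Prop) → State → Prop
  | .skip, Q, σ => Q σ
  | .store a e, Q, σ => a.eval S σ < B.addr ∧ e.eval S σ ≤ B.val ∧
      Q { σ with mem := σ.mem.update (a.eval S σ) (e.eval S σ) }
  | .draw, Q, σ => σ.drawn < q ∧ σ.drawn < B.draws ∧ Q { σ with drawn := σ.drawn + 1 }
  | .emit e, Q, σ => e.eval S σ ≤ B.val ∧ σ.out.length < B.len ∧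
      Q { σ with out := σ.out ++ [e.eval S σ] }
  | .seq p r, Q, σ => wp p (wp r Q) σ
  | .ite c p r, Q, σ => (c.eval S σ ≠ 0 → wp p Q σ) ∧ (c.eval S σ = 0 → wp r Q σ)
  | .loop _ _, _, _ => False

/-- A bound for the running time of a program without loops. -/
def loopFreeTime : Prog → ℕ
  | .skip => 1
  | .store a e => a.cost + e.cost + 1
  | .draw => 1
  | .emit e => e.cost + 1
  | .seq p r => loopFreeTime p + loopFreeTime r
  | .ite c p r => c.cost + 1 + max (loopFreeTime p) (loopFreeTime r)
  | .loop _ _ => 0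

variable {S B}

theorem Ensures.mono {P : Prog} {σ : State} {t t' : ℕ} {Q Q' : State → Prop}
    (h : Ensures S B P σ t Q) (ht : t ≤ t') (hQ : ∀ σ', σ'.Within B → Q σ' → Q' σ') :
    Ensures S B P σ t' Q' := by
  obtain ⟨σ', t₁, m, h1, h2, h3, h4, h5⟩ := h
  exact ⟨σ', t₁, m, h1, h2.trans ht, h3, h4, hQ _ h4 h5⟩

theorem Ensures.seq {p r : Prog} {σ : State} (t₁ t₂ : ℕ) {t : ℕ} {Q : State → Prop}
    (ht : t₁ + t₂ ≤ t) (h : Ensures S B p σ t₁ fun σ' => Ensures S B r σ' t₂ Q) :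
    Ensures S B (.seq p r) σ t Q := by
  obtain ⟨σ', t, m, h1, h2, h3, _, σ'', t', m', h1', h2', h3', h4', h5⟩ := h
  exact ⟨σ'', t + t', max m m', .seq h1 h1', by omega, max_le h3 h3', h4', h5⟩

theorem Ensures.ite {c : Expr} {p r : Prog} {σ : State} {t : ℕ} {Q : State → Prop}
    (h1 : c.eval S σ ≠ 0 → Ensures S B p σ t Q) (h2 : c.eval S σ = 0 → Ensures S B r σ t Q) :
    Ensures S B (.ite c p r) σ (c.cost + 1 + t) Q := by
  by_cases hc : c.eval S σ = 0
  · obtain ⟨σ', t, m, h1, h2, h3, h4, h5⟩ := h2 hc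
    exact ⟨σ', _, m, .ite_false hc h1, by omega, h3, h4, h5⟩
  · obtain ⟨σ', t, m, h1, h2, h3, h4, h5⟩ := h1 hc
    exact ⟨σ', _, m, .ite_true hc h1, by omega, h3, h4, h5⟩

theorem State.Within.update {σ : State} (h : σ.Within B) {a e : ℕ} (ha : a < B.addr)
    (he : e ≤ B.val) : State.Within { σ with mem := σ.mem.update a e } B where
  addr b hb := by
    have : b ≠ a := by omega
    simpa [Finsupp.coe_update, Function.update_apply, this] using h.addr b hb
  val b := by
    by_cases hb : b = a
    · simpa [Finsupp.coe_update, Function.update_apply, hb] using he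
    · simpa [Finsupp.coe_update, Function.update_apply, hb] using h.val b
  draws := h.draws
  len := h.len
  tok := h.tok

/-- The precondition demands the limits at each store, draw and emission, so every intermediate
state is within `B`. Loops have precondition `False`; they are left to `Ensures.loop` and `Reach`.
-/
theorem Ensures.of_wp {P : Prog} : ∀ {σ : State} {Q : State → Prop}, σ.Within B →
    wp S B P Q σ → Ensures S B P σ (loopFreeTime P) Q := by
  induction P with
  | skip => exact fun {σ Q} h hw => ⟨σ, 1, σ.space, .skip σ, le_rfl, h.space_le, h, hw⟩
  | store a e =>
    intro σ Q h hw
    have h' := h.update hw.1 hw.2.1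
    exact ⟨_, _, _, .store a e σ _ rfl, le_rfl, max_le h.space_le h'.space_le, h', hw.2.2⟩
  | draw =>
    intro σ Q h hw
    have h' : State.Within { σ with drawn := σ.drawn + 1 } B :=
      ⟨h.addr, h.val, hw.2.1, h.len, h.tok⟩
    exact ⟨_, _, _, .draw σ _ hw.1 rfl, le_rfl, max_le h.space_le h'.space_le, h', hw.2.2⟩
  | emit e =>
    intro σ Q h hw
    have h' : State.Within { σ with out := σ.out ++ [e.eval S σ] } B :=
      ⟨h.addr, h.val, h.draws, by simpa using hw.2.1, by
        intro k hk
        rcases List.mem_append.1 hk with hk | hk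
        · exact h.tok k hk
        · rw [List.mem_singleton.1 hk]; exact hw.1⟩
    exact ⟨_, _, _, .emit e σ _ rfl, le_rfl, max_le h.space_le h'.space_le, h', hw.2.2⟩
  | seq p r ihp ihr =>
    exact fun {σ Q} h hw =>
      .seq _ _ le_rfl ((ihp h hw).mono le_rfl fun σ' h' => ihr h')
  | ite c p r ihp ihr =>
    exact fun {σ Q} h hw => .ite
      (fun hc => (ihp h (hw.1 hc)).mono (le_max_left _ _) fun _ _ h => h)
      (fun hc => (ihr h (hw.2 hc)).mono (le_max_right _ _) fun _ _ h => h)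
  | loop c p => exact fun {σ Q} _ hw => hw.elim

theorem Ensures.wp {P : Prog} {σ : State} {t : ℕ} {Q : State → Prop} (h : σ.Within B)
    (ht : loopFreeTime P ≤ t) (hw : wp S B P Q σ) : Ensures S B P σ t Q :=
  (Ensures.of_wp h hw).mono ht fun _ _ h => h

theorem Ensures.wp_seq {p r : Prog} {σ : State} (t' : ℕ) {t : ℕ} {Q : State → Prop}
    (h : σ.Within B) (ht : loopFreeTime p + t' ≤ t)
    (hw : DTLearn.wp S B p (fun σ' => σ'.Within B → Ensures S B r σ' t' Q) σ) :
    Ensures S B (.seq p r) σ t Q :=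
  .seq _ _ ht ((Ensures.of_wp h hw).mono le_rfl fun _ h' hq => hq h')

theorem Reach.refl {c : Expr} {p : Prog} {σ : State} {t : ℕ} {Q : State → Prop}
    (h : σ.Within B) (hQ : Q σ) : Reach S B c p σ t Q :=
  ⟨σ, h, hQ, fun _ t'' m'' he => ⟨t'', m'', he, by omega, le_max_right _ _⟩⟩

theorem Reach.mono {c : Expr} {p : Prog} {σ : State} {t t' : ℕ} {Q Q' : State → Prop}
    (h : Reach S B c p σ t Q) (ht : t ≤ t') (hQ : ∀ σ', σ'.Within B → Q σ' → Q' σ') :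
    Reach S B c p σ t' Q' := by
  obtain ⟨σ', h1, h2, h3⟩ := h
  refine ⟨σ', h1, hQ _ h1 h2, fun σ'' t'' m'' he => ?_⟩
  obtain ⟨t₁, m₁, h4, h5, h6⟩ := h3 _ _ _ he
  exact ⟨t₁, m₁, h4, by omega, h6⟩

/-- A recursion is run as one flat loop, so a recursive call is a segment of consecutive rounds and
not a subprogram. `Reach` describes a segment by how it prolongs every halting run that starts at
its end; such descriptions compose, and `Reach.halt` closes the last one. -/
theorem Reach.trans {c : Expr} {p : Prog} {σ : State} {t₁ t₂ : ℕ} {Q : State → Prop}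
    (h : Reach S B c p σ t₁ fun σ' => Reach S B c p σ' t₂ Q) :
    Reach S B c p σ (t₁ + t₂) Q := by
  obtain ⟨σ₁, _, ⟨σ₂, h4, h5, h6⟩, h3⟩ := h
  refine ⟨σ₂, h4, h5, fun σ'' t'' m'' he => ?_⟩
  obtain ⟨t₁, m₁, h7, h8, h9⟩ := h6 _ _ _ he
  obtain ⟨t₂, m₂, h10, h11, h12⟩ := h3 _ _ _ h7
  exact ⟨t₂, m₂, h10, by omega, h12.trans (max_le (le_max_left _ _) h9)⟩

theorem Reach.step {c : Expr} {p : Prog} {σ : State} {t : ℕ} {Q : State → Prop}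
    (hc : c.eval S σ ≠ 0) (h : Ensures S B p σ t Q) :
    Reach S B c p σ (c.cost + 1 + t) Q := by
  obtain ⟨σ', t', m', h1, h2, h3, h4, h5⟩ := h
  refine ⟨σ', h4, h5, fun σ'' t'' m'' he => ⟨_, _, .loop_step hc h1 he, by omega, ?_⟩⟩
  exact max_le_max_right _ h3

theorem Reach.halt {c : Expr} {p : Prog} {σ : State} {t : ℕ} {Q : State → Prop}
    (h : Reach S B c p σ t fun σ' => c.eval S σ' = 0 ∧ Q σ') :
    Ensures S B (.loop c p) σ (t + (c.cost + 1)) Q := by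
  obtain ⟨σ', h1, h2, h3⟩ := h
  have h0 : Exec S (.loop c p) σ' σ' (c.cost + 1) σ'.space := by constructor; exact h2.1
  obtain ⟨t', m', h4, h5, h6⟩ := h3 _ _ _ h0
  exact ⟨σ', t', m', h4, h5, h6.trans (max_le le_rfl h1.space_le), h1, h2.2⟩

/-- A loop that runs exactly `N` rounds. -/
theorem Ensures.loop {c : Expr} {p : Prog} {σ : State} (t : ℕ) {T : ℕ} (Inv : ℕ → State → Prop)
    (N : ℕ) (ht : N * (c.cost + 1 + t) + (c.cost + 1) ≤ T) (h : σ.Within B) (h0 : Inv 0 σ)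
    (hN : ∀ σ', Inv N σ' → c.eval S σ' = 0)
    (hs : ∀ j < N, ∀ σ', σ'.Within B → Inv j σ' →
      c.eval S σ' ≠ 0 ∧ Ensures S B p σ' t (Inv (j + 1))) :
    Ensures S B (.loop c p) σ T (Inv N) := by
  refine Ensures.mono (Q := Inv N) (Reach.halt ?_) ht fun _ _ h => h
  have key : ∀ j ≤ N, Reach S B c p σ (j * (c.cost + 1 + t)) (Inv j) := by
    intro j
    induction j with
    | zero => exact fun _ => .refl h h0
    | succ j ih =>
      intro hj
      rw [Nat.succ_mul]
      refine Reach.trans ((ih (by omega)).mono le_rfl fun σ' h' hi => ?_)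
      obtain ⟨hc, he⟩ := hs j (by omega) σ' h' hi
      exact .step hc he
  exact (key N le_rfl).mono le_rfl fun σ' _ hi => ⟨hN _ hi, hi⟩

end Logic

end DTLearn

namespace DTLearn

/-! ### The recursion behind the learner -/

section Recursion
variable {n q : ℕ} (S : Fin q → Cube n × Bool)

/-- The examples in `A` whose coordinate number `v` is `b`. -/
def split (A : Finset ℕ) (v b : ℕ) : Finset ℕ := A.filter fun i => coordVal S q i v = b

/-- Some example in `A` has the label `y`. -/
def HasLabel (A : Finset ℕ) (y : ℕ) : Prop := ∃ i ∈ A, labelVal S q i = y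

/-- Both labels occur in `A`. -/
def Mixed (A : Finset ℕ) : Prop := HasLabel S A 0 ∧ HasLabel S A 1

/-- The minimum of `I` and of the values of `g` below `k`, with a place where it is attained. -/
def best (g : ℕ → ℕ) (I : ℕ) : ℕ → ℕ × ℕ
  | 0 => (I, 0)
  | k + 1 => if g k < (best g I k).1 then (g k, k) else best g I k

open Classical in
/-- The least number of mixed leaves of a tree of depth `h` which splits the examples `A` and
does so at every inner node; `I` stands for infinity. -/
noncomputable def splitCost (I : ℕ) : ℕ → Finset ℕ → ℕ
  | 0, A => if A = ∅ then I else if Mixed S A then 1 else 0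
  | h + 1, A => if A = ∅ then I else if Mixed S A then
      (best (fun v => splitCost I h (split S A v 0) + splitCost I h (split S A v 1)) I n).1
      else 0

/-- The variable at the root of an optimal tree of depth `h + 1`. -/
noncomputable def bestVar (I h : ℕ) (A : Finset ℕ) : ℕ :=
  (best (fun v => splitCost S I h (split S A v 0) + splitCost S I h (split S A v 1)) I n).2

/-- The number of levels to the next multiple of `d`, when `r` levels are left. -/
def horizon (d r : ℕ) : ℕ := if r % d = 0 then d else r % d

/-- The variable queried by the learner when `r` levels are left. -/
noncomputable def query (I d r : ℕ) (A : Finset ℕ) : ℕ := bestVar S I (horizon d r - 1) A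

open Classical in
/-- The tree that the learner returns, as a list of tokens. -/
noncomputable def tokens (I d : ℕ) : ℕ → Finset ℕ → List ℕ
  | 0, A => [if Mixed S A then 0 else if HasLabel S A 1 then 1 else 0]
  | r + 1, A => if Mixed S A then
      (query S I d (r + 1) A + 2) :: (tokens I d r (split S A (query S I d (r + 1) A) 0)
        ++ tokens I d r (split S A (query S I d (r + 1) A) 1))
      else [if HasLabel S A 1 then 1 else 0]

open Classical in
/-- The tree that the learner returns. -/
noncomputable def learnt (I d : ℕ) : ℕ → Finset ℕ → DTree n
  | 0, A => .leaf (if Mixed S A then false else decide (HasLabel S A 1))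
  | r + 1, A => if Mixed S A then
      if h : query S I d (r + 1) A < n then
        .node ⟨_, h⟩ (learnt I d r (split S A (query S I d (r + 1) A) 0))
          (learnt I d r (split S A (query S I d (r + 1) A) 1))
      else .leaf false
      else .leaf (decide (HasLabel S A 1))

open Classical in
/-- The function computed by the tree that the learner returns, undefined at mixed leaves. -/
noncomputable def learntPartial (I d : ℕ) : ℕ → Finset ℕ → Cube n → Option Bool
  | 0, A, _ => if Mixed S A then none else some (decide (HasLabel S A 1))
  | r + 1, A, x => if Mixed S A then
      if h : query S I d (r + 1) A < n then
        if x ⟨_, h⟩ = true then learntPartial I d r (split S A (query S I d (r + 1) A) 1) x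
        else learntPartial I d r (split S A (query S I d (r + 1) A) 0) x
      else none
      else some (decide (HasLabel S A 1))

theorem best_fst_le (g : ℕ → ℕ) (I k : ℕ) : (best g I k).1 ≤ I := by
  induction k with
  | zero => simp [best]
  | succ k ih => rw [best]; split_ifs <;> omega

theorem best_fst_le_apply (g : ℕ → ℕ) (I : ℕ) {k v : ℕ} (h : v < k) : (best g I k).1 ≤ g v := by
  induction k with
  | zero => omega
  | succ k ih =>
    rcases Nat.lt_succ_iff_lt_or_eq.1 h with h | rfl
    · have := ih h
      rw [best]; split_ifs <;> omega
    · rw [best]; split_ifs <;> omega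

/-- Below `I` the minimum must come from a value of `g`. If it equals `I`, the recorded place is
only the default `0`, which is why strictness is assumed. -/
theorem best_snd (g : ℕ → ℕ) (I k : ℕ) (h : (best g I k).1 < I) :
    (best g I k).2 < k ∧ g (best g I k).2 = (best g I k).1 := by
  induction k with
  | zero => simp [best] at h
  | succ k ih =>
    rw [best] at h ⊢
    split_ifs at h ⊢ with hc
    · simp
    · exact ⟨by have := (ih h).1; omega, (ih h).2⟩

theorem best_snd_le (g : ℕ → ℕ) (I k : ℕ) : (best g I k).2 ≤ k := by
  induction k with
  | zero => simp [best]
  | succ k ih => rw [best]; split_ifs <;> omega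

theorem splitCost_empty (I h : ℕ) : splitCost S I h ∅ = I := by
  cases h <;> simp [splitCost]

theorem splitCost_le {I : ℕ} (hI : 1 ≤ I) (h : ℕ) (A : Finset ℕ) : splitCost S I h A ≤ I := by
  cases h with
  | zero => rw [splitCost]; split_ifs <;> omega
  | succ h =>
    rw [splitCost]; split_ifs
    · exact le_rfl
    · exact best_fst_le _ _ _
    · omega

theorem splitCost_of_not_mixed (I h : ℕ) {A : Finset ℕ} (hA : A.Nonempty) (hm : ¬ Mixed S A) :
    splitCost S I h A = 0 := by
  cases h <;> simp [splitCost, hA.ne_empty, hm]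

theorem split_subset (A : Finset ℕ) (v b : ℕ) : split S A v b ⊆ A := Finset.filter_subset _ _

theorem mem_split {A : Finset ℕ} {v b i : ℕ} :
    i ∈ split S A v b ↔ i ∈ A ∧ coordVal S q i v = b := Finset.mem_filter

theorem coordVal_of_lt {i v : ℕ} (hi : i < q) (hv : v < n) :
    coordVal S q i v = ((S ⟨i, hi⟩).1 ⟨v, hv⟩).toNat := by simp [coordVal, hi, hv]

theorem labelVal_of_lt {i : ℕ} (hi : i < q) : labelVal S q i = (S ⟨i, hi⟩).2.toNat := by
  simp [labelVal, hi]

theorem coordVal_le_one (k i v : ℕ) : coordVal S k i v ≤ 1 := by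
  unfold coordVal; split_ifs <;> simp [Bool.toNat_le]

theorem labelVal_le_one (k i : ℕ) : labelVal S k i ≤ 1 := by
  unfold labelVal; split_ifs <;> simp [Bool.toNat_le]

theorem horizon_pos {d : ℕ} (hd : 0 < d) (r : ℕ) : 0 < horizon d r := by
  unfold horizon; split_ifs <;> omega

theorem horizon_le {d : ℕ} (hd : 0 < d) (r : ℕ) : horizon d r ≤ d := by
  unfold horizon
  have := Nat.mod_lt r hd
  split_ifs <;> omega

theorem horizon_mul_add {d j h : ℕ} (h1 : 1 ≤ h) (hd : h ≤ d) : horizon d (d * j + h) = h := by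
  unfold horizon
  rcases hd.lt_or_eq with hd | rfl
  · rw [Nat.mul_add_mod, Nat.mod_eq_of_lt hd, if_neg (by omega)]
  · simp

theorem exists_eq_mul_add {d r : ℕ} (hd : 0 < d) (hr : 0 < r) :
    ∃ j h, 1 ≤ h ∧ h ≤ d ∧ r = d * j + h := by
  have h1 := Nat.div_add_mod (r - 1) d
  have h2 := Nat.mod_lt (r - 1) hd
  exact ⟨(r - 1) / d, (r - 1) % d + 1, by omega, by omega, by omega⟩

/-- Going down one level uses up one level of the block, and a finished block is followed by a fresh
one of `d` levels. The program updates its register `21` by this rule on the way down and by its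
inverse on the way up. -/
theorem horizon_succ {d : ℕ} (hd : 0 < d) (r : ℕ) :
    horizon d r = if horizon d (r + 1) = 1 then d else horizon d (r + 1) - 1 := by
  obtain ⟨j, h, h1, h2, h3⟩ : ∃ j h, 1 ≤ h ∧ h ≤ d ∧ r + 1 = d * j + h :=
    exists_eq_mul_add hd (Nat.succ_pos r)
  rw [h3, horizon_mul_add h1 h2]
  split_ifs with h4
  · have : r = d * j := by omega
    simp [horizon, this]
  · have : r = d * j + (h - 1) := by omega
    rw [this, horizon_mul_add (by omega) (by omega)]

end Recursion

/-! ### The cost of splitting is at most the size of a consistent tree -/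

section Consistent
variable {n q : ℕ} {f : Cube n → Bool} {X : Fin q → Cube n}

/-- Prune `T` to the examples: omit the nodes with an empty side, and cut off at depth `h`. The
mixed leaves that remain are cut-off subtrees of `T`, each with a leaf of its own, so the bound does
not depend on `h`. -/
theorem splitCost_le_size (I h : ℕ) {A : Finset ℕ} (hA : A ⊆ Finset.range q)
    (hne : A.Nonempty) (T : DTree n)
    (hT : ∀ i (hi : i < q), i ∈ A → T.eval (X ⟨i, hi⟩) = f (X ⟨i, hi⟩)) :
    splitCost (labelled f X) I h A ≤ T.size := by
  induction T generalizing h A with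
  | leaf b =>
    rw [splitCost_of_not_mixed _ _ _ hne]
    · exact Nat.zero_le _
    · rintro ⟨⟨i, hi, h0⟩, ⟨j, hj, h1⟩⟩
      have hi' := Finset.mem_range.1 (hA hi)
      have hj' := Finset.mem_range.1 (hA hj)
      have e1 := hT i hi' hi
      have e2 := hT j hj' hj
      rw [labelVal_of_lt _ hi'] at h0
      rw [labelVal_of_lt _ hj'] at h1
      simp only [labelled, ← e1, ← e2, DTree.eval] at h0 h1
      omega
  | node v t0 t1 ih0 ih1 =>
    have hpos : ∀ t : DTree n, 1 ≤ t.size := by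
      intro t; induction t with
      | leaf b => exact le_rfl
      | node v t0 t1 ih0 ih1 => simp only [DTree.size]; omega
    have hs0 : split (labelled f X) A v 0 ⊆ Finset.range q := (split_subset _ _ _ _).trans hA
    have hs1 : split (labelled f X) A v 1 ⊆ Finset.range q := (split_subset _ _ _ _).trans hA
    have hT0 : ∀ i (hi : i < q), i ∈ split (labelled f X) A v 0 →
        t0.eval (X ⟨i, hi⟩) = f (X ⟨i, hi⟩) := by
      intro i hi hm
      obtain ⟨hm, hv⟩ := (mem_split _).1 hm
      rw [coordVal_of_lt _ hi v.2] at hv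
      have := hT i hi hm
      have hv' : X ⟨i, hi⟩ v = false := by simpa [labelled] using hv
      simpa [DTree.eval, hv'] using this
    have hT1 : ∀ i (hi : i < q), i ∈ split (labelled f X) A v 1 →
        t1.eval (X ⟨i, hi⟩) = f (X ⟨i, hi⟩) := by
      intro i hi hm
      obtain ⟨hm, hv⟩ := (mem_split _).1 hm
      rw [coordVal_of_lt _ hi v.2] at hv
      have := hT i hi hm
      have hv' : X ⟨i, hi⟩ v = true := by simpa [labelled] using hv
      simpa [DTree.eval, hv'] using this
    have hcases : ∀ i ∈ A, i ∈ split (labelled f X) A v 0 ∨ i ∈ split (labelled f X) A v 1 := by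
      intro i hi
      have := coordVal_le_one (labelled f X) q i v
      simp only [mem_split, hi, true_and]; omega
    -- If the root of `T` does not split `A`, the other subtree is consistent with all of `A` and
    -- takes the place of `T`, with the same `h`.
    rcases (split (labelled f X) A v 0).eq_empty_or_nonempty with he0 | he0
    · have : split (labelled f X) A v 1 = A := by
        refine (split_subset _ _ _ _).antisymm fun i hi => ?_
        rcases hcases i hi with h' | h'
        · simp [he0] at h'
        · exact h'
      rw [this] at hT1
      have := ih1 h hA hne hT1
      simp only [DTree.size]; omega
    rcases (split (labelled f X) A v 1).eq_empty_or_nonempty with he1 | he1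
    · have : split (labelled f X) A v 0 = A := by
        refine (split_subset _ _ _ _).antisymm fun i hi => ?_
        rcases hcases i hi with h' | h'
        · exact h'
        · simp [he1] at h'
      rw [this] at hT0
      have := ih0 h hA hne hT0
      simp only [DTree.size]; omega
    cases h with
    | zero =>
      have := hpos t0
      simp only [DTree.size, splitCost]; split_ifs
      · simp_all
      · omega
      · omega
    | succ h =>
      simp only [DTree.size, splitCost]; split_ifs
      · simp_all
      · exact (best_fst_le_apply _ _ v.2).trans
          (Nat.add_le_add (ih0 h hs0 he0 hT0) (ih1 h hs1 he1 hT1))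
      · omega

theorem splitCost_le_of_computable {s : ℕ} (hf : ComputableBySize f s) (h : ℕ)
    {A : Finset ℕ} (hA : A ⊆ Finset.range q)
    (hne : A.Nonempty) : splitCost (labelled f X) (s + 1) h A ≤ s := by
  obtain ⟨T, h1, h2⟩ := hf
  exact (splitCost_le_size _ _ hA hne T fun i hi _ => h2 _).trans h1

theorem Mixed.nonempty {S : Fin q → Cube n × Bool} {A : Finset ℕ} (h : Mixed S A) :
    A.Nonempty := let ⟨⟨i, hi, _⟩, _⟩ := h; ⟨i, hi⟩

/-- The cost is at most `s`, which is below `I = s + 1`. So the minimum is attained at a genuine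
variable, and a split with an empty side, which costs at least `I`, cannot be optimal. -/
theorem bestVar_spec {s : ℕ} (hf : ComputableBySize f s) (h : ℕ)
    {A : Finset ℕ} (hA : A ⊆ Finset.range q)
    (hm : Mixed (labelled f X) A) :
    bestVar (labelled f X) (s + 1) h A < n ∧
    (split (labelled f X) A (bestVar (labelled f X) (s + 1) h A) 0).Nonempty ∧
    (split (labelled f X) A (bestVar (labelled f X) (s + 1) h A) 1).Nonempty ∧
    splitCost (labelled f X) (s + 1) h
        (split (labelled f X) A (bestVar (labelled f X) (s + 1) h A) 0) +
      splitCost (labelled f X) (s + 1) h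
        (split (labelled f X) A (bestVar (labelled f X) (s + 1) h A) 1) =
      splitCost (labelled f X) (s + 1) (h + 1) A := by
  have hne : A.Nonempty := hm.nonempty
  have h1 := splitCost_le_of_computable (X := X) hf (h + 1) hA hne
  have h2 : splitCost (labelled f X) (s + 1) (h + 1) A =
      (best (fun v => splitCost (labelled f X) (s + 1) h (split (labelled f X) A v 0) +
        splitCost (labelled f X) (s + 1) h (split (labelled f X) A v 1)) (s + 1) n).1 := by
    simp [splitCost, hm, hne.ne_empty]
  rw [h2] at h1 ⊢
  obtain ⟨h3, h4⟩ := best_snd _ _ _ (Nat.lt_succ_of_le h1)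
  refine ⟨h3, ?_, ?_, h4⟩
  · rw [Finset.nonempty_iff_ne_empty]
    intro he
    rw [← h4, ← bestVar, he, splitCost_empty] at h1
    omega
  · rw [Finset.nonempty_iff_ne_empty]
    intro he
    rw [← h4, ← bestVar, he, splitCost_empty] at h1
    omega

end Consistent
end DTLearn

namespace DTLearn

/-! ### The learnt tree: its code, its agreement with the sample, and the weight of its mixed
leaves. -/

section Consistent
variable {n q : ℕ} {f : Cube n → Bool} {X : Fin q → Cube n}

/-- The token list is what the program writes, without a check that the variable is below `n`; for
computable `f` the check in `learnt` always succeeds. -/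
theorem code_learnt {s : ℕ} (hf : ComputableBySize f s) (d r : ℕ) {A : Finset ℕ}
    (hA : A ⊆ Finset.range q) :
    (learnt (labelled f X) (s + 1) d r A).code = tokens (labelled f X) (s + 1) d r A := by
  induction r generalizing A with
  | zero =>
    rw [learnt, tokens, DTree.code]
    split_ifs with h1 h2
    · rfl
    · simp [h2]
    · simp [h2]
  | succ r ih =>
    rw [learnt, tokens]
    split_ifs with h1 h2 h3
    · rw [DTree.code, ih ((split_subset _ _ _ _).trans hA), ih ((split_subset _ _ _ _).trans hA)]
    · exact absurd (bestVar_spec hf _ hA h1).1 h2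
    · simp [DTree.code, h3]
    · simp [DTree.code, h3]

theorem length_tokens_le (S : Fin q → Cube n × Bool) (I d r : ℕ) (A : Finset ℕ) :
    (tokens S I d r A).length + 1 ≤ 2 ^ (r + 1) := by
  induction r generalizing A with
  | zero => simp [tokens]
  | succ r ih =>
    have h0 := ih (split S A (query S I d (r + 1) A) 0)
    have h1 := ih (split S A (query S I d (r + 1) A) 1)
    rw [tokens, pow_succ]
    split_ifs <;> simp only [List.length_cons, List.length_append, List.length_nil] <;> omega

theorem eval_learnt (S : Fin q → Cube n × Bool) (I d r : ℕ) (A : Finset ℕ) (x : Cube n) (b : Bool)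
    (h : learntPartial S I d r A x = some b) : (learnt S I d r A).eval x = b := by
  induction r generalizing A with
  | zero =>
    rw [learntPartial] at h
    rw [learnt]
    split_ifs at h ⊢
    simpa [DTree.eval] using h
  | succ r ih =>
    rw [learntPartial] at h
    rw [learnt]
    split_ifs at h ⊢ with h1 h2 h3
    · simpa [DTree.eval, h3] using ih _ h
    · simpa [DTree.eval, h3] using ih _ h
    · simpa [DTree.eval] using h

open Classical in
-- An example stays in the set along its own path. It thus ends at a leaf that is either mixed,
-- where the value is `none`, or carries this example's label only.
theorem learntPartial_sample (I d r : ℕ) {A : Finset ℕ} {i : ℕ} (hi : i < q) (hA : i ∈ A) :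
    learntPartial (labelled f X) I d r A (X ⟨i, hi⟩) ≠ some (!f (X ⟨i, hi⟩)) := by
  have hpure : ∀ A : Finset ℕ, i ∈ A → ¬ Mixed (labelled f X) A →
      some (decide (HasLabel (labelled f X) A 1)) ≠ some (!f (X ⟨i, hi⟩)) := by
    intro A hA hm
    have hl : labelVal (labelled f X) q i = (f (X ⟨i, hi⟩)).toNat := labelVal_of_lt _ hi
    cases hb : f (X ⟨i, hi⟩) with
    | false =>
      rw [hb] at hl
      have : ¬ HasLabel (labelled f X) A 1 := fun h => hm ⟨⟨i, hA, hl⟩, h⟩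
      simp [this]
    | true =>
      rw [hb] at hl
      have : HasLabel (labelled f X) A 1 := ⟨i, hA, hl⟩
      simp [this]
  induction r generalizing A with
  | zero =>
    rw [learntPartial]
    split_ifs with h
    · simp
    · exact hpure A hA h
  | succ r ih =>
    rw [learntPartial]
    split_ifs with h h1 h2
    · exact ih ((mem_split _).2 ⟨hA, by rw [coordVal_of_lt _ hi h1]; simp [labelled, h2]⟩)
    · exact ih ((mem_split _).2 ⟨hA, by rw [coordVal_of_lt _ hi h1]; simp [labelled, h2]⟩)
    · simp
    · exact hpure A hA h

/-- If the examples in `A` agree in the coordinate `v`, then the learner does not query `v`. -/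
theorem learntPartial_update {s : ℕ} (hf : ComputableBySize f s) (d r : ℕ) {A : Finset ℕ}
    (hA : A ⊆ Finset.range q) (v : Fin n) (b : ℕ)
    (hv : ∀ i ∈ A, coordVal (labelled f X) q i v = b) (x : Cube n) (c : Bool) :
    learntPartial (labelled f X) (s + 1) d r A (Function.update x v c) =
      learntPartial (labelled f X) (s + 1) d r A x := by
  induction r generalizing A with
  | zero => simp only [learntPartial]
  | succ r ih =>
    simp only [learntPartial]
    by_cases h : Mixed (labelled f X) A
    swap
    · simp only [h, if_false]
    by_cases h1 : query (labelled f X) (s + 1) d (r + 1) A < n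
    swap
    · simp only [h1, dite_false]
    -- The queried variable takes both values on `A`, so it cannot be `v`, which is constant on `A`.
    obtain ⟨-, ⟨i, hi⟩, ⟨j, hj⟩, -⟩ := bestVar_spec hf (horizon d (r + 1) - 1) hA h
    rw [mem_split] at hi hj
    have hne : (⟨_, h1⟩ : Fin n) ≠ v := by
      rintro rfl
      have e1 := hv i hi.1
      have e2 := hv j hj.1
      have e3 := hi.2
      have e4 := hj.2
      simp only [query] at e1 e2
      omega
    simp only [h, h1, if_true, dite_true, Function.update_of_ne hne]
    rw [ih ((split_subset _ _ _ _).trans hA) fun i hi => hv i (split_subset _ _ _ _ hi),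
      ih ((split_subset _ _ _ _).trans hA) fun i hi => hv i (split_subset _ _ _ _ hi)]

/-- Half of the points at which a function that ignores the coordinate `v` has a given property
have a given value of this coordinate. -/
theorem two_mul_card_filter {α : Type*} [DecidableEq α] (g : Cube n → α) (a : α) (v : Fin n)
    (hg : ∀ x c, g (Function.update x v c) = g x) (b : Bool) :
    2 * (Finset.univ.filter fun x => x v = b ∧ g x = a).card =
      (Finset.univ.filter fun x => g x = a).card := by
  have h1 : (Finset.univ.filter fun x => x v = (!b) ∧ g x = a).card =
      (Finset.univ.filter fun x => x v = b ∧ g x = a).card := by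
    refine Finset.card_bij' (fun x _ => Function.update x v b) (fun x _ => Function.update x v (!b))
      ?_ ?_ ?_ ?_
    · intro x hx; simpa [hg x b] using (Finset.mem_filter.1 hx).2.2
    · intro x hx; simpa [hg x (!b)] using (Finset.mem_filter.1 hx).2.2
    · intro x hx
      have : x v = !b := by simp_all
      simp [← this]
    · intro x hx
      have : x v = b := by simp_all
      simp [← this]
  have h2 : (Finset.univ.filter fun x => g x = a) =
      (Finset.univ.filter fun x => x v = b ∧ g x = a) ∪
      (Finset.univ.filter fun x => x v = (!b) ∧ g x = a) := by
    ext x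
    cases b <;> cases h : x v <;> simp [h]
  rw [h2, Finset.card_union_of_disjoint, h1, two_mul]
  rw [Finset.disjoint_filter]
  rintro x - ⟨h, -⟩ ⟨h', -⟩
  cases b <;> simp_all

/-- The weight of the mixed leaves: at every multiple of `d` levels the number of mixed leaves is
multiplied by at most `s`. -/
theorem card_none_mul_le {s : ℕ} (hf : ComputableBySize f s) {d : ℕ}
    (j h : ℕ) (h1 : 1 ≤ h) (hd : h ≤ d) {A : Finset ℕ}
    (hA : A ⊆ Finset.range q) (hne : A.Nonempty) :
    (Finset.univ.filter fun x => learntPartial (labelled f X) (s + 1) d (d * j + h) A x = none).card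
      * 2 ^ (d * j + h) ≤ splitCost (labelled f X) (s + 1) h A * s ^ j * 2 ^ n := by
  obtain ⟨r, hr⟩ : ∃ r, r = d * j + h := ⟨_, rfl⟩
  rw [← hr]
  induction r generalizing j h A with
  | zero => omega
  | succ r ih =>
    by_cases hm : Mixed (labelled f X) A
    swap
    · have : (Finset.univ.filter fun x => learntPartial (labelled f X) (s + 1) d (r + 1) A x = none)
          = ∅ := by
        ext x; simp [learntPartial, hm]
      rw [this]; simp
    have hq : query (labelled f X) (s + 1) d (r + 1) A
        = bestVar (labelled f X) (s + 1) (h - 1) A := by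
      rw [query, hr, horizon_mul_add h1 hd]
    obtain ⟨b1, b2, b3, b4⟩ := bestVar_spec hf (h - 1) hA hm
    rw [← hq] at b1 b2 b3 b4
    generalize hv : query (labelled f X) (s + 1) d (r + 1) A = v at b1 b2 b3 b4
    rw [Nat.sub_add_cancel h1] at b4
    -- The bound for a child with `h - 1` levels left in the block. Its cost adds up over the two
    -- children to the cost of `A`.
    have key : ∀ A' : Finset ℕ, A' ⊆ Finset.range q → A'.Nonempty →
        (Finset.univ.filter fun x => learntPartial (labelled f X) (s + 1) d r A' x = none).card
        * 2 ^ r ≤ splitCost (labelled f X) (s + 1) (h - 1) A' * s ^ j * 2 ^ n := by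
      intro A' hA' hne'
      by_cases hm' : Mixed (labelled f X) A'
      swap
      · have : (Finset.univ.filter fun x => learntPartial (labelled f X) (s + 1) d r A' x = none)
            = ∅ := by
          ext x; cases r <;> simp [learntPartial, hm']
        rw [this]; simp
      by_cases hh : h = 1
      · subst hh
        have hB : splitCost (labelled f X) (s + 1) (1 - 1) A' = 1 := by
          simp [splitCost, hne'.ne_empty, hm']
        rw [hB, one_mul]
        cases j with
        | zero =>
          have : r = 0 := by omega
          subst this
          simpa using Finset.card_filter_le (Finset.univ : Finset (Cube n)) _
        -- End of a block: a mixed child, counted once so far, becomes the root of a new block,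
        -- whose cost is at most `s`. This accounts for one factor of `s ^ (j + 1)`.
        | succ j =>
          have := ih j d (by omega) le_rfl hA' hne' (by rw [Nat.mul_succ] at hr; omega)
          refine this.trans ?_
          rw [pow_succ, mul_comm (s ^ j) s]
          exact Nat.mul_le_mul_right _ (Nat.mul_le_mul_right _
            (splitCost_le_of_computable hf _ hA' hne'))
      · exact ih j (h - 1) (by omega) (by omega) hA' hne' (by omega)
    have hs0 := (split_subset (labelled f X) A v 0).trans hA
    have hs1 := (split_subset (labelled f X) A v 1).trans hA
    have k0 := key _ hs0 b2
    have k1 := key _ hs1 b3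
    -- Below a child the variable `v` is not queried again, so exactly half of the undefined points
    -- of the child's function lie on its side of the cube. This supplies the factor `2` for the
    -- level.
    have c0 := two_mul_card_filter (learntPartial (labelled f X) (s + 1) d r
      (split (labelled f X) A v 0)) none ⟨v, b1⟩
      (learntPartial_update hf d r hs0 ⟨v, b1⟩ 0 fun i hi => ((mem_split _).1 hi).2) false
    have c1 := two_mul_card_filter (learntPartial (labelled f X) (s + 1) d r
      (split (labelled f X) A v 1)) none ⟨v, b1⟩
      (learntPartial_update hf d r hs1 ⟨v, b1⟩ 1 fun i hi => ((mem_split _).1 hi).2) true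
    have hu : (Finset.univ.filter fun x =>
        learntPartial (labelled f X) (s + 1) d (r + 1) A x = none)
        = (Finset.univ.filter fun x => x ⟨v, b1⟩ = false ∧ learntPartial (labelled f X) (s + 1) d r
          (split (labelled f X) A v 0) x = none) ∪
        (Finset.univ.filter fun x => x ⟨v, b1⟩ = true ∧ learntPartial (labelled f X) (s + 1) d r
          (split (labelled f X) A v 1) x = none) := by
      ext x
      simp only [Finset.mem_filter, Finset.mem_univ, true_and, Finset.mem_union, learntPartial, hm,
        if_true, hv, b1, dite_true]
      cases x ⟨v, b1⟩ <;> simp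
    have hu' := Finset.card_union_le
      (Finset.univ.filter fun x => x ⟨v, b1⟩ = false ∧ learntPartial (labelled f X) (s + 1) d r
          (split (labelled f X) A v 0) x = none)
      (Finset.univ.filter fun x => x ⟨v, b1⟩ = true ∧ learntPartial (labelled f X) (s + 1) d r
          (split (labelled f X) A v 1) x = none)
    rw [← hu] at hu'
    rw [← b4, add_mul, add_mul]
    refine le_trans ?_ (Nat.add_le_add k0 k1)
    rw [← add_mul, ← c0, ← c1, ← Nat.mul_add, pow_succ]
    calc _ ≤ _ := Nat.mul_le_mul_right _ hu'
      _ = _ := by ring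

end Consistent
end DTLearn

namespace DTLearn

/-! ### Generalization -/

section Generalization
open Classical

theorem uniformOn_real_eq {α : Type*} [Fintype α] [MeasurableSpace α]
    [MeasurableSingletonClass α] (s : Set α) :
    (ProbabilityTheory.uniformOn (Set.univ : Set α)).real s =
      ((Finset.univ.filter fun x => x ∈ s).card : ℝ) / Fintype.card α := by
  rw [MeasureTheory.measureReal_def, ProbabilityTheory.uniformOn_univ, ENNReal.toReal_div]
  have : s = ((Finset.univ.filter fun x => x ∈ s : Finset α) : Set α) := by ext; simp
  conv_lhs => rw [this]
  rw [MeasureTheory.Measure.count_apply_finset]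
  simp

theorem error_eq {n : ℕ} (g f : Cube n → Bool) :
    error g f = ((Finset.univ.filter fun x => g x ≠ f x).card : ℝ) / (2 ^ n : ℕ) := by
  rw [error, uniformOn_real_eq]
  simp

/-- The partial functions computed by trees of depth `r` with leaf labels `some b` or `none`. -/
noncomputable def partialTrees (n : ℕ) : ℕ → Finset (Cube n → Option Bool)
  | 0 => Finset.univ.image fun o _ => o
  | r + 1 => (Finset.univ.image fun o _ => o) ∪
      ((Finset.univ : Finset (Fin n)) ×ˢ partialTrees n r ×ˢ partialTrees n r).image
        fun p x => if x p.1 = true then p.2.2 x else p.2.1 x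

theorem const_mem_partialTrees (n r : ℕ) (o : Option Bool) : (fun _ => o) ∈ partialTrees n r := by
  cases r with
  | zero => exact Finset.mem_image_of_mem (fun o (_ : Cube n) => o) (Finset.mem_univ o)
  | succ r =>
    exact Finset.mem_union_left _
      (Finset.mem_image_of_mem (fun o (_ : Cube n) => o) (Finset.mem_univ o))

/-- With `N` functions at depth `r` there are at most `3 + n * N ^ 2 ≤ (n + 3) * N ^ 2` at depth `r
+ 1`. The extra factor `n + 3` turns this recursion into plain squaring. -/
theorem card_partialTrees_mul_le (n r : ℕ) :
    (partialTrees n r).card * (n + 3) ≤ (n + 3) ^ 2 ^ (r + 1) := by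
  have hc : ((Finset.univ : Finset (Option Bool)).image fun o (_ : Cube n) => o).card ≤ 3 :=
    Finset.card_image_le
  induction r with
  | zero =>
    rw [partialTrees, zero_add, pow_one, sq]
    exact Nat.mul_le_mul_right _ (by omega)
  | succ r ih =>
    have h1 : (partialTrees n (r + 1)).card ≤ 3 + n * ((partialTrees n r).card *
        (partialTrees n r).card) := by
      rw [partialTrees]
      refine (Finset.card_union_le _ _).trans (Nat.add_le_add hc ?_)
      refine Finset.card_image_le.trans ?_
      simp [Finset.card_product]
    have h2 : 1 ≤ (partialTrees n r).card :=
      Finset.card_pos.2 ⟨_, const_mem_partialTrees n r none⟩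
    have h3 := Nat.mul_le_mul ih ih
    rw [← pow_add, ← two_mul, ← pow_succ'] at h3
    refine le_trans ?_ h3
    generalize (partialTrees n r).card = N at *
    generalize (partialTrees n (r + 1)).card = N' at *
    have h4 : 1 ≤ N * N := Nat.mul_pos h2 h2
    calc N' * (n + 3) ≤ (3 + n * (N * N)) * (n + 3) := Nat.mul_le_mul_right _ h1
      _ ≤ (3 * (N * N) + n * (N * N)) * (n + 3) := Nat.mul_le_mul_right _ (by omega)
      _ = _ := by ring

theorem card_partialTrees_le (n r : ℕ) :
    (partialTrees n r).card ≤ (n + 3) ^ 2 ^ (r + 1) :=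
  le_trans (Nat.le_mul_of_pos_right _ (by omega)) (card_partialTrees_mul_le n r)

/-- The learnt function depends on the sample, but it lies in a finite class that does not; the
union bound is taken over that class. -/
theorem learntPartial_mem {n q : ℕ} (S : Fin q → Cube n × Bool) (I d r : ℕ) (A : Finset ℕ) :
    learntPartial S I d r A ∈ partialTrees n r := by
  induction r generalizing A with
  | zero =>
    have : learntPartial S I d 0 A =
        fun _ => if Mixed S A then none else some (decide (HasLabel S A 1)) := by
      ext1 x; rw [learntPartial]
    rw [this]
    exact const_mem_partialTrees _ _ _
  | succ r ih =>
    by_cases h : Mixed S A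
    swap
    · have : learntPartial S I d (r + 1) A = fun _ => some (decide (HasLabel S A 1)) := by
        ext1 x; rw [learntPartial, if_neg h]
      rw [this]
      exact const_mem_partialTrees _ _ _
    by_cases h1 : query S I d (r + 1) A < n
    swap
    · have : learntPartial S I d (r + 1) A = fun _ => none := by
        ext1 x; rw [learntPartial, if_pos h, dif_neg h1]
      rw [this]
      exact const_mem_partialTrees _ _ _
    refine Finset.mem_union_right _ (Finset.mem_image.2 ⟨(⟨_, h1⟩,
      learntPartial S I d r (split S A (query S I d (r + 1) A) 0),
      learntPartial S I d r (split S A (query S I d (r + 1) A) 1)), ?_, ?_⟩)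
    · exact Finset.mem_product.2 ⟨Finset.mem_univ _, Finset.mem_product.2 ⟨ih _, ih _⟩⟩
    · ext1 x; rw [learntPartial, if_pos h, dif_pos h1]

theorem card_none_mul_two_pow_le {n q : ℕ} {f : Cube n → Bool} {X : Fin q → Cube n} {s : ℕ}
    (hf : ComputableBySize f s) {l k : ℕ} (hl : 1 ≤ l) (hs : s ≤ 2 ^ l) (hq : 0 < q) :
    (Finset.univ.filter fun x => learntPartial (labelled f X) (s + 1) (2 * l) (2 * l * k)
      (Finset.range q) x = none).card * 2 ^ (l * k) ≤ 2 ^ n := by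
  cases k with
  | zero =>
    simpa using Finset.card_filter_le (Finset.univ : Finset (Cube n)) _
  | succ k =>
    have hne : (Finset.range q).Nonempty := ⟨0, Finset.mem_range.2 hq⟩
    have h := card_none_mul_le (X := X) hf (d := 2 * l) k (2 * l) (by omega) le_rfl
      (Finset.Subset.refl (Finset.range q)) hne
    rw [← Nat.mul_succ] at h
    have h2 : splitCost (labelled f X) (s + 1) (2 * l) (Finset.range q) * s ^ k
        ≤ 2 ^ (l * (k + 1)) := by
      calc _ ≤ s * s ^ k := Nat.mul_le_mul_right _
            (splitCost_le_of_computable hf _ (Finset.Subset.refl _) hne)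
        _ = s ^ (k + 1) := by ring
        _ ≤ (2 ^ l) ^ (k + 1) := Nat.pow_le_pow_left hs _
        _ = _ := by rw [← pow_mul]
    -- Half of the levels pays for the growth `s ^ (k + 1)` of the number of mixed leaves; the other
    -- half is the gain.
    have h3 : 2 ^ (2 * l * (k + 1)) = 2 ^ (l * (k + 1)) * 2 ^ (l * (k + 1)) := by
      rw [← pow_add]; congr 1; ring
    rw [Nat.succ_eq_add_one] at h
    rw [h3, ← mul_assoc] at h
    have h4 := h.trans (Nat.mul_le_mul_right _ h2)
    rw [mul_comm (2 ^ (l * (k + 1))) (2 ^ n)] at h4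
    exact Nat.le_of_mul_le_mul_right h4 (by positivity)

/-- The probability that a fixed hypothesis with many wrong values is consistent with the
sample. -/
theorem card_consistent_le {n q : ℕ} (W : Finset (Cube n)) {c : ℕ} (hc : 0 < c)
    (hW : 2 ^ n < W.card * c) {M : ℕ} (hq : q = M * c) :
    ((Finset.univ.filter fun X : Fin q → Cube n => ∀ i, X i ∉ W).card : ℝ) * 2 ^ M ≤
      Fintype.card (Fin q → Cube n) := by
  have h1 : (Finset.univ.filter fun X : Fin q → Cube n => ∀ i, X i ∉ W)
      = Fintype.piFinset fun _ => Wᶜ := by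
    ext X; simp [Fintype.mem_piFinset]
  rw [h1, Fintype.card_piFinset, Finset.prod_const, Fintype.card_fun, Finset.card_univ,
    Fintype.card_fin]
  have hN : Fintype.card (Cube n) = 2 ^ n := by simp
  -- One example avoids `W` with probability at most `1 - 1/c ≤ exp (-1/c)`.
  have h2 : ((Wᶜ.card : ℕ) : ℝ) ≤ Fintype.card (Cube n) * Real.exp (-(1 / c)) := by
    have h3 : ((Wᶜ.card : ℕ) : ℝ) = (Fintype.card (Cube n) : ℝ) - W.card := by
      rw [Finset.card_compl, Nat.cast_sub (Finset.card_le_univ W)]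
    have h4 : (2 : ℝ) ^ n ≤ W.card * c := by exact_mod_cast hW.le
    have h5 : (2 : ℝ) ^ n * (1 / c) ≤ W.card := by
      rw [mul_one_div, div_le_iff₀ (by exact_mod_cast hc)]; exact h4
    have h6 := Real.add_one_le_exp (-(1 / (c : ℝ)))
    have h7 : (0 : ℝ) ≤ 2 ^ n := by positivity
    rw [h3, hN]
    push_cast
    nlinarith [mul_le_mul_of_nonneg_left h6 h7]
  -- Each group of `c` examples contributes a factor `exp (-1) ≤ 1/2`, and there are `M` groups.
  have h8 : (Real.exp (-(1 / c))) ^ q * 2 ^ M ≤ 1 := by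
    rw [hq, mul_comm M c, pow_mul, ← Real.exp_nat_mul, ← mul_pow]
    refine pow_le_one₀ (by positivity) ?_
    have : (c : ℝ) * -(1 / c) = -1 := by
      have : (c : ℝ) ≠ 0 := by exact_mod_cast hc.ne'
      field_simp
    rw [this, Real.exp_neg]
    have := Real.add_one_le_exp (1 : ℝ)
    rw [inv_mul_le_iff₀ (Real.exp_pos _)]
    linarith
  push_cast
  calc ((Wᶜ.card : ℕ) : ℝ) ^ q * 2 ^ M
      ≤ ((Fintype.card (Cube n) : ℝ) * Real.exp (-(1 / c))) ^ q * 2 ^ M := by gcongr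
    _ = (Fintype.card (Cube n) : ℝ) ^ q * ((Real.exp (-(1 / c))) ^ q * 2 ^ M) := by ring
    _ ≤ (Fintype.card (Cube n) : ℝ) ^ q * 1 := by gcongr
    _ = _ := by rw [mul_one]

/-- The error is at most the weight of the mixed leaves plus the weight of the wrong values. The
first is at most `1/(2E)` on every sample. In the sample size, the term with `g` pays for the union
bound over the class, and `D` leaves a failure probability `2 ^ (-D) ≤ δ`. -/
theorem prob_error_learnt_le {n q : ℕ} {f : Cube n → Bool} {s : ℕ}
    (hf : ComputableBySize f s) {l k g D E : ℕ} {ε δ : ℝ} (hl : 1 ≤ l) (hs : s ≤ 2 ^ l)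
    (hE : 0 < E) (hk : 2 * E ≤ 2 ^ (l * k)) (hg : n + 3 ≤ 2 ^ g)
    (hq : q = (2 ^ (2 * l * k + 1) * g + D) * (2 * E)) (hε : 1 / (E : ℝ) ≤ ε)
    (hδ : 1 ≤ δ * 2 ^ D) :
    1 - δ ≤ (ProbabilityTheory.uniformOn (Set.univ : Set (Fin q → Cube n))).real
      {X | error (learnt (labelled f X) (s + 1) (2 * l) (2 * l * k) (Finset.range q)).eval f
        ≤ ε} := by
  -- An empty sample would have cost `I`, so the bound on the mixed leaves needs at least one
  -- example.
  have hq0 : 0 < q := by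
    have : g ≠ 0 := by rintro rfl; simp at hg
    rw [hq]
    exact Nat.mul_pos (Nat.add_pos_left (Nat.mul_pos (by positivity) (by omega)) _) (by omega)
  let wrong : (Cube n → Option Bool) → Finset (Cube n) := fun h =>
    Finset.univ.filter fun x => h x = some (!f x)
  let bad : Finset (Cube n → Option Bool) := (partialTrees n (2 * l * k)).filter fun h =>
    2 ^ n < (wrong h).card * (2 * E)
  have hN : Fintype.card (Cube n) = 2 ^ n := by simp
  have hsub : (Finset.univ.filter fun X : Fin q → Cube n => ¬ (X ∈ {X : Fin q → Cube n |
      error (learnt (labelled f X) (s + 1) (2 * l) (2 * l * k) (Finset.range q)).eval f ≤ ε})) ⊆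
      bad.biUnion fun h => Finset.univ.filter fun X : Fin q → Cube n => ∀ i, X i ∉ wrong h := by
    intro X hX
    have hX' := (Finset.mem_filter.1 hX).2
    rw [Set.mem_ofPred_eq, not_le, error_eq] at hX'
    refine Finset.mem_biUnion.2 ⟨learntPartial (labelled f X) (s + 1) (2 * l) (2 * l * k)
      (Finset.range q), Finset.mem_filter.2 ⟨learntPartial_mem _ _ _ _ _, ?_⟩,
      Finset.mem_filter.2 ⟨Finset.mem_univ _, fun i hi => ?_⟩⟩
    · have h1 := card_none_mul_two_pow_le (X := X) hf hl hs hq0 (k := k)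
      have h2 : (Finset.univ.filter fun x => (learnt (labelled f X) (s + 1) (2 * l)
          (2 * l * k) (Finset.range q)).eval x ≠ f x) ⊆
          (Finset.univ.filter fun x => learntPartial (labelled f X) (s + 1) (2 * l) (2 * l * k)
            (Finset.range q) x = none) ∪
          wrong (learntPartial (labelled f X) (s + 1) (2 * l) (2 * l * k) (Finset.range q)) := by
        intro x hx
        have hx' := (Finset.mem_filter.1 hx).2
        cases ho : learntPartial (labelled f X) (s + 1) (2 * l) (2 * l * k) (Finset.range q) x with
        | none => exact Finset.mem_union_left _ (Finset.mem_filter.2 ⟨Finset.mem_univ _, ho⟩)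
        | some b =>
          refine Finset.mem_union_right _ (Finset.mem_filter.2 ⟨Finset.mem_univ _, ?_⟩)
          rw [ho, ← eval_learnt _ _ _ _ _ _ _ ho]
          congr 1
          revert hx'
          cases (learnt (labelled f X) (s + 1) (2 * l) (2 * l * k) (Finset.range q)).eval x <;>
            cases f x <;> simp
      have h3 := (Finset.card_le_card h2).trans (Finset.card_union_le _ _)
      generalize (Finset.univ.filter fun x => (learnt (labelled f X) (s + 1) (2 * l)
          (2 * l * k) (Finset.range q)).eval x ≠ f x).card = a at *
      generalize (Finset.univ.filter fun x => learntPartial (labelled f X) (s + 1) (2 * l)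
        (2 * l * k) (Finset.range q) x = none).card = b at *
      generalize (wrong (learntPartial (labelled f X) (s + 1) (2 * l) (2 * l * k)
        (Finset.range q))).card = c at *
      have h4 : 2 ^ n < a * E := by
        have h5 := hε.trans_lt hX'
        rw [div_lt_div_iff₀ (by exact_mod_cast hE) (by positivity)] at h5
        have h6 : (1 * (2 ^ n : ℕ) : ℝ) = ((2 ^ n : ℕ) : ℝ) := one_mul _
        rw [h6] at h5
        exact_mod_cast h5
      -- With `a` errors, `b` undefined and `c` wrong points: `a ≤ b + c`, `a * E > 2 ^ n` and `b *
      -- (2 * E) ≤ 2 ^ n` force `c * (2 * E) > 2 ^ n`.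
      have h7 := (Nat.mul_le_mul_left b hk).trans h1
      have h8 := Nat.mul_le_mul_right (2 * E) h3
      rw [add_mul] at h8
      have h9 : a * (2 * E) = 2 * (a * E) := by ring
      omega
    · exact learntPartial_sample _ _ _ i.2 (Finset.mem_range.2 i.2) (Finset.mem_filter.1 hi).2
  have hcard := (Finset.card_le_card hsub).trans Finset.card_biUnion_le
  have hsum : ((∑ h ∈ bad, (Finset.univ.filter fun X : Fin q → Cube n =>
      ∀ i, X i ∉ wrong h).card : ℕ) : ℝ) * 2 ^ D ≤ Fintype.card (Fin q → Cube n) := by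
    set M := 2 ^ (2 * l * k + 1) * g + D with hM
    have h1 : ((∑ h ∈ bad, (Finset.univ.filter fun X : Fin q → Cube n =>
        ∀ i, X i ∉ wrong h).card : ℕ) : ℝ) * 2 ^ M ≤
        bad.card * Fintype.card (Fin q → Cube n) := by
      push_cast
      rw [Finset.sum_mul, ← nsmul_eq_mul]
      refine Finset.sum_le_card_nsmul _ _ _ fun h hh => ?_
      have := card_consistent_le (wrong h) (c := 2 * E) (by omega) (Finset.mem_filter.1 hh).2 hq
      exact_mod_cast this
    have h2 : (bad.card : ℝ) ≤ 2 ^ (2 ^ (2 * l * k + 1) * g) := by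
      have h3 : bad.card ≤ 2 ^ (2 ^ (2 * l * k + 1) * g) := by
        calc bad.card ≤ (partialTrees n (2 * l * k)).card :=
              Finset.card_le_card (Finset.filter_subset _ _)
          _ ≤ (n + 3) ^ 2 ^ (2 * l * k + 1) := card_partialTrees_le _ _
          _ ≤ (2 ^ g) ^ 2 ^ (2 * l * k + 1) := Nat.pow_le_pow_left hg _
          _ = _ := by rw [← pow_mul, mul_comm]
      exact_mod_cast h3
    rw [hM, pow_add] at h1
    have h4 := h1.trans (mul_le_mul_of_nonneg_right h2 (Nat.cast_nonneg _))
    rw [mul_left_comm] at h4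
    exact le_of_mul_le_mul_left h4 (by positivity)
  have hpos : (0 : ℝ) < Fintype.card (Fin q → Cube n) := by
    exact_mod_cast Fintype.card_pos
  rw [uniformOn_real_eq, le_div_iff₀ hpos]
  have htot := Finset.card_filter_add_card_filter_not (s := (Finset.univ : Finset (Fin q → Cube n)))
    (fun X => X ∈ {X : Fin q → Cube n | error (learnt (labelled f X) (s + 1) (2 * l)
      (2 * l * k) (Finset.range q)).eval f ≤ ε})
  rw [Finset.card_univ] at htot
  generalize Fintype.card (Fin q → Cube n) = N at *
  generalize (Finset.univ.filter fun X : Fin q → Cube n => X ∈ {X : Fin q → Cube n |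
    error (learnt (labelled f X) (s + 1) (2 * l) (2 * l * k) (Finset.range q)).eval f ≤ ε}).card
      = a at *
  have hb : ((Finset.univ.filter fun X : Fin q → Cube n => ¬ (X ∈ {X : Fin q → Cube n |
      error (learnt (labelled f X) (s + 1) (2 * l) (2 * l * k) (Finset.range q)).eval f
        ≤ ε})).card : ℝ) * 2 ^ D ≤ N :=
    le_trans (mul_le_mul_of_nonneg_right (by exact_mod_cast hcard) (by positivity)) hsum
  generalize (Finset.univ.filter fun X : Fin q → Cube n => ¬ (X ∈ {X : Fin q → Cube n |
      error (learnt (labelled f X) (s + 1) (2 * l) (2 * l * k) (Finset.range q)).eval f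
        ≤ ε})).card = b at *
  have hb' : (b : ℝ) ≤ δ * N := by
    have h2 : (0 : ℝ) < 2 ^ D := by positivity
    have h3 : (0 : ℝ) ≤ N := by positivity
    have : (b : ℝ) * 2 ^ D ≤ (δ * N) * 2 ^ D := by
      calc _ ≤ (N : ℝ) := hb
        _ ≤ (δ * 2 ^ D) * N := by nlinarith
        _ = _ := by ring
    exact le_of_mul_le_mul_right this h2
  have : (N : ℝ) = a + b := by exact_mod_cast htot.symm
  rw [this] at hb' ⊢
  linarith

end Generalization
end DTLearn

namespace DTLearn

/-! ### The program: examples that follow the current path -/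

infixr:60 " ;; " => Prog.seq

/-- The content of a register. -/
abbrev reg (k : ℕ) : Expr := .load (.const k)

/-- Assignment to a register. -/
abbrev setReg (k : ℕ) (e : Expr) : Prog := .store (.const k) e

/-- The cell at distance `j` below the top of the stack, to which register `9` points. -/
abbrev below (j : ℕ) : Expr := .minus (reg 9) (.const j)

/-- `σ'` differs from `σ` only in cells outside `R`. -/
structure Same (R : ℕ → Prop) (σ σ' : State) : Prop where
  drawn : σ'.drawn = σ.drawn
  out : σ'.out = σ.out
  mem : ∀ a, R a → σ'.mem a = σ.mem a

theorem Same.refl (R : ℕ → Prop) (σ : State) : Same R σ σ := ⟨rfl, rfl, fun _ _ => rfl⟩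

theorem Same.trans {R R' R'' : ℕ → Prop} {σ σ' σ'' : State} (h : Same R σ σ')
    (h' : Same R' σ' σ'') (h1 : ∀ a, R'' a → R a ∧ R' a) : Same R'' σ σ'' :=
  ⟨h'.drawn.trans h.drawn, h'.out.trans h.out,
    fun a ha => (h'.mem a (h1 a ha).2).trans (h.mem a (h1 a ha).1)⟩

/-- Compare the current example with one stack frame. -/
def checkFrame : Prog :=
  .ite (.plus (.minus (.coord (reg 10) (.load (reg 11))) (.load (.plus (reg 11) (.const 1))))
      (.minus (.load (.plus (reg 11) (.const 1))) (.coord (reg 10) (.load (reg 11)))))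
    (setReg 12 (.const 0)) .skip ;;
  setReg 11 (.plus (reg 11) (.const 5))

/-- Does the current example follow the path on the stack? If so, record its label. -/
def checkExample : Prog :=
  (setReg 12 (.const 1) ;; setReg 11 (.const 32)) ;;
  .loop (.minus (reg 9) (reg 11)) checkFrame ;;
  .ite (reg 12) (.ite (.label (reg 10)) (setReg 14 (.const 1)) (setReg 13 (.const 1))) .skip ;;
  setReg 10 (.plus (reg 10) (.const 1))

/-- Record in the registers `13` and `14` which labels occur among the examples that follow the
path on the stack. -/
def findLabels : Prog :=
  (setReg 13 (.const 0) ;; setReg 14 (.const 0) ;; setReg 10 (.const 0)) ;;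
  .loop (.minus (reg 7) (reg 10)) checkExample

/-! ### Paths on the stack and the scan of the sample. -/

section FindLabels
variable {n q : ℕ} (S : Fin q → Cube n × Bool) (B : Lim)

/-- The example `i` follows the path that is stored in the first `L` stack frames. -/
def Follows (m : ℕ → ℕ) (L i : ℕ) : Prop :=
  ∀ j < L, coordVal S q i (m (5 * j + 32)) = m (5 * j + 33)

open Classical in
/-- The examples that follow the path which is stored in the first `L` stack frames. -/
noncomputable def active (m : ℕ → ℕ) (L : ℕ) : Finset ℕ :=
  (Finset.range q).filter (Follows S m L)

/-- The limits leave room for `Λ` stack frames, for the number of examples, and for costs. -/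
structure Room (n q I Λ : ℕ) (B : Lim) : Prop where
  addr : 5 * Λ + 37 ≤ B.addr
  val : 5 * Λ + 37 + q + 2 * I + n ≤ B.val

variable {S B} {I Λ : ℕ}

theorem Follows.congr {m m' : ℕ → ℕ} {L : ℕ} (h : ∀ a, 32 ≤ a → a < 5 * L + 32 → m' a = m a)
    (i : ℕ) : Follows S m' L i ↔ Follows S m L i := by
  refine forall₂_congr fun j hj => ?_
  rw [h _ (by omega) (by omega), h _ (by omega) (by omega)]

/-- The active set is read off the frames of the path alone. Work in the registers, or on the stack
above the path, does not disturb it. -/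
theorem active_congr {m m' : ℕ → ℕ} {L : ℕ} (h : ∀ a, 32 ≤ a → a < 5 * L + 32 → m' a = m a) :
    active S m' L = active S m L := by
  classical
  exact Finset.filter_congr fun i _ => Follows.congr h i

theorem follows_succ {m : ℕ → ℕ} {L i : ℕ} : Follows S m (L + 1) i ↔
    Follows S m L i ∧ coordVal S q i (m (5 * L + 32)) = m (5 * L + 33) := by
  constructor
  · exact fun h => ⟨fun j hj => h j (by omega), h L (by omega)⟩
  · rintro ⟨h1, h2⟩ j hj
    rcases Nat.lt_succ_iff_lt_or_eq.1 hj with hj | rfl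
    · exact h1 j hj
    · exact h2

/-- Pushing a frame onto the stack is a split of the active set; this links the stack to the
recursion of `splitCost` and `tokens`. -/
theorem active_succ (m : ℕ → ℕ) (L : ℕ) : active S m (L + 1) =
    split S (active S m L) (m (5 * L + 32)) (m (5 * L + 33)) := by
  ext i
  simp only [active, mem_split, Finset.mem_filter, follows_succ, and_assoc]

theorem active_zero (m : ℕ → ℕ) : active S m 0 = Finset.range q := by
  classical
  exact Finset.filter_true_of_mem fun i _ j hj => absurd hj (Nat.not_lt_zero j)

open Classical in
-- The inner loop keeps in register `12` whether the first `j` frames agree with the example;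
-- equality of two numbers is tested by the sum of their two truncated differences.
theorem checkExample_spec {σ : State} (hB : Room n q I Λ B) (h : σ.Within B) {L i : ℕ}
    (hL : L ≤ Λ) (hi : i < q) (hd : σ.drawn = q) (hp : σ.mem 9 = 5 * L + 32)
    (hi' : σ.mem 10 = i) :
    Ensures S B checkExample σ (60 * Λ + 60) fun σ' =>
      Same (fun a => a < 10 ∨ 15 ≤ a) σ σ' ∧ σ'.mem 10 = i + 1 ∧
      σ'.mem 13 = (if Follows S σ.mem L i ∧ labelVal S q i = 0 then 1 else σ.mem 13) ∧
      σ'.mem 14 = (if Follows S σ.mem L i ∧ labelVal S q i = 1 then 1 else σ.mem 14) := by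
  obtain ⟨hB1, hB2⟩ := hB
  unfold checkExample
  refine Ensures.wp_seq (60 * Λ + 50) h (by simp only [loopFreeTime, Expr.cost]; omega)
      ⟨by simp [Expr.eval]; omega, by simp [Expr.eval]; omega, by simp [Expr.eval]; omega,
        by simp [Expr.eval]; omega, fun h1 => Ensures.seq (60 * Λ + 10) 40 (by omega)
          ((Ensures.loop 40 (fun j σ' => Same (fun a => a < 11 ∨ 13 ≤ a) σ σ' ∧
            σ'.mem 11 = 5 * j + 32 ∧ σ'.mem 12 = if Follows S σ.mem j i then 1 else 0) L
            (by simp only [Expr.cost]; omega) h1 ?_ ?_ ?_).mono le_rfl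
          fun σ' h2 hI => Ensures.wp h2 (by decide) ?_)⟩
  · refine ⟨⟨rfl, rfl, fun a ha => ?_⟩, ?_, ?_⟩
    · simp only [Expr.eval, Finsupp.coe_update, Function.update_apply]
      split_ifs <;> omega
    · simp [Expr.eval]
    · simp [Expr.eval, Follows]
  · rintro σ' ⟨h1, h2, -⟩
    simp only [Expr.eval]
    rw [h1.mem 9 (by omega)]
    omega
  · rintro j hj σ' h' ⟨h1, h2, h3⟩
    have e9 := h1.mem 9 (by omega)
    have e10 := h1.mem 10 (by omega)
    have ev := h1.mem (5 * j + 32) (by omega)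
    have eb := h1.mem (5 * j + 33) (by omega)
    refine ⟨by simp only [Expr.eval]; omega, Ensures.wp h' (by decide) ?_⟩
    have e33 : 5 * j + 32 + 1 = 5 * j + 33 := by omega
    simp only [checkFrame, wp, Expr.eval, h2, e10, hi', h1.drawn, hd, ev, e33, eb]
    refine ⟨fun hc => ⟨by omega, by omega, ?_⟩, fun hc => ?_⟩
    · refine ⟨by omega, ?_, ⟨hd.symm, h1.out, fun a ha => ?_⟩, ?_, ?_⟩
      · simp [h2]; omega
      · simp only [Finsupp.coe_update, Function.update_apply]
        split_ifs <;> first | omega | exact h1.mem a (by omega)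
      · simp [h2]; omega
      · have : ¬ Follows S σ.mem (j + 1) i := by
          rw [follows_succ]; rintro ⟨-, h5⟩; omega
        simp [this]
    · refine ⟨by omega, by omega, ⟨hd.symm, h1.out, fun a ha => ?_⟩, ?_, ?_⟩
      · simp only [Finsupp.coe_update, Function.update_apply]
        split_ifs <;> first | omega | exact h1.mem a (by omega)
      · simp; omega
      · have : Follows S σ.mem (j + 1) i ↔ Follows S σ.mem j i := by
          rw [follows_succ, and_iff_left_iff_imp]; intro; omega
        simp [this, h3]
  · obtain ⟨h1, h2, h3⟩ := hI
    have e10 := h1.mem 10 (by omega)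
    have e13 := h1.mem 13 (by omega)
    have e14 := h1.mem 14 (by omega)
    have hl := labelVal_le_one S q i
    have hm : ∀ a, a < 10 ∨ 15 ≤ a → σ'.mem a = σ.mem a := fun a ha => h1.mem a (by omega)
    simp only [wp, Expr.eval, e10, hi', h1.drawn, hd, h3]
    refine ⟨fun hc => ⟨fun hc' => ⟨by omega, by omega, by omega, ?_, ?_⟩,
      fun hc' => ⟨by omega, by omega, by omega, ?_, ?_⟩⟩, fun hc => ⟨by omega, by omega, ?_⟩⟩
    · simp [e10]; omega
    · have hF : Follows S σ.mem L i := by by_contra hF; simp [hF] at hc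
      have hl1 : labelVal S q i = 1 := by omega
      refine ⟨⟨hd.symm, h1.out, fun a ha => ?_⟩, ?_, ?_, ?_⟩
      · simp only [Finsupp.coe_update, Function.update_apply]
        split_ifs <;> first | omega | exact hm a ha
      · simp [e10]; omega
      · simp [e13, hl1]
      · simp [hl1, hF]
    · simp [e10]; omega
    · have hF : Follows S σ.mem L i := by by_contra hF; simp [hF] at hc
      refine ⟨⟨hd.symm, h1.out, fun a ha => ?_⟩, ?_, ?_, ?_⟩
      · simp only [Finsupp.coe_update, Function.update_apply]
        split_ifs <;> first | omega | exact hm a ha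
      · simp [e10]; omega
      · simp [hc', hF]
      · simp [hc', e14]
    · have hF : ¬ Follows S σ.mem L i := by by_contra hF; simp [hF] at hc
      refine ⟨⟨hd.symm, h1.out, fun a ha => ?_⟩, ?_, ?_, ?_⟩
      · simp only [Finsupp.coe_update, Function.update_apply]
        split_ifs <;> first | omega | exact hm a ha
      · simp
      · simp [hF, e13]
      · simp [hF, e14]

open Classical in
theorem findLabels_spec {σ : State} (hB : Room n q I Λ B) (h : σ.Within B) {L : ℕ}
    (hL : L ≤ Λ) (hd : σ.drawn = q) (hp : σ.mem 9 = 5 * L + 32) (hq : σ.mem 7 = q) :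
    Ensures S B findLabels σ (q * (60 * Λ + 70) + 20) fun σ' =>
      Same (fun a => a < 10 ∨ 15 ≤ a) σ σ' ∧
      σ'.mem 13 = (if HasLabel S (active S σ.mem L) 0 then 1 else 0) ∧
      σ'.mem 14 = (if HasLabel S (active S σ.mem L) 1 then 1 else 0) := by
  have hB1 := hB.addr
  have hB2 := hB.val
  -- The scan is an induction on the examples below `i`: the labels seen so far are those of active
  -- examples with smaller number.
  have hstep : ∀ i < q, ∀ y, HasLabel S ((active S σ.mem L).filter (· < i + 1)) y ↔
      (Follows S σ.mem L i ∧ labelVal S q i = y) ∨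
        HasLabel S ((active S σ.mem L).filter (· < i)) y := by
    intro i hi y
    simp only [HasLabel, Finset.mem_filter, active, Finset.mem_range]
    constructor
    · rintro ⟨j, ⟨⟨h1, h2⟩, h3⟩, h4⟩
      rcases Nat.lt_succ_iff_lt_or_eq.1 h3 with h3 | rfl
      · exact .inr ⟨j, ⟨⟨h1, h2⟩, h3⟩, h4⟩
      · exact .inl ⟨h2, h4⟩
    · rintro (⟨h1, h2⟩ | ⟨j, ⟨⟨h1, h2⟩, h3⟩, h4⟩)
      · exact ⟨i, ⟨⟨hi, h1⟩, by omega⟩, h2⟩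
      · exact ⟨j, ⟨⟨h1, h2⟩, by omega⟩, h4⟩
  have hall : (active S σ.mem L).filter (· < q) = active S σ.mem L :=
    Finset.filter_true_of_mem fun i hi => Finset.mem_range.1 (Finset.mem_filter.1 hi).1
  unfold findLabels
  refine Ensures.wp_seq (q * (60 * Λ + 70) + 10) h (by simp only [loopFreeTime, Expr.cost]; omega)
    ⟨by simp [Expr.eval]; omega, by simp [Expr.eval], by simp [Expr.eval]; omega,
      by simp [Expr.eval], by simp [Expr.eval]; omega, by simp [Expr.eval],
      fun h1 => (Ensures.loop (60 * Λ + 60)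
        (fun j σ' => Same (fun a => a < 10 ∨ 15 ≤ a) σ σ' ∧ σ'.mem 10 = j ∧
          σ'.mem 13 = (if HasLabel S ((active S σ.mem L).filter (· < j)) 0 then 1 else 0) ∧
          σ'.mem 14 = (if HasLabel S ((active S σ.mem L).filter (· < j)) 1 then 1 else 0))
        q ?_ h1 ?_ ?_ ?_).mono le_rfl ?_⟩
  · simp only [Expr.cost]
    have : q * (1 + 1 + (1 + 1) + 1 + 1 + (60 * Λ + 60)) ≤ q * (60 * Λ + 70) :=
      Nat.mul_le_mul_left _ (by omega)
    omega
  · refine ⟨⟨rfl, rfl, fun a ha => ?_⟩, ?_, ?_, ?_⟩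
    · simp only [Expr.eval, Finsupp.coe_update, Function.update_apply]
      split_ifs <;> omega
    · simp [Expr.eval]
    · simp [Expr.eval, HasLabel]
    · simp [Expr.eval, HasLabel]
  · rintro σ' ⟨h1, h2, -⟩
    simp only [Expr.eval]
    rw [h1.mem 7 (by omega)]
    omega
  · rintro j hj σ' h' ⟨h1, h2, h3, h4⟩
    have e7 := h1.mem 7 (by omega)
    refine ⟨by simp only [Expr.eval]; omega, ?_⟩
    have hF : Follows S σ'.mem L j ↔ Follows S σ.mem L j :=
      Follows.congr (fun a ha _ => h1.mem a (by omega)) j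
    refine (checkExample_spec hB h' hL hj (h1.drawn.trans hd)
      ((h1.mem 9 (by omega)).trans hp) h2).mono le_rfl ?_
    rintro σ'' - ⟨k1, k2, k3, k4⟩
    refine ⟨h1.trans k1 fun a ha => ⟨ha, ha⟩, k2, ?_, ?_⟩
    · rw [k3, h3, hF]; simp only [hstep j hj]
      split_ifs <;> simp_all
    · rw [k4, h4, hF]; simp only [hstep j hj]
      split_ifs <;> simp_all
  · rintro σ' - ⟨h1, -, h3, h4⟩
    rw [hall] at h3 h4
    exact ⟨h1, h3, h4⟩

end FindLabels
end DTLearn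

namespace DTLearn

/-! ### The program: the cost of splitting

A stack frame consists of five cells: a variable, its value, the least cost so far, a variable
that attains it, and the cost for the value `0` of the variable. -/

/-- Open a new stack frame. -/
def pushFrame : Prog :=
  .store (reg 9) (.const 0) ;; .store (.plus (reg 9) (.const 1)) (.const 0) ;;
  .store (.plus (reg 9) (.const 2)) (reg 5) ;; .store (.plus (reg 9) (.const 3)) (.const 0) ;;
  setReg 9 (.plus (reg 9) (.const 5)) ;; setReg 18 (.minus (reg 18) (.const 1))

/-- Return the value of `e`. -/
def returnValue (e : Expr) : Prog := setReg 15 e ;; setReg 17 (.const 0)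

/-- Start to compute the cost of the current set of examples. -/
def costCall : Prog :=
  findLabels ;;
  .ite (reg 13)
    (.ite (reg 14) (.ite (reg 18) pushFrame (returnValue (.const 1))) (returnValue (.const 0)))
    (.ite (reg 14) (returnValue (.const 0)) (returnValue (reg 5)))

/-- Take over a returned cost into the topmost stack frame. -/
def costReturn : Prog :=
  .ite (.load (below 4))
    (setReg 15 (.plus (reg 15) (.load (below 1))) ;;
      .ite (.minus (.load (below 3)) (reg 15))
        (.store (below 3) (reg 15) ;; .store (below 2) (.load (below 5))) .skip ;;
      .store (below 5) (.plus (.load (below 5)) (.const 1)) ;;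
      .ite (.minus (reg 0) (.load (below 5)))
        (.store (below 4) (.const 0) ;; setReg 17 (.const 1))
        (setReg 15 (.load (below 3)) ;; setReg 16 (.load (below 2)) ;;
          setReg 18 (.plus (reg 18) (.const 1)) ;; setReg 9 (below 5)))
    (.store (below 1) (reg 15) ;; .store (below 4) (.const 1) ;; setReg 17 (.const 1))

def costBody : Prog := .ite (reg 17) costCall costReturn

/-- Nonzero while a call is pending (register `17`) or the stack is higher than at the start of the
search, whose height is kept in register `19`. -/
def costCond : Expr := .plus (reg 17) (.minus (reg 9) (reg 19))

/-- Compute the cost of splitting and an optimal variable. -/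
def costLoop : Prog := .loop costCond costBody

/-! ### Correctness and running time of the cost search. -/

section Cost
variable {n q : ℕ} {S : Fin q → Cube n × Bool} {B : Lim} {I Λ : ℕ}

/-- The registers are set for the computation of a cost with `h` levels left. -/
structure AtCall (n q I L h : ℕ) (σ : State) : Prop where
  drawn : σ.drawn = q
  dim : σ.mem 0 = n
  inf : σ.mem 5 = I
  count : σ.mem 7 = q
  top : σ.mem 9 = 5 * L + 32
  mode : σ.mem 17 = 1
  depth : σ.mem 18 = h
  start : σ.mem 19 ≤ 5 * L + 32

open Classical in
-- Either the two label flags settle the cost at once, or a frame is opened. The new frame holds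
-- variable `0`, value `0` and the pair `(I, 0)`, which is `best` over no variables.
theorem costCall_spec {σ : State} (hB : Room n q I Λ B) (hI : 1 ≤ I) (h : σ.Within B) {L k : ℕ}
    (hL : L + k ≤ Λ) (hσ : AtCall n q I L k σ) :
    Ensures S B costBody σ (q * (60 * Λ + 70) + 100) fun σ' =>
      if Mixed S (active S σ.mem L) ∧ 0 < k then
        Same (fun a => a < 9 ∨ 19 ≤ a ∧ a < 5 * L + 32) σ σ' ∧ AtCall n q I (L + 1) (k - 1) σ' ∧
          σ'.mem (5 * L + 32) = 0 ∧ σ'.mem (5 * L + 33) = 0 ∧ σ'.mem (5 * L + 34) = I ∧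
          σ'.mem (5 * L + 35) = 0
      else Same (fun a => a < 10 ∨ 18 ≤ a ∧ a < 5 * L + 32) σ σ' ∧ σ'.mem 17 = 0 ∧
        σ'.mem 15 = splitCost S I k (active S σ.mem L) := by
  obtain ⟨hd, h0, h5, h7, h9, h17, h18, h19⟩ := hσ
  have hB1 := hB.addr
  have hB2 := hB.val
  unfold costBody costCall
  refine (Ensures.ite (t := q * (60 * Λ + 70) + 80) (fun _ => ?_) fun hc => ?_).mono
    (by simp only [Expr.cost]; omega) fun _ _ h => h
  swap
  · simp [Expr.eval, h17] at hc
  refine Ensures.seq _ 60 (by omega) ((findLabels_spec hB h (by omega) hd h9 h7).mono le_rfl ?_)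
  rintro σ' h' ⟨hs, e13, e14⟩
  refine Ensures.wp h' (by decide) ?_
  have k5 := hs.mem 5 (by omega)
  have k9 := hs.mem 9 (by omega)
  have k18 := hs.mem 18 (by omega)
  generalize active S σ.mem L = A at *
  have hsame : ∀ a, (a < 10 ∨ 18 ≤ a ∧ a < 5 * L + 32) → σ'.mem a = σ.mem a :=
    fun a ha => hs.mem a (by omega)
  -- If neither label occurs, the set is empty; so the two flags suffice to recognise the case of
  -- cost `I`.
  have hempty : ¬ HasLabel S A 0 → ¬ HasLabel S A 1 → A = ∅ := by
    intro l0 l1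
    by_contra hne
    obtain ⟨i, hi⟩ := Finset.nonempty_iff_ne_empty.2 hne
    have := labelVal_le_one S q i
    rcases Nat.le_one_iff_eq_zero_or_eq_one.1 this with h | h
    · exact l0 ⟨i, hi, h⟩
    · exact l1 ⟨i, hi, h⟩
  have hne : ∀ y, HasLabel S A y → A.Nonempty := fun y ⟨i, hi, _⟩ => ⟨i, hi⟩
  have hret : ∀ e : Expr, e.eval S σ' ≤ B.val → ¬ (Mixed S A ∧ 0 < k) →
      e.eval S σ' = splitCost S I k A → wp S B (returnValue e) (fun σ' =>
      if Mixed S A ∧ 0 < k then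
        Same (fun a => a < 9 ∨ 19 ≤ a ∧ a < 5 * L + 32) σ σ' ∧ AtCall n q I (L + 1) (k - 1) σ' ∧
          σ'.mem (5 * L + 32) = 0 ∧ σ'.mem (5 * L + 33) = 0 ∧ σ'.mem (5 * L + 34) = I ∧
          σ'.mem (5 * L + 35) = 0
      else Same (fun a => a < 10 ∨ 18 ≤ a ∧ a < 5 * L + 32) σ σ' ∧ σ'.mem 17 = 0 ∧
        σ'.mem 15 = splitCost S I k A) σ' := by
    intro e he hm hv
    simp only [returnValue, wp, hm, if_false]
    refine ⟨by simp [Expr.eval]; omega, he, by simp [Expr.eval]; omega, by simp [Expr.eval],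
      ⟨hs.drawn, hs.out, fun a ha => ?_⟩, by simp [Expr.eval], by simp [Expr.eval, hv]⟩
    simp only [Expr.eval, Finsupp.coe_update, Function.update_apply]
    split_ifs <;> first | omega | exact hsame a ha
  refine ⟨fun c13 => ⟨fun c14 => ⟨fun c18 => ?_, fun c18 => ?_⟩, fun c14 => ?_⟩,
    fun c13 => ⟨fun c14 => ?_, fun c14 => ?_⟩⟩
  all_goals simp only [Expr.eval, e13, e14] at c13 c14
  all_goals simp only [ite_eq_right_iff, one_ne_zero, imp_false, ne_eq, not_not] at c13 c14
  · simp only [Expr.eval, k18, h18] at c18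
    have hm : Mixed S A ∧ 0 < k := ⟨⟨c13, c14⟩, by omega⟩
    simp only [hm, and_self, if_true]
    simp only [pushFrame, wp, Expr.eval]
    simp [k9, h9, k5, h5, k18, h18]
    refine ⟨by omega, by omega, by omega, by omega, by omega, by omega, by omega, by omega,
      by omega, ⟨hs.drawn, hs.out, fun a ha => ?_⟩,
      ⟨hs.drawn.trans hd, ?_, ?_, ?_, ?_, ?_, ?_, ?_⟩⟩
    · simp only [Finsupp.coe_update, Function.update_apply]
      split_ifs <;> first | omega | exact hs.mem a (by omega)
    · simp [hs.mem 0, h0]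
    · simp [k5, h5]
    · simp [hs.mem 7, h7]
    · simp; omega
    · simp [hs.mem 17, h17]
    · simp
    · simp [hs.mem 19]; omega
  · simp only [Expr.eval, k18, h18] at c18
    subst c18
    refine hret _ (by simp [Expr.eval]; omega) (by simp) ?_
    simp [Expr.eval, splitCost, (hne _ c13).ne_empty, show Mixed S A from ⟨c13, c14⟩]
  · have hm : ¬ Mixed S A := fun h => c14 h.2
    exact hret _ (by simp [Expr.eval]) (fun h => hm h.1)
      (by rw [splitCost_of_not_mixed _ _ _ (hne _ c13) hm]; rfl)
  · have hm : ¬ Mixed S A := fun h => c13 h.1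
    exact hret _ (by simp [Expr.eval]) (fun h => hm h.1)
      (by rw [splitCost_of_not_mixed _ _ _ (hne _ c14) hm]; rfl)
  · have hm : ¬ Mixed S A := fun h => c13 h.1
    refine hret _ (by simp [Expr.eval, k5, h5]; omega) (fun h => hm h.1) ?_
    rw [hempty c13 c14, splitCost_empty]
    simp [Expr.eval, k5, h5]

theorem costReturn_spec_zero {σ : State} (hB : Room n q I Λ B) (h : σ.Within B) {L : ℕ}
    (hL : L < Λ) (h9 : σ.mem 9 = 5 * L + 37) (h17 : σ.mem 17 = 0) (hb : σ.mem (5 * L + 33) = 0) :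
    Ensures S B costBody σ 100 fun σ' =>
      Same (fun a => a ≠ 17 ∧ a ≠ 5 * L + 33 ∧ a ≠ 5 * L + 36) σ σ' ∧ σ'.mem 17 = 1 ∧
        σ'.mem (5 * L + 33) = 1 ∧ σ'.mem (5 * L + 36) = σ.mem 15 := by
  have hB1 := hB.addr
  have hB2 := hB.val
  have h15 := h.val 15
  refine Ensures.wp h (by decide) ⟨fun hc => by simp [Expr.eval, h17] at hc, fun _ =>
    ⟨fun hc => by simp [Expr.eval, h9, hb] at hc, fun _ => ?_⟩⟩
  simp only [wp, Expr.eval]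
  simp [h9]
  refine ⟨by omega, by omega, by omega, by omega, by omega, by omega, ⟨rfl, rfl, fun a ha => ?_⟩⟩
  simp only [Finsupp.coe_update, Function.update_apply]
  split_ifs <;> omega

/-- Both children of `v` are done: the pair of least cost and its place makes one step of the
recursion `best`. Then either the next variable is started or the frame is popped and the pair is
returned in registers `15` and `16`. -/
theorem costReturn_spec_one {σ : State} (hB : Room n q I Λ B) (h : σ.Within B) {L v x y w : ℕ}
    (hL : L < Λ) (h0 : σ.mem 0 = n) (h9 : σ.mem 9 = 5 * L + 37) (h17 : σ.mem 17 = 0)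
    (h18 : σ.mem 18 < Λ) (hv : v < n)
    (hb : σ.mem (5 * L + 33) = 1) (hv' : σ.mem (5 * L + 32) = v) (hx : σ.mem (5 * L + 34) = x)
    (hy : σ.mem (5 * L + 35) = y) (hw : σ.mem 15 + σ.mem (5 * L + 36) = w) (hwI : w ≤ 2 * I)  :
    Ensures S B costBody σ 120 fun σ' =>
      if v + 1 < n then
        Same (fun a => a ≠ 17 ∧ a ≠ 15 ∧ (a < 5 * L + 32 ∨ 5 * L + 35 < a)) σ σ' ∧ σ'.mem 17 = 1 ∧
        σ'.mem (5 * L + 32) = v + 1 ∧ σ'.mem (5 * L + 33) = 0 ∧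
        (σ'.mem (5 * L + 34), σ'.mem (5 * L + 35)) = (if w < x then (w, v) else (x, y))
      else
        Same (fun a => a < 9 ∨ 19 ≤ a ∧ a < 5 * L + 32) σ σ' ∧ σ'.mem 17 = 0 ∧
        σ'.mem 9 = 5 * L + 32 ∧ σ'.mem 18 = σ.mem 18 + 1 ∧
        (σ'.mem 15, σ'.mem 16) = (if w < x then (w, v) else (x, y)) := by
  have hB1 := hB.addr
  have hB2 := hB.val
  have h15 := h.val 15
  have hxV := h.val (5 * L + 34)
  have hyV := h.val (5 * L + 35)
  refine Ensures.wp h (by decide) ⟨fun hc => by simp [Expr.eval, h17] at hc, fun _ =>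
    ⟨fun _ => ?_, fun hc => by simp [Expr.eval, h9, hb] at hc⟩⟩
  by_cases hlt : w < x
  · by_cases hn : v + 1 < n
    · have e1 : ¬ x ≤ w := by omega
      have e2 : ¬ n ≤ v + 1 := by omega
      simp only [wp, Expr.eval]
      simp [h9, hv', hx, hy, hw, h0, Nat.sub_eq_zero_iff_le, e1, e2, hn, hlt]
      and_intros
      any_goals omega
      refine ⟨rfl, rfl, fun a ha => ?_⟩
      simp only [Finsupp.coe_update, Function.update_apply]
      split_ifs <;> omega
    · have e1 : ¬ x ≤ w := by omega
      have e2 : n ≤ v + 1 := by omega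
      simp only [wp, Expr.eval]
      simp [h9, hv', hx, hy, hw, h0, Nat.sub_eq_zero_iff_le, e1, e2, hn, hlt]
      and_intros
      any_goals omega
      refine ⟨rfl, rfl, fun a ha => ?_⟩
      simp only [Finsupp.coe_update, Function.update_apply]
      split_ifs <;> omega
  · by_cases hn : v + 1 < n
    · have e1 : x ≤ w := by omega
      have e2 : ¬ n ≤ v + 1 := by omega
      simp only [wp, Expr.eval]
      simp [h9, hv', hx, hy, hw, h0, Nat.sub_eq_zero_iff_le, e1, e2, hn, hlt]
      and_intros
      any_goals omega
      refine ⟨rfl, rfl, fun a ha => ?_⟩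
      simp only [Finsupp.coe_update, Function.update_apply]
      split_ifs <;> omega
    · have e1 : x ≤ w := by omega
      have e2 : n ≤ v + 1 := by omega
      simp only [wp, Expr.eval]
      simp [h9, hv', hx, hy, hw, h0, e1, e2, hn, hlt]
      and_intros
      any_goals omega
      refine ⟨rfl, rfl, fun a ha => ?_⟩
      simp only [Finsupp.coe_update, Function.update_apply]
      split_ifs <;> omega

/-- A bound for the number of steps in the computation of a cost with `k` levels left. -/
def costTime (n q Λ k : ℕ) : ℕ := (4 * n + 1) ^ k * (q * (60 * Λ + 70) + 300)

/-- The cost of `A` has been returned, with the current path at level `L`. -/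
def CostReturned (S : Fin q → Cube n × Bool) (I L k : ℕ) (σ σ' : State) : Prop :=
  Same (fun a => a < 10 ∨ 18 ≤ a ∧ a < 5 * L + 32) σ σ' ∧ σ'.mem 17 = 0 ∧
    σ'.mem 15 = splitCost S I k (active S σ.mem L) ∧
    (Mixed S (active S σ.mem L) → 0 < k → σ'.mem 16 = bestVar S I (k - 1) (active S σ.mem L))

/-- One variable costs two recursive calls, each followed by a return. The hypothesis `ih` is the
induction hypothesis of `cost_reach`, for the sets one level further down. -/
theorem cost_reach_pair (hB : Room n q I Λ B) (hI : 1 ≤ I) {L k : ℕ} (hL : L + 1 + k ≤ Λ)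
    (ih : ∀ σ : State, σ.Within B → AtCall n q I (L + 1) k σ →
      Reach S B costCond costBody σ (costTime n q Λ k) (CostReturned S I (L + 1) k σ))
    (A : Finset ℕ) (v : ℕ) (hvn : v < n) {σ : State} (h : σ.Within B)
    (hσ : AtCall n q I (L + 1) k σ) (hst : σ.mem 19 ≤ 5 * L + 32) (hA : active S σ.mem L = A)
    (hv : σ.mem (5 * L + 32) = v) (hb : σ.mem (5 * L + 33) = 0)
    (hbest : (σ.mem (5 * L + 34), σ.mem (5 * L + 35)) =
      best (fun v => splitCost S I k (split S A v 0) + splitCost S I k (split S A v 1)) I v) :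
    Reach S B costCond costBody σ (2 * costTime n q Λ k + 300) fun σ' =>
      Same (fun a => a < 9 ∨ 19 ≤ a ∧ a < 5 * L + 32) σ σ' ∧
      if v + 1 < n then AtCall n q I (L + 1) k σ' ∧ σ'.mem (5 * L + 32) = v + 1 ∧
        σ'.mem (5 * L + 33) = 0 ∧ (σ'.mem (5 * L + 34), σ'.mem (5 * L + 35)) =
        best (fun v => splitCost S I k (split S A v 0) + splitCost S I k (split S A v 1)) I (v + 1)
      else σ'.mem 17 = 0 ∧
        σ'.mem 9 = 5 * L + 32 ∧ σ'.mem 18 = k + 1 ∧ (σ'.mem 15, σ'.mem 16) =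
        best (fun v => splitCost S I k (split S A v 0) + splitCost S I k (split S A v 1)) I
          (v + 1) := by
  have hcost : costCond.cost = 8 := rfl
  refine Reach.mono (Reach.trans (Reach.mono (ih σ h hσ) le_rfl fun σ₁ h₁ r₁ =>
    -- A round takes one evaluation of the loop condition, 8 + 1 steps, besides its body: 109 = 9 +
    -- 100 for the first return, 129 = 9 + 120 for the second.
    Reach.trans (t₁ := 109) (t₂ := costTime n q Λ k + 129) ?_)) (by omega) fun σ' _ hs => hs
  obtain ⟨r₁, m₁, c₁, -⟩ := r₁
  have top₁ : σ₁.mem 9 = 5 * L + 37 := by rw [r₁.mem 9 (by omega), hσ.top]; ring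
  have b₁ : σ₁.mem (5 * L + 33) = 0 := by rw [r₁.mem _ (by omega), hb]
  have st₁ : σ₁.mem 19 = σ.mem 19 := r₁.mem _ (by omega)
  refine Reach.mono (Reach.step ?_ (costReturn_spec_zero hB h₁ (by omega) top₁ m₁ b₁))
    (by rw [hcost]) ?_
  · simp only [costCond, Expr.eval, m₁, top₁, st₁]; omega
  rintro σ₂ h₂ ⟨r₂, m₂, b₂, a₂⟩
  have r₂₀ : Same (fun a => a < 10 ∨ 18 ≤ a ∧ a < 5 * L + 33) σ σ₂ :=
    r₁.trans r₂ fun a ha => ⟨by omega, by omega⟩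
  have s₂ : AtCall n q I (L + 1) k σ₂ := by
    refine ⟨r₂₀.drawn.trans hσ.drawn, ?_, ?_, ?_, ?_, m₂, ?_, ?_⟩
    · rw [r₂₀.mem _ (by omega), hσ.dim]
    · rw [r₂₀.mem _ (by omega), hσ.inf]
    · rw [r₂₀.mem _ (by omega), hσ.count]
    · rw [r₂₀.mem _ (by omega), hσ.top]
    · rw [r₂₀.mem _ (by omega), hσ.depth]
    · rw [r₂₀.mem _ (by omega)]; exact hσ.start
  refine Reach.trans (Reach.mono (ih σ₂ h₂ s₂) le_rfl ?_)
  rintro σ₃ h₃ ⟨r₃, m₃, c₃, -⟩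
  have r₃₀ : Same (fun a => a < 10 ∨ 18 ≤ a ∧ a < 5 * L + 33) σ σ₃ :=
    r₂₀.trans r₃ fun a ha => ⟨by omega, by omega⟩
  have A₂ : active S σ₂.mem L = A := by
    rw [← hA]; exact active_congr fun a h1 h2 => r₂₀.mem a (by omega)
  rw [active_succ, hA, hv, hb] at c₁
  rw [active_succ, A₂, r₂₀.mem _ (by omega), hv, b₂] at c₃
  have le₁ := splitCost_le S hI k (split S A v 0)
  have le₃ := splitCost_le S hI k (split S A v 1)
  refine Reach.mono (Reach.step ?_ (costReturn_spec_one hB h₃ (L := L) (by omega)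
    (by rw [r₃₀.mem _ (by omega), hσ.dim]) (by rw [r₃₀.mem _ (by omega), hσ.top]; ring) m₃
    (by rw [r₃₀.mem _ (by omega), hσ.depth]; omega) hvn (by rw [r₃.mem _ (by omega), b₂])
    (by rw [r₃₀.mem _ (by omega), hv]) rfl rfl
    (w := splitCost S I k (split S A v 0) + splitCost S I k (split S A v 1)) ?_ (by omega)))
    (by rw [hcost]) ?_
  · simp only [costCond, Expr.eval, m₃]
    rw [r₃₀.mem 9 (by omega), r₃₀.mem 19 (by omega), hσ.top]; omega
  · rw [c₃, r₃.mem _ (by omega), a₂, c₁, add_comm]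
  intro σ₄ h₄ hs
  have e34 : σ₃.mem (5 * L + 34) = σ.mem (5 * L + 34) := by
    rw [r₃.mem _ (by omega), r₂.mem _ (by omega), r₁.mem _ (by omega)]
  have e35 : σ₃.mem (5 * L + 35) = σ.mem (5 * L + 35) := by
    rw [r₃.mem _ (by omega), r₂.mem _ (by omega), r₁.mem _ (by omega)]
  have hbest' : (if splitCost S I k (split S A v 0) + splitCost S I k (split S A v 1) <
      σ₃.mem (5 * L + 34) then
        (splitCost S I k (split S A v 0) + splitCost S I k (split S A v 1), v)
      else (σ₃.mem (5 * L + 34), σ₃.mem (5 * L + 35))) =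
      best (fun v => splitCost S I k (split S A v 0) + splitCost S I k (split S A v 1)) I
        (v + 1) := by
    rw [e34, e35, hbest, best, ← hbest]
  rw [hbest'] at hs
  split_ifs at hs ⊢ with hvn'
  · obtain ⟨r₄, k1, k2, k3, k4⟩ := hs
    have r₄₀ : Same (fun a => a < 10 ∨ 18 ≤ a ∧ a < 5 * L + 32) σ σ₄ :=
      r₃₀.trans r₄ fun a ha => ⟨by omega, by omega⟩
    refine ⟨⟨r₄₀.drawn, r₄₀.out, fun a ha => r₄₀.mem a (by omega)⟩,
      ⟨r₄₀.drawn.trans hσ.drawn, ?_, ?_, ?_, ?_, k1, ?_, ?_⟩, k2, k3, k4⟩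
    · rw [r₄₀.mem _ (by omega), hσ.dim]
    · rw [r₄₀.mem _ (by omega), hσ.inf]
    · rw [r₄₀.mem _ (by omega), hσ.count]
    · rw [r₄₀.mem _ (by omega), hσ.top]
    · rw [r₄₀.mem _ (by omega), hσ.depth]
    · rw [r₄₀.mem _ (by omega)]; exact hσ.start
  · obtain ⟨r₄, k1, k2, k3, k4⟩ := hs
    exact ⟨r₃₀.trans r₄ fun a ha => ⟨by omega, by omega⟩, k1, k2,
      by rw [k3, r₃₀.mem _ (by omega), hσ.depth], k4⟩

/-- Induction on the number `j` of variables that are still to come after `v`. -/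
theorem cost_reach_children (hB : Room n q I Λ B) (hI : 1 ≤ I) {L k : ℕ}
    (hL : L + 1 + k ≤ Λ)
    (ih : ∀ σ : State, σ.Within B → AtCall n q I (L + 1) k σ →
      Reach S B costCond costBody σ (costTime n q Λ k) (CostReturned S I (L + 1) k σ))
    (A : Finset ℕ) (j v : ℕ) (hj : v + j + 1 = n) {σ : State} (h : σ.Within B)
    (hσ : AtCall n q I (L + 1) k σ) (hst : σ.mem 19 ≤ 5 * L + 32) (hA : active S σ.mem L = A)
    (hv : σ.mem (5 * L + 32) = v) (hb : σ.mem (5 * L + 33) = 0)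
    (hbest : (σ.mem (5 * L + 34), σ.mem (5 * L + 35)) =
      best (fun v => splitCost S I k (split S A v 0) + splitCost S I k (split S A v 1)) I v) :
    Reach S B costCond costBody σ ((j + 1) * (2 * costTime n q Λ k + 300)) fun σ' =>
      Same (fun a => a < 9 ∨ 19 ≤ a ∧ a < 5 * L + 32) σ σ' ∧ σ'.mem 17 = 0 ∧
        σ'.mem 9 = 5 * L + 32 ∧ σ'.mem 18 = k + 1 ∧ (σ'.mem 15, σ'.mem 16) =
        best (fun v => splitCost S I k (split S A v 0) + splitCost S I k (split S A v 1)) I n := by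
  induction j generalizing v σ with
  | zero =>
    refine Reach.mono (cost_reach_pair hB hI hL ih A v (by omega) h hσ hst hA hv hb hbest)
      (by omega) ?_
    rintro σ' - ⟨hs, hs'⟩
    rw [if_neg (by omega), show v + 1 = n by omega] at hs'
    exact ⟨hs, hs'⟩
  | succ j ihj =>
    refine Reach.mono (Reach.trans (t₁ := 2 * costTime n q Λ k + 300)
      (t₂ := (j + 1) * (2 * costTime n q Λ k + 300)) (Reach.mono
      (cost_reach_pair hB hI hL ih A v (by omega) h hσ hst hA hv hb hbest) le_rfl ?_))
      (by rw [Nat.succ_mul (j + 1)]; omega) fun σ' _ hs => hs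
    rintro σ₁ h₁ ⟨hs, hs'⟩
    rw [if_pos (by omega)] at hs'
    obtain ⟨k1, k2, k3, k4⟩ := hs'
    refine Reach.mono (ihj (v + 1) (by omega) h₁ k1 ?_ ?_ k2 k3 k4) le_rfl ?_
    · rw [hs.mem _ (by omega)]; exact hst
    · rw [← hA]; exact active_congr fun a h1 h2 => hs.mem a (by omega)
    · rintro σ' - ⟨k5, k6⟩
      exact ⟨hs.trans k5 fun a ha => ⟨ha, ha⟩, k6⟩

/-- Induction on the number of levels left. Since the loop tries a variable before testing whether
any are left, `n` must be positive. -/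
theorem cost_reach (hB : Room n q I Λ B) (hI : 1 ≤ I) (hn : 0 < n) {L k : ℕ} (hL : L + k ≤ Λ)
    {σ : State} (h : σ.Within B) (hσ : AtCall n q I L k σ) :
    Reach S B costCond costBody σ (costTime n q Λ k) (CostReturned S I L k σ) := by
  classical
  induction k generalizing L σ with
  | zero =>
    refine Reach.mono (Reach.step ?_ (costCall_spec hB hI h hL hσ)) ?_ fun σ' h' hs => ?_
    · simp [costCond, Expr.eval, hσ.mode]
    · simp only [costCond, Expr.cost, costTime, pow_zero]; omega
    · rw [if_neg (by simp)] at hs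
      exact ⟨hs.1, hs.2.1, hs.2.2, fun _ h0 => absurd h0 (lt_irrefl 0)⟩
  | succ k ih =>
    have hT : q * (60 * Λ + 70) + 300 ≤ costTime n q Λ k :=
      Nat.le_mul_of_pos_left _ (by positivity)
    -- The recursion `T (k + 1) ≤ call + n * (2 * T k + 300)` is solved by powers of `4 * n + 1`,
    -- since `T k` exceeds both 300 and the cost of a scan.
    have ht : costCond.cost + 1 + (q * (60 * Λ + 70) + 100) + n * (2 * costTime n q Λ k + 300)
        ≤ costTime n q Λ (k + 1) := by
      have e : costTime n q Λ (k + 1) = 4 * (n * costTime n q Λ k) + costTime n q Λ k := by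
        rw [costTime, costTime, pow_succ]; ring
      have e2 : n * (2 * costTime n q Λ k + 300) = 2 * (n * costTime n q Λ k) + n * 300 := by ring
      have e3 : n * 300 ≤ n * costTime n q Λ k := Nat.mul_le_mul_left _ (by omega)
      rw [e, e2]
      simp only [costCond, Expr.cost]
      omega
    refine Reach.mono (Reach.trans (Reach.mono (Reach.step ?_ (costCall_spec hB hI h hL hσ)) le_rfl
      fun σ₁ h₁ hs => ?_)) ht fun σ' _ hs => hs
    · simp [costCond, Expr.eval, hσ.mode]
    by_cases hm : Mixed S (active S σ.mem L)
    swap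
    · rw [if_neg (fun h => hm h.1)] at hs
      exact Reach.refl h₁ ⟨hs.1, hs.2.1, hs.2.2, fun h0 => absurd h0 hm⟩
    rw [if_pos ⟨hm, by omega⟩] at hs
    obtain ⟨hs, hcall, e0, e1, e2, e3⟩ := hs
    have hact : active S σ₁.mem L = active S σ.mem L :=
      active_congr fun a h1 h2 => hs.mem a (by omega)
    refine Reach.mono (cost_reach_children hB hI (by omega)
      (fun σ h hσ => ih (by omega) h hσ) (active S σ.mem L) (n - 1) 0 (by omega) h₁ hcall
      (by have := hσ.start; have := hs.mem 19 (by omega); omega) hact e0 e1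
      (by rw [e2, e3]; rfl)) (by rw [Nat.sub_add_cancel hn]) ?_
    rintro σ' - ⟨k1, k2, k3, k4, k5⟩
    refine ⟨⟨k1.drawn.trans hs.drawn, k1.out.trans hs.out, fun a ha => ?_⟩, k2, ?_, fun _ _ => ?_⟩
    -- The stack pointer `9` and the depth `18` change during the search, but are restored when the
    -- frame is popped.
    · by_cases ha9 : a = 9
      · rw [ha9, k3, hσ.top]
      by_cases ha18 : a = 18
      · rw [ha18, k4, hσ.depth]
      rw [k1.mem a (by omega), hs.mem a (by omega)]
    · rw [splitCost, if_neg hm.nonempty.ne_empty, if_pos hm]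
      exact congrArg Prod.fst k5
    · exact congrArg Prod.snd k5

end Cost
end DTLearn

namespace DTLearn

/-! ### The program: writing the tree -/

/-- Query the optimal variable, and go to the child for the value `0`. -/
def growNode : Prog :=
  (setReg 18 (reg 21) ;; setReg 19 (reg 9) ;; setReg 17 (.const 1)) ;; costLoop ;;
  .emit (.plus (reg 16) (.const 2)) ;; .store (reg 9) (reg 16) ;;
  .store (.plus (reg 9) (.const 1)) (.const 0) ;; setReg 9 (.plus (reg 9) (.const 5)) ;;
  .ite (.minus (reg 21) (.const 1)) (setReg 21 (.minus (reg 21) (.const 1))) (setReg 21 (reg 4))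

def growLeaf (e : Expr) : Prog := .emit e ;; setReg 20 (.const 0)

def growVisit : Prog :=
  findLabels ;;
  .ite (reg 13)
    (.ite (reg 14) (.ite (.minus (reg 8) (reg 9)) growNode (growLeaf (.const 0)))
      (growLeaf (reg 14))) (growLeaf (reg 14))

/-- Go to the next subtree, or to the parent if there is none. -/
def growBack : Prog :=
  .ite (.load (below 4))
    (setReg 9 (below 5) ;;
      .ite (.minus (reg 4) (reg 21)) (setReg 21 (.plus (reg 21) (.const 1)))
        (setReg 21 (.const 1)))
    (.store (below 4) (.const 1) ;; setReg 20 (.const 1))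

def growBody : Prog := .ite (reg 20) growVisit growBack

/-- Nonzero while a node is to be visited (register `20`) or the path is not empty; the stack begins
at cell `32`. -/
def growCond : Expr := .plus (reg 20) (.minus (reg 9) (.const 32))

/-- Write the tree for the examples that follow the path on the stack. -/
def growLoop : Prog := .loop growCond growBody

/-! ### Correctness and running time of the writing of the tree. -/

section Grow
variable {n q : ℕ} {S : Fin q → Cube n × Bool} {B : Lim} {I Λ d : ℕ}

/-- The registers are set for writing a tree with `r` levels. -/
structure AtNode (n q I d L r : ℕ) (σ : State) : Prop where
  drawn : σ.drawn = q
  dim : σ.mem 0 = n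
  step : σ.mem 4 = d
  inf : σ.mem 5 = I
  count : σ.mem 7 = q
  bottom : σ.mem 8 = 5 * (L + r) + 32
  top : σ.mem 9 = 5 * L + 32
  mode : σ.mem 20 = 1
  depth : σ.mem 21 = horizon d r

theorem costTime_mono {k k' : ℕ} (h : k ≤ k') : costTime n q Λ k ≤ costTime n q Λ k' :=
  Nat.mul_le_mul_right _ (Nat.pow_le_pow_right (by omega) h)

/-- A bound for the number of steps needed for one node. -/
def nodeTime (n q Λ d : ℕ) : ℕ := costTime n q Λ d + q * (60 * Λ + 70) + 300

/-- The cost search uses the stack above the current path as scratch space. Afterwards the variable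
it found is written into the next frame, over that scratch, and register `21` follows
`horizon_succ`. -/
theorem growNode_spec {σ : State} (hB : Room n q I Λ B) (hI : 1 ≤ I) (hn : 0 < n) (hd : 0 < d)
    (h : σ.Within B) {L r : ℕ} (hL : L + d ≤ Λ) (hσ : AtNode n q I d L (r + 1) σ)
    (hm : Mixed S (active S σ.mem L)) (hlen : σ.out.length < B.len) :
    Ensures S B growNode σ (costTime n q Λ d + 110) fun σ' =>
      (∀ a, a < 9 ∨ 22 ≤ a ∧ a < 5 * L + 32 → σ'.mem a = σ.mem a) ∧
      AtNode n q I d (L + 1) r σ' ∧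
      σ'.mem (5 * L + 32) = query S I d (r + 1) (active S σ.mem L) ∧ σ'.mem (5 * L + 33) = 0 ∧
      σ'.out = σ.out ++ [query S I d (r + 1) (active S σ.mem L) + 2] := by
  obtain ⟨e1, e2, e3, e4, e5, e6, e7, e8, e9⟩ := hσ
  have hB1 := hB.addr
  have hB2 := hB.val
  have hh1 := horizon_pos hd (r + 1)
  have hh2 := horizon_le hd (r + 1)
  have hh3 := horizon_le hd r
  have hs := horizon_succ hd r
  refine Ensures.wp_seq (costTime n q Λ d + 80) h (by simp only [loopFreeTime, Expr.cost]; omega)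
    ?_
  simp only [wp, Expr.eval]
  simp [e9, e7]
  refine ⟨by omega, by omega, by omega, by omega, by omega, by omega, fun h₁ => ?_⟩
  obtain ⟨σ₁, hσ₁⟩ : ∃ σ₁ : State, σ₁ = State.mk
      (((σ.mem.update 18 (horizon d (r + 1))).update 19 (5 * L + 32)).update 17 1)
      σ.drawn σ.out := ⟨_, rfl⟩
  rw [← hσ₁] at h₁ ⊢
  have r₁ : Same (fun a => a < 17 ∨ 20 ≤ a) σ σ₁ := by
    rw [hσ₁]
    refine ⟨rfl, rfl, fun a ha => ?_⟩
    simp only [Finsupp.coe_update, Function.update_apply]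
    split_ifs <;> omega
  have s₁ : AtCall n q I L (horizon d (r + 1)) σ₁ := by
    rw [hσ₁]; constructor <;> simp [*]
  have hcost : costCond.cost = 8 := rfl
  refine Ensures.seq (costTime n q Λ d + 9) 70 (by omega) (Ensures.mono (Reach.halt (Reach.mono
    (cost_reach hB hI hn (by omega) h₁ s₁) (costTime_mono hh2) ?_)) (by rw [hcost])
    fun _ _ h => h)
  rintro σ₂ h₂ ⟨r₂, m₂, -, v₂⟩
  have hact : active S σ₁.mem L = active S σ.mem L :=
    active_congr fun a h1 h2 => r₁.mem a (by omega)
  have e19 : σ₁.mem 19 = 5 * L + 32 := by rw [hσ₁]; simp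
  rw [hact] at v₂
  have v₂ := v₂ hm hh1
  have hq : bestVar S I (horizon d (r + 1) - 1) (active S σ.mem L) =
    query S I d (r + 1) (active S σ.mem L) := rfl
  have hqn : query S I d (r + 1) (active S σ.mem L) ≤ n := best_snd_le _ _ _
  rw [hq] at v₂
  have k9 : σ₂.mem 9 = 5 * L + 32 := by rw [r₂.mem _ (by omega), s₁.top]
  have k4 : σ₂.mem 4 = d := by rw [r₂.mem _ (by omega), r₁.mem _ (by omega), e3]
  have k21 : σ₂.mem 21 = horizon d (r + 1) := by
    rw [r₂.mem _ (by omega), r₁.mem _ (by omega), e9]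
  refine ⟨?_, Ensures.wp h₂ (by decide) ?_⟩
  · simp only [costCond, Expr.eval, m₂, k9]
    rw [r₂.mem 19 (by omega), e19]; omega
  generalize query S I d (r + 1) (active S σ.mem L) = v at *
  have hmem : ∀ a, a < 10 ∨ 20 ≤ a ∧ a < 5 * L + 32 → σ₂.mem a = σ.mem a := fun a ha => by
    rw [r₂.mem _ (by omega), r₁.mem _ (by omega)]
  have hout : σ₂.out = σ.out := r₂.out.trans r₁.out
  have hdr : σ₂.drawn = q := r₂.drawn.trans (r₁.drawn.trans e1)
  by_cases hone : horizon d (r + 1) = 1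
  · rw [if_pos hone] at hs
    simp only [wp, Expr.eval]
    simp [k9, k4, k21, hone, v₂, hout]
    and_intros
    any_goals omega
    · intro a ha
      simp only [Function.update_apply]
      split_ifs <;> first | omega | exact hmem a (by omega)
    · constructor
      · exact hdr
      all_goals simp [*]
      all_goals omega
  · rw [if_neg hone] at hs
    simp only [wp, Expr.eval]
    have hone' : ¬ horizon d (r + 1) ≤ 1 := by omega
    simp [k9, k4, k21, Nat.sub_eq_zero_iff_le, hone', v₂, hout]
    and_intros
    any_goals omega
    · intro a ha
      simp only [Function.update_apply]
      split_ifs <;> first | omega | exact hmem a (by omega)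
    · constructor
      · exact hdr
      all_goals simp [*]
      all_goals omega

open Classical in
-- A pure set, and any set on the last level, becomes a leaf. For a pure set the token is the flag
-- for label `1`; a mixed set on the last level gets the arbitrary label `0`.
theorem growVisit_spec {σ : State} (hB : Room n q I Λ B) (hI : 1 ≤ I) (hn : 0 < n) (hd : 0 < d)
    (h : σ.Within B) {L r : ℕ} (hL : L + d ≤ Λ) (hσ : AtNode n q I d L r σ)
    (hlen : σ.out.length < B.len) :
    Ensures S B growBody σ (costTime n q Λ d + q * (60 * Λ + 70) + 200) fun σ' =>
      if Mixed S (active S σ.mem L) ∧ 0 < r then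
        (∀ a, a < 9 ∨ 22 ≤ a ∧ a < 5 * L + 32 → σ'.mem a = σ.mem a) ∧
        AtNode n q I d (L + 1) (r - 1) σ' ∧
        σ'.mem (5 * L + 32) = query S I d r (active S σ.mem L) ∧ σ'.mem (5 * L + 33) = 0 ∧
        σ'.out = σ.out ++ [query S I d r (active S σ.mem L) + 2]
      else
        (∀ a, a < 10 ∨ 21 ≤ a ∧ a < 5 * L + 32 → σ'.mem a = σ.mem a) ∧ σ'.mem 20 = 0 ∧
        σ'.drawn = q ∧ σ'.out = σ.out ++ tokens S I d r (active S σ.mem L) := by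
  have hB1 := hB.addr
  have hB2 := hB.val
  have h20 := hσ.mode
  unfold growBody growVisit
  refine (Ensures.ite (t := costTime n q Λ d + q * (60 * Λ + 70) + 190) (fun _ => ?_)
    fun hc => ?_).mono (by simp only [Expr.cost]; omega) fun _ _ h => h
  swap
  · simp [Expr.eval, h20] at hc
  refine Ensures.seq _ (costTime n q Λ d + 140) (by omega)
    ((findLabels_spec hB h (by omega) hσ.drawn hσ.top hσ.count).mono le_rfl ?_)
  rintro σ₁ h₁ ⟨r₁, e13, e14⟩
  have s₁ : AtNode n q I d L r σ₁ := by
    refine ⟨r₁.drawn.trans hσ.drawn, ?_, ?_, ?_, ?_, ?_, ?_, ?_, ?_⟩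
    · rw [r₁.mem _ (by omega), hσ.dim]
    · rw [r₁.mem _ (by omega), hσ.step]
    · rw [r₁.mem _ (by omega), hσ.inf]
    · rw [r₁.mem _ (by omega), hσ.count]
    · rw [r₁.mem _ (by omega), hσ.bottom]
    · rw [r₁.mem _ (by omega), hσ.top]
    · rw [r₁.mem _ (by omega), hσ.mode]
    · rw [r₁.mem _ (by omega), hσ.depth]
  have hact : active S σ₁.mem L = active S σ.mem L :=
    active_congr fun a h1 h2 => r₁.mem a (by omega)
  have hleaf : ∀ e : Expr, e.cost ≤ 2 → e.eval S σ₁ ≤ 1 → ¬ (Mixed S (active S σ.mem L) ∧ 0 < r) →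
      [e.eval S σ₁] = tokens S I d r (active S σ.mem L) → Ensures S B (growLeaf e) σ₁ 20 fun σ' =>
      if Mixed S (active S σ.mem L) ∧ 0 < r then
        (∀ a, a < 9 ∨ 22 ≤ a ∧ a < 5 * L + 32 → σ'.mem a = σ.mem a) ∧
        AtNode n q I d (L + 1) (r - 1) σ' ∧
        σ'.mem (5 * L + 32) = query S I d r (active S σ.mem L) ∧ σ'.mem (5 * L + 33) = 0 ∧
        σ'.out = σ.out ++ [query S I d r (active S σ.mem L) + 2]
      else
        (∀ a, a < 10 ∨ 21 ≤ a ∧ a < 5 * L + 32 → σ'.mem a = σ.mem a) ∧ σ'.mem 20 = 0 ∧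
        σ'.drawn = q ∧ σ'.out = σ.out ++ tokens S I d r (active S σ.mem L) := by
    intro e hc he hm ht
    refine Ensures.wp h₁ (by simp only [growLeaf, loopFreeTime, Expr.cost]; omega) ?_
    simp only [wp, growLeaf, if_neg hm, ← ht]
    refine ⟨by omega, by rw [r₁.out]; exact hlen, by simp [Expr.eval]; omega, by simp [Expr.eval],
      fun a ha => ?_, by simp [Expr.eval], r₁.drawn.trans hσ.drawn, by rw [r₁.out]⟩
    simp only [Expr.eval, Finsupp.coe_update, Function.update_apply]
    split_ifs <;> first | omega | exact r₁.mem a (by omega)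
  have c13 : (reg 13).eval S σ₁ = σ₁.mem 13 := rfl
  have c14 : (reg 14).eval S σ₁ = σ₁.mem 14 := rfl
  have le14 : (reg 14).eval S σ₁ ≤ 1 := by rw [c14, e14]; split_ifs <;> omega
  have htok : ¬ Mixed S (active S σ.mem L) →
      [(reg 14).eval S σ₁] = tokens S I d r (active S σ.mem L) := by
    intro hm
    rw [c14, e14]
    cases r <;> rw [tokens, if_neg hm]
  refine (Ensures.ite (t := costTime n q Λ d + 130) (fun l0 => Ensures.mono (Ensures.ite
    (t := costTime n q Λ d + 124) (fun l1 => Ensures.mono (Ensures.ite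
    (t := costTime n q Λ d + 116) (fun hr => ?_) fun hr => ?_) (by simp only [Expr.cost]; omega)
    fun _ _ h => h) fun l1 => ?_) (by simp only [Expr.cost]; omega) fun _ _ h => h)
    fun l0 => ?_).mono (by simp only [Expr.cost]; omega) fun _ _ h => h
  all_goals
    simp only [Expr.eval, e13, ite_eq_right_iff, one_ne_zero, imp_false, ne_eq, not_not] at l0
  all_goals try
    simp only [Expr.eval, e14, ite_eq_right_iff, one_ne_zero, imp_false, ne_eq, not_not] at l1
  · simp only [Expr.eval, s₁.bottom, s₁.top] at hr
    obtain ⟨r, rfl⟩ : ∃ r', r = r' + 1 := ⟨r - 1, by omega⟩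
    have hm : Mixed S (active S σ.mem L) := ⟨l0, l1⟩
    refine (growNode_spec hB hI hn hd h₁ hL s₁ (by rw [hact]; exact hm)
      (by rw [r₁.out]; exact hlen)).mono (by omega) ?_
    rintro σ₂ - ⟨k1, k2, k3, k4, k5⟩
    rw [if_pos ⟨hm, by omega⟩]
    rw [hact] at k3 k5
    exact ⟨fun a ha => (k1 a ha).trans (r₁.mem a (by omega)), k2, k3, k4, by rw [k5, r₁.out]⟩
  · simp only [Expr.eval, s₁.bottom, s₁.top] at hr
    obtain rfl : r = 0 := by omega
    have hm : Mixed S (active S σ.mem L) := ⟨l0, l1⟩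
    refine (hleaf (.const 0) (by decide) (by simp [Expr.eval]) (by simp) ?_).mono (by omega)
      fun _ _ h => h
    rw [tokens, if_pos hm]; rfl
  · have hm : ¬ Mixed S (active S σ.mem L) := fun h => l1 h.2
    exact (hleaf _ (by decide) le14 (fun h => hm h.1) (htok hm)).mono (by omega) fun _ _ h => h
  · have hm : ¬ Mixed S (active S σ.mem L) := fun h => l0 h.1
    exact (hleaf _ (by decide) le14 (fun h => hm h.1) (htok hm)).mono (by omega) fun _ _ h => h

theorem growBack_spec_zero {σ : State} (hB : Room n q I Λ B) (h : σ.Within B) {L : ℕ}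
    (hL : L < Λ) (h9 : σ.mem 9 = 5 * L + 37) (h20 : σ.mem 20 = 0) (hb : σ.mem (5 * L + 33) = 0) :
    Ensures S B growBody σ 60 fun σ' => Same (fun a => a ≠ 20 ∧ a ≠ 5 * L + 33) σ σ' ∧
      σ'.mem 20 = 1 ∧ σ'.mem (5 * L + 33) = 1 := by
  have hB1 := hB.addr
  have hB2 := hB.val
  unfold growBody growBack
  have hb' : (Expr.load (below 4)).eval S σ = 0 := by simp [Expr.eval, h9, hb]
  refine (Ensures.ite (t := 50) (fun hc => by simp [Expr.eval, h20] at hc) fun _ =>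
    (Ensures.ite (t := 40) (fun hc => absurd hb' hc) fun _ => Ensures.wp h (by decide) ?_).mono
      (by decide) fun _ _ h => h).mono (by decide) fun _ _ h => h
  simp only [wp, Expr.eval]
  simp [h9]
  and_intros
  any_goals omega
  refine ⟨rfl, rfl, fun a ha => ?_⟩
  simp only [Finsupp.coe_update, Function.update_apply]
  split_ifs <;> omega

/-- Going up inverts `horizon_succ`: a full block above means that the parent was the last level of
the previous block. -/
theorem growBack_spec_one {σ : State} (hB : Room n q I Λ B) (hd : 0 < d) (h : σ.Within B)
    {L r : ℕ} (hL : L + d ≤ Λ) (h4 : σ.mem 4 = d) (h9 : σ.mem 9 = 5 * L + 37)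
    (h20 : σ.mem 20 = 0) (h21 : σ.mem 21 = horizon d r) (hb : σ.mem (5 * L + 33) = 1) :
    Ensures S B growBody σ 60 fun σ' => Same (fun a => a ≠ 9 ∧ a ≠ 21) σ σ' ∧
      σ'.mem 9 = 5 * L + 32 ∧ σ'.mem 21 = horizon d (r + 1) := by
  have hB1 := hB.addr
  have hB2 := hB.val
  have hs := horizon_succ hd r
  have hh1 := horizon_pos hd (r + 1)
  have hh2 := horizon_le hd (r + 1)
  have hh3 := horizon_le hd r
  unfold growBody growBack
  have hb' : (Expr.load (below 4)).eval S σ ≠ 0 := by simp [Expr.eval, h9, hb]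
  refine (Ensures.ite (t := 50) (fun hc => by simp [Expr.eval, h20] at hc) fun _ =>
    (Ensures.ite (t := 40) (fun _ => Ensures.wp h (by decide) ?_) fun hc => absurd hc hb').mono
      (by decide) fun _ _ h => h).mono (by decide) fun _ _ h => h
  by_cases hc : d ≤ horizon d r
  · have e : horizon d (r + 1) = 1 := by split_ifs at hs <;> omega
    simp only [wp, Expr.eval]
    simp [h4, h9, h21, hc, e]
    and_intros
    any_goals omega
    refine ⟨rfl, rfl, fun a ha => ?_⟩
    simp only [Finsupp.coe_update, Function.update_apply]
    split_ifs <;> omega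
  · have e : horizon d (r + 1) = horizon d r + 1 := by split_ifs at hs <;> omega
    simp only [wp, Expr.eval]
    simp [h4, h9, h21, Nat.sub_eq_zero_iff_le, hc, e]
    and_intros
    any_goals omega
    refine ⟨rfl, rfl, fun a ha => ?_⟩
    simp only [Finsupp.coe_update, Function.update_apply]
    split_ifs <;> omega

/-- Preorder traversal by induction on the levels left. Two subtrees and two returns fit into a
factor `4`, because `nodeTime` is at least 300. -/
theorem grow_reach (hB : Room n q I Λ B) (hI : 1 ≤ I) (hn : 0 < n) (hd : 0 < d) {L r : ℕ}
    (hL : L + r + d ≤ Λ) {σ : State} (h : σ.Within B) (hσ : AtNode n q I d L r σ)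
    (hlen : σ.out.length + 2 ^ (r + 1) ≤ B.len) :
    Reach S B growCond growBody σ (4 ^ r * nodeTime n q Λ d) fun σ' =>
      (∀ a, a < 10 ∨ 21 ≤ a ∧ a < 5 * L + 32 → σ'.mem a = σ.mem a) ∧ σ'.mem 20 = 0 ∧
        σ'.drawn = q ∧ σ'.out = σ.out ++ tokens S I d r (active S σ.mem L) := by
  have hcost : growCond.cost = 7 := rfl
  rw [pow_succ] at hlen
  induction r generalizing L σ with
  | zero =>
    refine Reach.mono (Reach.step ?_ (growVisit_spec hB hI hn hd h (by omega) hσ (by omega))) ?_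
      fun σ' h' hs => ?_
    · simp [growCond, Expr.eval, hσ.mode]
    · rw [hcost, nodeTime]; omega
    · rwa [if_neg (by simp)] at hs
  | succ r ih =>
    have hV : 300 ≤ nodeTime n q Λ d := by rw [nodeTime]; omega
    have hT : nodeTime n q Λ d ≤ 4 ^ r * nodeTime n q Λ d :=
      Nat.le_mul_of_pos_left _ (by positivity)
    have hT' : 4 ^ (r + 1) * nodeTime n q Λ d = 4 * (4 ^ r * nodeTime n q Λ d) := by
      rw [pow_succ]; ring
    rw [pow_succ] at hlen
    have hpow' : 0 < 2 ^ r := by positivity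
    refine Reach.mono (Reach.trans (t₁ := nodeTime n q Λ d)
      (t₂ := (4 ^ r * nodeTime n q Λ d + (68 + (4 ^ r * nodeTime n q Λ d + 68))))
      (Reach.mono (Reach.step ?_ (growVisit_spec hB hI hn hd h (by omega) hσ (by omega)))
      (by rw [hcost, nodeTime]; omega) fun σ₁ h₁ hs => ?_)) (by rw [hT']; omega)
      fun σ' _ hs => hs
    · simp [growCond, Expr.eval, hσ.mode]
    by_cases hm : Mixed S (active S σ.mem L)
    swap
    · rw [if_neg (fun h => hm h.1)] at hs
      exact Reach.refl h₁ hs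
    rw [if_pos ⟨hm, by omega⟩] at hs
    generalize hA : active S σ.mem L = A at *
    generalize hv : query S I d (r + 1) A = v at *
    obtain ⟨m₁, s₁, v₁, b₁, o₁⟩ := hs
    rw [Nat.add_sub_cancel] at s₁
    have A₁ : active S σ₁.mem L = A := by
      rw [← hA]; exact active_congr fun a h1 h2 => m₁ a (by omega)
    refine Reach.trans (Reach.mono (ih (by omega) h₁ s₁
      (by rw [o₁, List.length_append, List.length_singleton]; omega)) le_rfl ?_)
    rintro σ₂ h₂ ⟨m₂, z₂, d₂, o₂⟩
    rw [active_succ, A₁, v₁, b₁, o₁] at o₂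
    have t₂ : σ₂.mem 9 = 5 * L + 37 := by rw [m₂ _ (by omega), s₁.top]; ring
    refine Reach.trans (Reach.mono (Reach.step ?_ (growBack_spec_zero hB h₂ (by omega) t₂ z₂
      (by rw [m₂ _ (by omega), b₁]))) (by rw [hcost]) ?_)
    · simp only [growCond, Expr.eval, t₂]; omega
    rintro σ₃ h₃ ⟨m₃, z₃, b₃⟩
    have m₃₀ : ∀ a, a < 10 ∨ 21 ≤ a ∧ a < 5 * L + 33 → σ₃.mem a = σ₁.mem a := fun a ha => by
      rw [m₃.mem _ (by omega), m₂ _ (by omega)]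
    have s₃ : AtNode n q I d (L + 1) r σ₃ := by
      refine ⟨m₃.drawn.trans d₂, ?_, ?_, ?_, ?_, ?_, ?_, z₃, ?_⟩
      · rw [m₃₀ _ (by omega), s₁.dim]
      · rw [m₃₀ _ (by omega), s₁.step]
      · rw [m₃₀ _ (by omega), s₁.inf]
      · rw [m₃₀ _ (by omega), s₁.count]
      · rw [m₃₀ _ (by omega), s₁.bottom]
      · rw [m₃₀ _ (by omega), s₁.top]
      · rw [m₃₀ _ (by omega), s₁.depth]
    have A₃ : active S σ₃.mem L = A := by
      rw [← A₁]; exact active_congr fun a h1 h2 => m₃₀ a (by omega)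
    -- The first subtree writes at most `2 ^ (r + 1) - 1` tokens, which leaves enough room in the
    -- output for the second.
    have l₂ := length_tokens_le S I d r (split S A v 0)
    refine Reach.trans (Reach.mono (ih (by omega) h₃ s₃ ?_) le_rfl ?_)
    · rw [m₃.out, o₂, List.length_append, List.length_append, List.length_singleton]
      rw [pow_succ] at l₂
      omega
    rintro σ₄ h₄ ⟨m₄, z₄, d₄, o₄⟩
    rw [active_succ, A₃, b₃, m₃₀ _ (by omega), v₁, m₃.out, o₂] at o₄
    have t₄ : σ₄.mem 9 = 5 * L + 37 := by rw [m₄ _ (by omega), s₃.top]; ring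
    refine Reach.mono (Reach.step ?_ (growBack_spec_one hB hd h₄ (L := L) (r := r) (by omega)
      (by rw [m₄ _ (by omega), s₃.step]) t₄ z₄ (by rw [m₄ _ (by omega), s₃.depth])
      (by rw [m₄ _ (by omega), b₃]))) (by rw [hcost]) ?_
    · simp only [growCond, Expr.eval, t₄]; omega
    rintro σ₅ h₅ ⟨m₅, t₅, e₅⟩
    refine ⟨fun a ha => ?_, by rw [m₅.mem _ (by omega), z₄], m₅.drawn.trans d₄, ?_⟩
    · by_cases ha9 : a = 9
      · rw [ha9, t₅, hσ.top]
      by_cases ha21 : a = 21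
      · rw [ha21, e₅, hσ.depth]
      rw [m₅.mem _ ⟨ha9, ha21⟩, m₄ _ (by omega), m₃₀ _ (by omega), m₁ _ (by omega)]
    · rw [m₅.out, o₄, tokens, if_pos hm, hv]
      simp

end Grow
end DTLearn

namespace DTLearn

/-! ### The program: parameters -/

/-- Compute the logarithm of `e`, rounded up, in register `a`, and the corresponding power of two
in register `23`. -/
def logProg (e : Expr) (a : ℕ) : Prog :=
  (setReg 23 (.const 1) ;; setReg a (.const 0)) ;;
  .loop (.minus e (reg 23))
    (setReg 23 (.plus (reg 23) (reg 23)) ;; setReg a (.plus (reg a) (.const 1)))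

/-- Run `p` as often as the value of `e` says. -/
def repeatProg (e : Expr) (p : Prog) : Prog :=
  setReg 24 (.const 0) ;;
  .loop (.minus e (reg 24)) (p ;; setReg 24 (.plus (reg 24) (.const 1)))

/-! ### Arithmetic by repetition: logarithms, products and powers. -/

section Setup
variable {n q : ℕ} {S : Fin q → Cube n × Bool} {B : Lim}

/-- The least power of two that is not below `x` is found by doubling. The expression `e` is
evaluated anew in each round, so its value may not depend on the two registers in use. -/
theorem logProg_spec {σ : State} (h : σ.Within B) (hB : 32 ≤ B.addr) {e : Expr} {a x : ℕ}
    (ha : a ≠ 23) (ha' : a < 32) (he : e.cost ≤ 5) (hx : 2 ^ Nat.clog 2 x ≤ B.val)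
    (hev : ∀ σ' : State, Same (fun b => b ≠ 23 ∧ b ≠ a) σ σ' → e.eval S σ' = x) :
    Ensures S B (logProg e a) σ (40 * Nat.clog 2 x + 40) fun σ' =>
      Same (fun b => b ≠ 23 ∧ b ≠ a) σ σ' ∧ σ'.mem a = Nat.clog 2 x := by
  unfold logProg
  refine Ensures.wp_seq (40 * Nat.clog 2 x + 20) h (by simp only [loopFreeTime, Expr.cost]; omega)
    ?_
  have hpos : 1 ≤ 2 ^ Nat.clog 2 x := Nat.one_le_two_pow
  simp only [wp, Expr.eval]
  refine ⟨by omega, by omega, by omega, by omega, fun h₁ => ?_⟩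
  refine Ensures.mono (Ensures.loop 20 (fun j σ' => Same (fun b => b ≠ 23 ∧ b ≠ a) σ σ' ∧
    σ'.mem 23 = 2 ^ j ∧ σ'.mem a = j) (Nat.clog 2 x) ?_ h₁ ?_ ?_ ?_) le_rfl ?_
  · have : Nat.clog 2 x * ((Expr.minus e (reg 23)).cost + 1 + 20) ≤ Nat.clog 2 x * 40 :=
      Nat.mul_le_mul_left _ (by simp only [Expr.cost]; omega)
    simp only [Expr.cost] at this ⊢
    omega
  · refine ⟨⟨rfl, rfl, fun b hb => ?_⟩, ?_, ?_⟩
    · simp [hb.1, hb.2]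
    · simp [show (23 : ℕ) ≠ a by omega]
    · simp
  · rintro σ' ⟨k1, k2, -⟩
    simp only [Expr.eval]
    rw [hev σ' k1, k2]
    exact Nat.sub_eq_zero_of_le (Nat.le_pow_clog (by norm_num) x)
  · rintro j hj σ' h' ⟨k1, k2, k3⟩
    have hlt : 2 ^ j < x := (Nat.lt_clog_iff_pow_lt (by norm_num)).1 hj
    have hle : 2 ^ (j + 1) ≤ 2 ^ Nat.clog 2 x := Nat.pow_le_pow_right (by norm_num) hj
    have hj2 : j < 2 ^ j := Nat.lt_two_pow_self
    rw [pow_succ] at hle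
    refine ⟨?_, Ensures.wp h' (by simp only [loopFreeTime, Expr.cost]; omega) ?_⟩
    · simp only [Expr.eval]
      rw [hev σ' k1, k2]
      omega
    simp only [wp, Expr.eval]
    refine ⟨by omega, by omega, by omega, ?_, ⟨k1.drawn, k1.out, fun b hb => ?_⟩, ?_, ?_⟩
    · simp [show a ≠ 23 by omega, k3]; omega
    · simp [hb.1, hb.2, k1.mem b hb]
    · simp [show (23 : ℕ) ≠ a by omega, k2, pow_succ]; omega
    · simp [show a ≠ 23 by omega, k3]
  · rintro σ' - ⟨k1, -, k3⟩
    exact ⟨k1, k3⟩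

/-- The machine has no multiplication, so products, powers and the drawing of the sample are all
repetitions. The invariant must ignore register `24`, which counts the rounds. -/
theorem repeatProg_spec {σ : State} (h : σ.Within B) (hB : 32 ≤ B.addr) {e : Expr} {p : Prog}
    (he : e.cost ≤ 5) (t N : ℕ) (ht : t ≤ 20) (hN : N ≤ B.val) (Inv : ℕ → State → Prop)
    (h0 : Inv 0 σ)
    (hstable : ∀ j σ' v, Inv j σ' → Inv j { σ' with mem := σ'.mem.update 24 v })
    (hev : ∀ j σ', Inv j σ' → e.eval S σ' = N)
    (hstep : ∀ j < N, ∀ σ' : State, σ'.Within B → Inv j σ' →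
      Ensures S B p σ' t fun σ'' => Inv (j + 1) σ'' ∧ σ''.mem 24 = σ'.mem 24) :
    Ensures S B (repeatProg e p) σ (40 * N + 20) (Inv N) := by
  unfold repeatProg
  refine Ensures.wp_seq (40 * N + 15) h (by simp only [loopFreeTime, Expr.cost]; omega) ?_
  simp only [wp, Expr.eval]
  refine ⟨by omega, by omega, fun h₁ => ?_⟩
  refine Ensures.mono (Ensures.loop 26 (fun j σ' => Inv j σ' ∧ σ'.mem 24 = j) N ?_ h₁ ?_ ?_ ?_)
    le_rfl fun σ' _ hs => hs.1
  · have : N * ((Expr.minus e (reg 24)).cost + 1 + 26) ≤ N * 40 :=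
      Nat.mul_le_mul_left _ (by simp only [Expr.cost]; omega)
    simp only [Expr.cost] at this ⊢
    omega
  · exact ⟨hstable _ _ _ h0, by simp⟩
  · rintro σ' ⟨k1, k2⟩
    simp only [Expr.eval]
    rw [hev _ σ' k1, k2, Nat.sub_self]
  · rintro j hj σ' h' ⟨k1, k2⟩
    refine ⟨?_, Ensures.seq t 6 (by omega) ((hstep j hj σ' h' k1).mono le_rfl ?_)⟩
    · simp only [Expr.eval]
      rw [hev _ σ' k1, k2]
      omega
    rintro σ'' h'' ⟨k3, k4⟩
    refine Ensures.wp h'' (by decide) ?_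
    simp only [wp, Expr.eval]
    exact ⟨by omega, by omega, hstable _ _ _ k3, by simp [k4, k2]⟩

/-- Multiplication by repeated addition. -/
theorem repeatProg_add_spec {σ : State} (h : σ.Within B) (hB : 32 ≤ B.addr) {e : Expr}
    {a b N : ℕ} (ha : a < 32) (ha' : a ≠ 24) (hb : b ≠ 24) (hab : a ≠ b) (he : e.cost ≤ 5)
    (hN : N ≤ B.val) (hV : σ.mem a + σ.mem b * N ≤ B.val)
    (hev : ∀ σ' : State, Same (fun c => c ≠ 24 ∧ c ≠ a) σ σ' → e.eval S σ' = N) :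
    Ensures S B (repeatProg e (setReg a (.plus (reg a) (reg b)))) σ (40 * N + 20) fun σ' =>
      Same (fun c => c ≠ 24 ∧ c ≠ a) σ σ' ∧ σ'.mem a = σ.mem a + σ.mem b * N := by
  refine repeatProg_spec h hB he 20 N le_rfl hN (fun j σ' => Same (fun c => c ≠ 24 ∧ c ≠ a) σ σ' ∧
    σ'.mem a = σ.mem a + σ.mem b * j) ⟨Same.refl _ _, by simp⟩ ?_ (fun j σ' hs => hev σ' hs.1) ?_
  · rintro j σ' v ⟨k1, k2⟩
    refine ⟨⟨k1.drawn, k1.out, fun c hc => ?_⟩, by simp [ha', k2]⟩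
    simp [hc.1, k1.mem c hc]
  · rintro j hj σ' h' ⟨k1, k2⟩
    have hle : σ.mem b * (j + 1) ≤ σ.mem b * N := Nat.mul_le_mul_left _ hj
    have kb := k1.mem b ⟨hb, hab.symm⟩
    refine Ensures.wp h' (by simp only [loopFreeTime, Expr.cost]; omega) ?_
    simp only [wp, Expr.eval]
    rw [Nat.mul_succ] at hle
    refine ⟨by omega, by omega, ⟨⟨k1.drawn, k1.out, fun c hc => ?_⟩, ?_⟩, ?_⟩
    · simp [hc.2, k1.mem c hc]
    · simp [k2, kb, Nat.mul_succ, add_assoc]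
    · simp [ha'.symm]

/-- A power of two by repeated doubling. -/
theorem repeatProg_double_spec {σ : State} (h : σ.Within B) (hB : 32 ≤ B.addr) {e : Expr}
    {a N : ℕ} (ha : a < 32) (ha' : a ≠ 24) (he : e.cost ≤ 5)
    (hN : N ≤ B.val) (hV : σ.mem a * 2 ^ N ≤ B.val)
    (hev : ∀ σ' : State, Same (fun c => c ≠ 24 ∧ c ≠ a) σ σ' → e.eval S σ' = N) :
    Ensures S B (repeatProg e (setReg a (.plus (reg a) (reg a)))) σ (40 * N + 20) fun σ' =>
      Same (fun c => c ≠ 24 ∧ c ≠ a) σ σ' ∧ σ'.mem a = σ.mem a * 2 ^ N := by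
  refine repeatProg_spec h hB he 20 N le_rfl hN (fun j σ' => Same (fun c => c ≠ 24 ∧ c ≠ a) σ σ' ∧
    σ'.mem a = σ.mem a * 2 ^ j) ⟨Same.refl _ _, by simp⟩ ?_ (fun j σ' hs => hev σ' hs.1) ?_
  · rintro j σ' v ⟨k1, k2⟩
    refine ⟨⟨k1.drawn, k1.out, fun c hc => ?_⟩, by simp [ha', k2]⟩
    simp [hc.1, k1.mem c hc]
  · rintro j hj σ' h' ⟨k1, k2⟩
    have hle : σ.mem a * 2 ^ (j + 1) ≤ σ.mem a * 2 ^ N :=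
      Nat.mul_le_mul_left _ (Nat.pow_le_pow_right (by norm_num) hj)
    rw [pow_succ, ← mul_assoc] at hle
    refine Ensures.wp h' (by simp only [loopFreeTime, Expr.cost]; omega) ?_
    simp only [wp, Expr.eval]
    refine ⟨by omega, by omega, ⟨⟨k1.drawn, k1.out, fun c hc => ?_⟩, ?_⟩, ?_⟩
    · simp [hc.2, k1.mem c hc]
    · simp [k2, pow_succ]; ring
    · simp [ha'.symm]

theorem repeatProg_draw_spec {σ : State} (h : σ.Within B) (hB : 32 ≤ B.addr) (hd : σ.drawn = 0)
    (hq : σ.mem 7 = q) (hN : q ≤ B.val) (hV : q ≤ B.draws) :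
    Ensures S B (repeatProg (reg 7) .draw) σ (40 * q + 20) fun σ' =>
      σ'.drawn = q ∧ σ'.out = σ.out ∧ ∀ c, c ≠ 24 → σ'.mem c = σ.mem c := by
  refine repeatProg_spec h hB (by decide) 20 q le_rfl hN (fun j σ' => σ'.drawn = j ∧
    σ'.out = σ.out ∧ ∀ c, c ≠ 24 → σ'.mem c = σ.mem c) ⟨hd, rfl, fun _ _ => rfl⟩ ?_ ?_ ?_
  · rintro j σ' v ⟨k1, k2, k3⟩
    refine ⟨k1, k2, fun c hc => ?_⟩
    simp [hc, k3 c hc]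
  · rintro j σ' ⟨-, -, k3⟩
    simp only [Expr.eval]
    rw [k3 7 (by omega), hq]
  · rintro j hj σ' h' ⟨k1, k2, k3⟩
    refine Ensures.wp h' (by simp only [loopFreeTime]; omega) ?_
    simp only [wp]
    exact ⟨by omega, by omega, ⟨by omega, k2, k3⟩, trivial⟩

end Setup
end DTLearn

namespace DTLearn

/-! ### The learner -/

/-- The number of levels between two checks of the cost. -/
def blockDepth (s : ℕ) : ℕ := 2 * Nat.clog 2 s

/-- The quotient `2 * clog (2 * E) / blockDepth`, rounded up. -/
def rounds (s E : ℕ) : ℕ := (2 * Nat.clog 2 (2 * E) + (blockDepth s - 1)) / blockDepth s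

/-- The depth of the tree that is returned. -/
def levels (s E : ℕ) : ℕ := blockDepth s * rounds s E

def sampleUnit (n s E D : ℕ) : ℕ := 2 ^ (levels s E + 1) * Nat.clog 2 (n + 3) + D

/-- The number of examples. -/
def sampleSize (n s E D : ℕ) : ℕ := sampleUnit n s E D * (2 * E)

/-- The size that is used in place of `s`. -/
def effectiveSize (n s : ℕ) : ℕ := if n ≤ 1 then 2 else s

/-- The stack must hold the path, at most `levels` frames, and the search above it, at most
`blockDepth` frames. The bound on values is a sum of all numbers that are ever stored. Only `n` and
`2 ^ clog (n + 3)` in it are of order `n`; their bit lengths are logarithmic. -/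
def runLim (n s s' E D : ℕ) : Lim where
  addr := 5 * (levels s' E + blockDepth s') + 37
  val := 5 * (levels s' E + blockDepth s') + 37 + sampleSize n s' E D + 2 * (s' + 1) + n + s + E + D
    + 2 ^ Nat.clog 2 s' + 2 ^ Nat.clog 2 (2 * E) + 2 ^ Nat.clog 2 (n + 3) + 2 ^ (levels s' E + 1)
    + sampleUnit n s' E D
  draws := sampleSize n s' E D
  len := 2 ^ (levels s' E + 1)

/-- A bound for the running time. -/
def runTime (n s E D : ℕ) : ℕ :=
  40 * (Nat.clog 2 s + Nat.clog 2 (2 * E) + rounds s E + levels s E + 2 * Nat.clog 2 (n + 3)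
    + 2 * E + sampleSize n s E D) + 600 +
  4 ^ levels s E * nodeTime n (sampleSize n s E D) (levels s E + blockDepth s) (blockDepth s)

/-- Half of `n` vanishes exactly for `n ≤ 1`. -/
def sizeProg : Prog := .ite (.half (reg 0)) .skip (setReg 1 (.const 2))

def blockProg : Prog :=
  setReg 4 (.plus (reg 22) (reg 22)) ;; setReg 5 (.plus (reg 1) (.const 1)) ;;
  setReg 26 (.const 0)

def levelsProg : Prog :=
  .loop (.minus (.plus (reg 25) (reg 25)) (reg 26)) (setReg 26 (.plus (reg 26) (reg 4)))

def rootProg : Prog :=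
  setReg 8 (.plus (.plus (.plus (reg 26) (reg 26)) (.plus (.plus (reg 26) (reg 26)) (reg 26)))
    (.const 32)) ;;
  setReg 9 (.const 32) ;; setReg 20 (.const 1) ;; setReg 21 (reg 4)

/-- The learner for sizes `s ≥ 2` and dimensions `n ≥ 1`. -/
def mainProg : Prog :=
  sizeProg ;; logProg (reg 1) 22 ;; logProg (.plus (reg 2) (reg 2)) 25 ;; blockProg ;;
  levelsProg ;; setReg 27 (.const 2) ;; repeatProg (reg 26) (setReg 27 (.plus (reg 27) (reg 27))) ;;
  logProg (.plus (reg 0) (.const 3)) 28 ;; setReg 29 (reg 3) ;;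
  repeatProg (reg 28) (setReg 29 (.plus (reg 29) (reg 27))) ;; setReg 7 (.const 0) ;;
  repeatProg (.plus (reg 2) (reg 2)) (setReg 7 (.plus (reg 7) (reg 29))) ;;
  repeatProg (reg 7) .draw ;; rootProg ;; growLoop

/-- Enough rounds for the accuracy, `2 * E ≤ 2 ^ (l * k)`. It also shows that `levelsProg` stops
after this many rounds; `mul_lt_of_lt_rounds` shows that it does not stop earlier. -/
theorem le_rounds {s E : ℕ} (hs : 2 ≤ s) :
    Nat.clog 2 (2 * E) ≤ Nat.clog 2 s * rounds s E := by
  have hl : 0 < Nat.clog 2 s := Nat.clog_pos (by norm_num) hs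
  have h1 : 0 < blockDepth s := by unfold blockDepth; omega
  have h2 := Nat.div_add_mod (2 * Nat.clog 2 (2 * E) + (blockDepth s - 1)) (blockDepth s)
  have h3 := Nat.mod_lt (2 * Nat.clog 2 (2 * E) + (blockDepth s - 1)) h1
  change blockDepth s * rounds s E + _ = _ at h2
  have h4 : blockDepth s * rounds s E = 2 * (Nat.clog 2 s * rounds s E) := by
    unfold blockDepth; ring
  omega

theorem mul_lt_of_lt_rounds {s E j : ℕ} (hs : 2 ≤ s) (hj : j < rounds s E) :
    blockDepth s * j < 2 * Nat.clog 2 (2 * E) := by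
  have hl : 0 < Nat.clog 2 s := Nat.clog_pos (by norm_num) hs
  have h1 : 0 < blockDepth s := by unfold blockDepth; omega
  have h2 := Nat.div_mul_le_self (2 * Nat.clog 2 (2 * E) + (blockDepth s - 1)) (blockDepth s)
  change rounds s E * blockDepth s ≤ _ at h2
  have h3 : (j + 1) * blockDepth s ≤ rounds s E * blockDepth s := Nat.mul_le_mul_right _ hj
  rw [Nat.succ_mul, mul_comm] at h3
  omega

/-! ### Correctness and running time of the whole program. -/

section Main
variable {n q : ℕ} {S : Fin q → Cube n × Bool}

theorem start_mem (a b c d : ℕ) : (State.start a b c d).mem 0 = a ∧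
    (State.start a b c d).mem 1 = b ∧ (State.start a b c d).mem 2 = c ∧
    (State.start a b c d).mem 3 = d ∧ ∀ i, 4 ≤ i → (State.start a b c d).mem i = 0 := by
  refine ⟨?_, ?_, ?_, ?_, fun i hi => ?_⟩
  all_goals simp [State.start, Finsupp.single_apply]
  omega

theorem start_within {B : Lim} {a b c d : ℕ} (h : 4 ≤ B.addr) (ha : a ≤ B.val) (hb : b ≤ B.val)
    (hc : c ≤ B.val) (hd : d ≤ B.val) : (State.start a b c d).Within B := by
  obtain ⟨h0, h1, h2, h3, h4⟩ := start_mem a b c d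
  refine ⟨fun i hi => h4 i (by omega), fun i => ?_, Nat.zero_le _, Nat.zero_le _, ?_⟩
  · rcases Nat.lt_or_ge i 4 with hi | hi
    · interval_cases i <;> omega
    · rw [h4 i hi]; exact Nat.zero_le _
  · intro k hk
    exact absurd hk (by simp [State.start])

theorem mainProg_spec {s E D : ℕ} (hn : 0 < n) (hs : 2 ≤ s) (hE : 0 < E)
    (hq : q = sampleSize n (effectiveSize n s) E D) :
    Ensures S (runLim n s (effectiveSize n s) E D) mainProg (State.start n s E D)
      (runTime n (effectiveSize n s) E D) fun σ' => σ'.out =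
        tokens S (effectiveSize n s + 1) (blockDepth (effectiveSize n s))
          (levels (effectiveSize n s) E) (Finset.range q) := by
  obtain ⟨e0, e1, e2, e3, -⟩ := start_mem n s E D
  have hd0 : (State.start n s E D).drawn = 0 := rfl
  have ho0 : (State.start n s E D).out = [] := rfl
  have hw : (State.start n s E D).Within (runLim n s (effectiveSize n s) E D) := by
    have p0 : 0 < 2 ^ levels (effectiveSize n s) E := by positivity
    have p1 : 0 < 2 ^ Nat.clog 2 (effectiveSize n s) := by positivity
    have p2 : 0 < 2 ^ Nat.clog 2 (2 * E) := by positivity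
    have p3 : 0 < 2 ^ Nat.clog 2 (n + 3) := by positivity
    apply start_within <;> simp only [runLim] <;> omega
  have hs' : 2 ≤ effectiveSize n s := by unfold effectiveSize; split_ifs <;> omega
  have hsz : (State.start n s E D).mem 0 / 2 = 0 ↔ n ≤ 1 := by rw [e0]; omega
  generalize State.start n s E D = σ at *
  obtain ⟨t, ht⟩ : ∃ t, t = effectiveSize n s := ⟨_, rfl⟩
  have hsz' : (if n ≤ 1 then 2 else s) = t := by rw [ht, effectiveSize]
  rw [← ht] at hq hw hs' ⊢
  -- The limits are made opaque and kept only as linear equations, so that `omega` can settle all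
  -- resource conditions below.
  obtain ⟨B, hB⟩ : ∃ B, B = runLim n s t E D := ⟨_, rfl⟩
  rw [← hB] at hw ⊢
  have hA : 5 * (levels t E + blockDepth t) + 37 = B.addr := by rw [hB]; rfl
  have hV : 5 * (levels t E + blockDepth t) + 37 + sampleSize n t E D + 2 * (t + 1) + n + s + E + D
    + 2 ^ Nat.clog 2 t + 2 ^ Nat.clog 2 (2 * E) + 2 ^ Nat.clog 2 (n + 3) + 2 ^ (levels t E + 1)
    + sampleUnit n t E D = B.val := by rw [hB]; rfl
  have hDr : B.draws = sampleSize n t E D := by rw [hB]; rfl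
  have hLen : B.len = 2 ^ (levels t E + 1) := by rw [hB]; rfl
  clear hB
  have hl : 0 < Nat.clog 2 t := Nat.clog_pos (by norm_num) hs'
  have hK : 0 < 2 ^ levels t E := by positivity
  have hK2 : levels t E < 2 ^ levels t E := Nat.lt_two_pow_self
  have hP : 2 ^ (levels t E + 1) = 2 * 2 ^ levels t E := pow_succ' _ _
  have hl2 : Nat.clog 2 t < 2 ^ Nat.clog 2 t := Nat.lt_two_pow_self
  have he2 : Nat.clog 2 (2 * E) < 2 ^ Nat.clog 2 (2 * E) := Nat.lt_two_pow_self
  have hg2 : Nat.clog 2 (n + 3) < 2 ^ Nat.clog 2 (n + 3) := Nat.lt_two_pow_self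
  have hd : blockDepth t = Nat.clog 2 t + Nat.clog 2 t := by unfold blockDepth; omega
  have hT : runTime n t E D = 40 * (Nat.clog 2 t + Nat.clog 2 (2 * E) + rounds t E + levels t E
    + 2 * Nat.clog 2 (n + 3) + 2 * E + sampleSize n t E D) + 600 +
    4 ^ levels t E * nodeTime n (sampleSize n t E D) (levels t E + blockDepth t) (blockDepth t) :=
    rfl
  rw [hT]
  generalize hTg : 4 ^ levels t E *
    nodeTime n (sampleSize n t E D) (levels t E + blockDepth t) (blockDepth t) = Tg
  clear hT
  unfold mainProg
  -- the size
  refine Ensures.seq 20 (40 * (Nat.clog 2 t + Nat.clog 2 (2 * E) + rounds t E + levels t E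
    + 2 * Nat.clog 2 (n + 3) + 2 * E + sampleSize n t E D) + 580 + Tg) (by omega)
    (Ensures.mono (Q := fun σ' => Same (fun a => a ≠ 1) σ σ' ∧ σ'.mem 1 = t)
    (Ensures.wp hw (by decide) ?_) le_rfl ?_)
  · simp only [sizeProg, wp, Expr.eval]
    refine ⟨fun hc => ⟨Same.refl _ _, ?_⟩, fun hc => ⟨by omega, by omega,
      ⟨⟨rfl, rfl, fun a ha => by simp [ha]⟩, ?_⟩⟩⟩
    · have : ¬ n ≤ 1 := fun h => hc (hsz.2 h)
      rw [e1, ← hsz', if_neg this]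
    · have := hsz.1 hc
      simp [← hsz', this]
  rintro σ₁ h₁ ⟨r₁, f1⟩
  have f0 := (r₁.mem 0 (by omega)).trans e0
  have f2 := (r₁.mem 2 (by omega)).trans e2
  have f3 := (r₁.mem 3 (by omega)).trans e3
  have fd := r₁.drawn.trans hd0
  have fo := r₁.out.trans ho0
  clear r₁ e0 e1 e2 e3 hd0 ho0 hw hsz
  -- the logarithm of the size
  refine Ensures.seq (40 * Nat.clog 2 t + 40) (40 * (Nat.clog 2 (2 * E) + rounds t E + levels t E
    + 2 * Nat.clog 2 (n + 3) + 2 * E + sampleSize n t E D) + 540 + Tg) (by omega)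
    ((logProg_spec h₁ (by omega) (by omega) (by omega) (by decide) (x := t) (by omega)
      fun σ' hσ' => ?_).mono le_rfl ?_)
  · simp only [Expr.eval]
    rw [hσ'.mem 1 (by omega), f1]
  rintro σ₂ h₂ ⟨r, f22⟩
  replace f0 := (r.mem 0 (by omega)).trans f0
  replace f1 := (r.mem 1 (by omega)).trans f1
  replace f2 := (r.mem 2 (by omega)).trans f2
  replace f3 := (r.mem 3 (by omega)).trans f3
  replace fd := r.drawn.trans fd
  replace fo := r.out.trans fo
  clear r h₁
  -- the logarithm of the accuracy
  refine Ensures.seq (40 * Nat.clog 2 (2 * E) + 40) (40 * (rounds t E + levels t E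
    + 2 * Nat.clog 2 (n + 3) + 2 * E + sampleSize n t E D) + 500 + Tg) (by omega)
    ((logProg_spec h₂ (by omega) (by omega) (by omega) (by decide) (x := 2 * E) (by omega)
      fun σ' hσ' => ?_).mono le_rfl ?_)
  · simp only [Expr.eval]
    rw [hσ'.mem 2 (by omega), f2]; omega
  rintro σ₃ h₃ ⟨r, f25⟩
  replace f0 := (r.mem 0 (by omega)).trans f0
  replace f1 := (r.mem 1 (by omega)).trans f1
  replace f2 := (r.mem 2 (by omega)).trans f2
  replace f3 := (r.mem 3 (by omega)).trans f3
  replace f22 := (r.mem 22 (by omega)).trans f22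
  replace fd := r.drawn.trans fd
  replace fo := r.out.trans fo
  clear r h₂
  -- the depth of a block
  refine Ensures.wp_seq (40 * (rounds t E + levels t E
    + 2 * Nat.clog 2 (n + 3) + 2 * E + sampleSize n t E D) + 470 + Tg) h₃
    (by simp only [loopFreeTime, blockProg, Expr.cost]; omega) ?_
  simp only [blockProg, wp, Expr.eval]
  simp only [f22, ← hd]
  refine ⟨by omega, by omega, by omega, by simp [f1]; omega, by omega, by omega, ?_⟩
  generalize hσ₄ : State.mk _ _ _ = σ₄
  intro h₄
  replace f0 : σ₄.mem 0 = n := by rw [← hσ₄]; simp [f0]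
  replace f2 : σ₄.mem 2 = E := by rw [← hσ₄]; simp [f2]
  replace f3 : σ₄.mem 3 = D := by rw [← hσ₄]; simp [f3]
  have f4 : σ₄.mem 4 = blockDepth t := by rw [← hσ₄]; simp
  have f5 : σ₄.mem 5 = t + 1 := by rw [← hσ₄]; simp [f1]
  have f26 : σ₄.mem 26 = 0 := by rw [← hσ₄]; simp
  replace f25 : σ₄.mem 25 = Nat.clog 2 (2 * E) := by rw [← hσ₄]; simp [f25]
  replace fd : σ₄.drawn = 0 := by rw [← hσ₄]; exact fd
  replace fo : σ₄.out = [] := by rw [← hσ₄]; exact fo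
  clear hσ₄ h₃ f22 f1
  -- the number of levels
  have hle := le_rounds (s := t) (E := E) hs'
  have hlev : levels t E = 2 * (Nat.clog 2 t * rounds t E) := by
    unfold levels blockDepth; ring
  refine Ensures.seq (40 * rounds t E + 40) (40 * (levels t E
    + 2 * Nat.clog 2 (n + 3) + 2 * E + sampleSize n t E D) + 430 + Tg) (by omega)
    ((Ensures.loop 10 (fun j σ' => Same (fun a => a ≠ 26) σ₄ σ' ∧ σ'.mem 26 = blockDepth t * j)
      (rounds t E) ?_ h₄ ⟨Same.refl _ _, by rw [f26, mul_zero]⟩ ?_ ?_).mono le_rfl ?_)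
  · simp only [Expr.cost]; omega
  · rintro σ' ⟨k1, k2⟩
    change _ = levels t E at k2
    simp only [Expr.eval]
    rw [k1.mem 25 (by omega), f25, k2]; omega
  · rintro j hj σ' h' ⟨k1, k2⟩
    have hlt := mul_lt_of_lt_rounds hs' hj
    have hj' : blockDepth t * (j + 1) ≤ levels t E := Nat.mul_le_mul_left _ hj
    rw [Nat.mul_succ] at hj'
    refine ⟨?_, Ensures.wp h' (by decide) ?_⟩
    · simp only [Expr.eval]
      rw [k1.mem 25 (by omega), f25, k2]; omega
    simp only [wp, Expr.eval]
    rw [k1.mem 4 (by omega), f4, k2]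
    exact ⟨by omega, by omega, ⟨k1.drawn, k1.out, fun a ha => by simp [ha, k1.mem a ha]⟩,
      by simp [Nat.mul_succ]⟩
  rintro σ₅ h₅ ⟨r, f26'⟩
  change _ = levels t E at f26'
  replace f26 := f26'
  replace f0 := (r.mem 0 (by omega)).trans f0
  replace f2 := (r.mem 2 (by omega)).trans f2
  replace f3 := (r.mem 3 (by omega)).trans f3
  replace f4 := (r.mem 4 (by omega)).trans f4
  replace f5 := (r.mem 5 (by omega)).trans f5
  replace fd := r.drawn.trans fd
  replace fo := r.out.trans fo
  clear r h₄ f26' f25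
  -- the sample size
  refine Ensures.wp_seq (40 * (levels t E
    + 2 * Nat.clog 2 (n + 3) + 2 * E + sampleSize n t E D) + 420 + Tg) h₅
    (by simp only [loopFreeTime, Expr.cost]; omega) ?_
  simp only [wp, Expr.eval]
  refine ⟨by omega, by omega, ?_⟩
  generalize hσ₆ : State.mk _ _ _ = σ₆
  intro h₆
  replace f0 : σ₆.mem 0 = n := by rw [← hσ₆]; simp [f0]
  replace f2 : σ₆.mem 2 = E := by rw [← hσ₆]; simp [f2]
  replace f3 : σ₆.mem 3 = D := by rw [← hσ₆]; simp [f3]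
  replace f4 : σ₆.mem 4 = blockDepth t := by rw [← hσ₆]; simp [f4]
  replace f5 : σ₆.mem 5 = t + 1 := by rw [← hσ₆]; simp [f5]
  replace f26 : σ₆.mem 26 = levels t E := by rw [← hσ₆]; simp [f26]
  have f27 : σ₆.mem 27 = 2 := by rw [← hσ₆]; simp
  replace fd : σ₆.drawn = 0 := by rw [← hσ₆]; exact fd
  replace fo : σ₆.out = [] := by rw [← hσ₆]; exact fo
  clear hσ₆ h₅
  refine Ensures.seq (40 * levels t E + 20) (40 * (2 * Nat.clog 2 (n + 3) + 2 * E
    + sampleSize n t E D) + 400 + Tg) (by omega)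
    ((repeatProg_double_spec h₆ (by omega) (by omega) (by omega) (by decide) (N := levels t E)
      (by omega) (by rw [f27]; omega) fun σ' hσ' => ?_).mono le_rfl ?_)
  · simp only [Expr.eval]
    rw [hσ'.mem 26 (by omega), f26]
  rintro σ₇ h₇ ⟨r, f27'⟩
  rw [f27, ← hP] at f27'
  replace f27 := f27'
  replace f0 := (r.mem 0 (by omega)).trans f0
  replace f2 := (r.mem 2 (by omega)).trans f2
  replace f3 := (r.mem 3 (by omega)).trans f3
  replace f4 := (r.mem 4 (by omega)).trans f4
  replace f5 := (r.mem 5 (by omega)).trans f5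
  replace f26 := (r.mem 26 (by omega)).trans f26
  replace fd := r.drawn.trans fd
  replace fo := r.out.trans fo
  clear r h₆ f27'
  refine Ensures.seq (40 * Nat.clog 2 (n + 3) + 40) (40 * (Nat.clog 2 (n + 3) + 2 * E
    + sampleSize n t E D) + 360 + Tg) (by omega)
    ((logProg_spec h₇ (by omega) (by omega) (by omega) (by decide) (x := n + 3) (by omega)
      fun σ' hσ' => ?_).mono le_rfl ?_)
  · simp only [Expr.eval]
    rw [hσ'.mem 0 (by omega), f0]
  rintro σ₈ h₈ ⟨r, f28⟩
  replace f0 := (r.mem 0 (by omega)).trans f0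
  replace f2 := (r.mem 2 (by omega)).trans f2
  replace f3 := (r.mem 3 (by omega)).trans f3
  replace f4 := (r.mem 4 (by omega)).trans f4
  replace f5 := (r.mem 5 (by omega)).trans f5
  replace f26 := (r.mem 26 (by omega)).trans f26
  replace f27 := (r.mem 27 (by omega)).trans f27
  replace fd := r.drawn.trans fd
  replace fo := r.out.trans fo
  clear r h₇
  refine Ensures.wp_seq (40 * (Nat.clog 2 (n + 3) + 2 * E + sampleSize n t E D) + 350 + Tg) h₈
    (by simp only [loopFreeTime, Expr.cost]; omega) ?_
  simp only [wp, Expr.eval]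
  refine ⟨by omega, by omega, ?_⟩
  generalize hσ₉ : State.mk _ _ _ = σ₉
  intro h₉
  replace f0 : σ₉.mem 0 = n := by rw [← hσ₉]; simp [f0]
  replace f2 : σ₉.mem 2 = E := by rw [← hσ₉]; simp [f2]
  have f29 : σ₉.mem 29 = D := by rw [← hσ₉]; simp [f3]
  replace f4 : σ₉.mem 4 = blockDepth t := by rw [← hσ₉]; simp [f4]
  replace f5 : σ₉.mem 5 = t + 1 := by rw [← hσ₉]; simp [f5]
  replace f26 : σ₉.mem 26 = levels t E := by rw [← hσ₉]; simp [f26]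
  replace f27 : σ₉.mem 27 = 2 ^ (levels t E + 1) := by rw [← hσ₉]; simp [f27]
  replace f28 : σ₉.mem 28 = Nat.clog 2 (n + 3) := by rw [← hσ₉]; simp [f28]
  replace fd : σ₉.drawn = 0 := by rw [← hσ₉]; exact fd
  replace fo : σ₉.out = [] := by rw [← hσ₉]; exact fo
  clear hσ₉ h₈ f3
  have hunit : D + 2 ^ (levels t E + 1) * Nat.clog 2 (n + 3) = sampleUnit n t E D := by
    unfold sampleUnit; omega
  refine Ensures.seq (40 * Nat.clog 2 (n + 3) + 20) (40 * (2 * E + sampleSize n t E D) + 330 + Tg)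
    (by omega)
    ((repeatProg_add_spec h₉ (by omega) (by omega) (by omega) (by omega) (by omega) (by decide)
      (N := Nat.clog 2 (n + 3)) (by omega) (by rw [f29, f27, hunit]; omega)
      fun σ' hσ' => ?_).mono le_rfl ?_)
  · simp only [Expr.eval]
    rw [hσ'.mem 28 (by omega), f28]
  rintro σ₁₀ h₁₀ ⟨r, f29'⟩
  rw [f29, f27, hunit] at f29'
  replace f29 := f29'
  replace f0 := (r.mem 0 (by omega)).trans f0
  replace f2 := (r.mem 2 (by omega)).trans f2
  replace f4 := (r.mem 4 (by omega)).trans f4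
  replace f5 := (r.mem 5 (by omega)).trans f5
  replace f26 := (r.mem 26 (by omega)).trans f26
  replace fd := r.drawn.trans fd
  replace fo := r.out.trans fo
  clear r h₉ f29' f27 f28
  refine Ensures.wp_seq (40 * (2 * E + sampleSize n t E D) + 320 + Tg) h₁₀
    (by simp only [loopFreeTime, Expr.cost]; omega) ?_
  simp only [wp, Expr.eval]
  refine ⟨by omega, by omega, ?_⟩
  generalize hσ₁₁ : State.mk _ _ _ = σ₁₁
  intro h₁₁
  replace f0 : σ₁₁.mem 0 = n := by rw [← hσ₁₁]; simp [f0]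
  replace f2 : σ₁₁.mem 2 = E := by rw [← hσ₁₁]; simp [f2]
  replace f29 : σ₁₁.mem 29 = sampleUnit n t E D := by rw [← hσ₁₁]; simp [f29]
  replace f4 : σ₁₁.mem 4 = blockDepth t := by rw [← hσ₁₁]; simp [f4]
  replace f5 : σ₁₁.mem 5 = t + 1 := by rw [← hσ₁₁]; simp [f5]
  replace f26 : σ₁₁.mem 26 = levels t E := by rw [← hσ₁₁]; simp [f26]
  have f7 : σ₁₁.mem 7 = 0 := by rw [← hσ₁₁]; simp
  replace fd : σ₁₁.drawn = 0 := by rw [← hσ₁₁]; exact fd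
  replace fo : σ₁₁.out = [] := by rw [← hσ₁₁]; exact fo
  clear hσ₁₁ h₁₀
  have hsize : 0 + sampleUnit n t E D * (2 * E) = q := by rw [hq, zero_add]; rfl
  refine Ensures.seq (40 * (2 * E) + 20) (40 * sampleSize n t E D + 300 + Tg)
    (by omega)
    ((repeatProg_add_spec h₁₁ (by omega) (by omega) (by omega) (by omega) (by omega) (by decide)
      (N := 2 * E) ?_ (by rw [f29, f7, hsize]; omega)
      fun σ' hσ' => ?_).mono le_rfl ?_)
  · have := Nat.le_pow_clog (b := 2) (by norm_num) (2 * E); omega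
  · simp only [Expr.eval]
    rw [hσ'.mem 2 (by omega), f2]; omega
  rintro σ₁₂ h₁₂ ⟨r, f7'⟩
  rw [f29, f7, hsize] at f7'
  replace f7 := f7'
  replace f0 := (r.mem 0 (by omega)).trans f0
  replace f4 := (r.mem 4 (by omega)).trans f4
  replace f5 := (r.mem 5 (by omega)).trans f5
  replace f26 := (r.mem 26 (by omega)).trans f26
  replace fd := r.drawn.trans fd
  replace fo := r.out.trans fo
  clear r h₁₁ f7' f29 f2
  -- the examples
  refine Ensures.seq (40 * q + 20) (280 + Tg) (by omega) ((repeatProg_draw_spec h₁₂ (by omega)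
    fd f7 (by omega) (by omega)).mono le_rfl ?_)
  rintro σ₁₃ h₁₃ ⟨kd, ko, km⟩
  replace f0 := (km 0 (by omega)).trans f0
  replace f4 := (km 4 (by omega)).trans f4
  replace f5 := (km 5 (by omega)).trans f5
  replace f7 := (km 7 (by omega)).trans f7
  replace f26 := (km 26 (by omega)).trans f26
  replace fd := kd
  replace fo := ko.trans fo
  clear km h₁₂ kd ko
  -- the tree
  refine Ensures.wp_seq (200 + Tg) h₁₃
    (by simp only [loopFreeTime, rootProg, Expr.cost]; omega) ?_
  simp only [rootProg, wp, Expr.eval]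
  refine ⟨by omega, by omega, by omega, by omega, by omega, by omega, by omega, by simp [f4]; omega,
    ?_⟩
  generalize hσ₁₄ : State.mk _ _ _ = σ₁₄
  intro h₁₄
  have hroot : AtNode n q (t + 1) (blockDepth t) 0 (levels t E) σ₁₄ := by
    have hhor : horizon (blockDepth t) (levels t E) = blockDepth t := by
      simp [horizon, levels]
    rw [← hσ₁₄]
    constructor
    · exact fd
    all_goals simp [f0, f4, f5, f7, f26, hhor]
    omega
  have hout : σ₁₄.out = [] := by rw [← hσ₁₄]; exact fo
  -- At the root the path is empty and all examples are active. A tree of `levels` levels and a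
  -- search of `blockDepth` further levels fit into `Λ` frames.
  refine Ensures.mono (Reach.halt (Reach.mono (grow_reach (Λ := levels t E + blockDepth t)
    ⟨by omega, by omega⟩ (by omega) hn (by omega) (by omega) h₁₄ hroot (by rw [hout, hLen]; simp))
    (by rw [← hTg, ← hq]) ?_)) (t := Tg + 8) (by omega) fun _ _ h => h
  rintro σ' - ⟨k1, k2, k3, k4⟩
  rw [hout, active_zero, List.nil_append] at k4
  refine ⟨?_, k4⟩
  simp only [growCond, Expr.eval]
  rw [k1 9 (by omega), hroot.top, k2]

end Main
end DTLearn

namespace DTLearn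

/-! ### Polynomial bounds -/

/-- `F` is polynomially bounded in `Y`. -/
def IsPoly {ι : Type*} (Y : ι → ℝ) (F : ι → ℕ) : Prop := ∃ C : ℕ, ∀ i, (F i : ℝ) ≤ C * Y i ^ C

section Poly
variable {ι : Type*} {Y : ι → ℝ}

theorem mul_pow_le_mul_pow {y : ℝ} (hy : 1 ≤ y) {C C' : ℕ} (h : C ≤ C') :
    (C : ℝ) * y ^ C ≤ C' * y ^ C' := by
  have h1 : (C : ℝ) ≤ C' := by exact_mod_cast h
  have h2 : y ^ C ≤ y ^ C' := pow_le_pow_right₀ hy h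
  have h3 : 0 ≤ y ^ C := by positivity
  exact mul_le_mul h1 h2 h3 (by positivity)

theorem IsPoly.mono {F G : ι → ℕ} (hG : IsPoly Y G) (h : ∀ i, F i ≤ G i) : IsPoly Y F := by
  obtain ⟨C, hC⟩ := hG
  exact ⟨C, fun i => le_trans (by exact_mod_cast h i) (hC i)⟩

theorem IsPoly.of_le {F : ι → ℕ} (hY : ∀ i, 1 ≤ Y i) (c k : ℕ) (h : ∀ i, (F i : ℝ) ≤ c * Y i ^ k) :
    IsPoly Y F := by
  refine ⟨max c k, fun i => (h i).trans ?_⟩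
  have h1 : (c : ℝ) ≤ (max c k : ℕ) := by exact_mod_cast le_max_left c k
  have h2 : Y i ^ k ≤ Y i ^ max c k := pow_le_pow_right₀ (hY i) (le_max_right c k)
  have := hY i
  exact mul_le_mul h1 h2 (by positivity) (by positivity)

theorem IsPoly.const (hY : ∀ i, 1 ≤ Y i) (c : ℕ) : IsPoly Y fun _ => c :=
  .of_le hY c 0 fun i => by simp

theorem IsPoly.mul {F G : ι → ℕ} (hY : ∀ i, 1 ≤ Y i) (hF : IsPoly Y F) (hG : IsPoly Y G) :
    IsPoly Y fun i => F i * G i := by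
  obtain ⟨C, hC⟩ := hF
  obtain ⟨C', hC'⟩ := hG
  refine .of_le hY (C * C') (C + C') fun i => ?_
  have := hY i
  push_cast
  calc (F i : ℝ) * G i ≤ (C * Y i ^ C) * (C' * Y i ^ C') :=
        mul_le_mul (hC i) (hC' i) (by positivity) (by positivity)
    _ = _ := by rw [pow_add]; ring

theorem IsPoly.add {F G : ι → ℕ} (hY : ∀ i, 1 ≤ Y i) (hF : IsPoly Y F) (hG : IsPoly Y G) :
    IsPoly Y fun i => F i + G i := by
  obtain ⟨C, hC⟩ := hF
  obtain ⟨C', hC'⟩ := hG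
  refine .of_le hY (C + C') (max C C') fun i => ?_
  have h0 := hY i
  have h1 : Y i ^ C ≤ Y i ^ max C C' := pow_le_pow_right₀ h0 (le_max_left _ _)
  have h2 : Y i ^ C' ≤ Y i ^ max C C' := pow_le_pow_right₀ h0 (le_max_right _ _)
  push_cast
  rw [add_mul]
  exact add_le_add ((hC i).trans (by gcongr)) ((hC' i).trans (by gcongr))

theorem IsPoly.pow {F : ι → ℕ} (hY : ∀ i, 1 ≤ Y i) (hF : IsPoly Y F) (k : ℕ) :
    IsPoly Y fun i => F i ^ k := by
  induction k with
  | zero => simpa using IsPoly.const hY 1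
  | succ k ih => simpa only [pow_succ] using IsPoly.mul hY ih hF

theorem two_pow_clog_le {x : ℕ} (hx : 1 ≤ x) : 2 ^ Nat.clog 2 x ≤ 2 * x := by
  rcases hx.eq_or_lt with rfl | hx
  · simp
  · have h1 := Nat.pow_pred_clog_lt_self (b := 2) (by norm_num) hx
    have h2 : 0 < Nat.clog 2 x := Nat.clog_pos (by norm_num) hx
    obtain ⟨k, hk⟩ : ∃ k, Nat.clog 2 x = k + 1 := ⟨Nat.clog 2 x - 1, by omega⟩
    rw [hk] at h1 ⊢
    rw [pow_succ]
    simp only [Nat.pred_succ] at h1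
    omega

theorem clog_le_self (x : ℕ) : Nat.clog 2 x ≤ x := Nat.clog_le_of_le_pow Nat.lt_two_pow_self.le

theorem levels_le {t E : ℕ} : levels t E ≤ 2 * Nat.clog 2 (2 * E) + blockDepth t := by
  have := Nat.mul_div_le (2 * Nat.clog 2 (2 * E) + (blockDepth t - 1)) (blockDepth t)
  unfold levels rounds
  omega

theorem rounds_le {t E : ℕ} (ht : 2 ≤ t) : rounds t E ≤ levels t E := by
  have : 0 < Nat.clog 2 t := Nat.clog_pos (by norm_num) ht
  exact Nat.le_mul_of_pos_left _ (by unfold blockDepth; omega)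

/-- Rounding up to whole blocks adds fewer than `blockDepth t` levels, that is, a factor of at most
`(2 * t) ^ 2`. So a tree of full depth is still polynomial in `t` and `E`. -/
theorem two_pow_levels_le {t E : ℕ} (ht : 1 ≤ t) (hE : 0 < E) :
    2 ^ levels t E ≤ (2 * (2 * E)) ^ 2 * (2 * t) ^ 2 := by
  calc 2 ^ levels t E ≤ 2 ^ (2 * Nat.clog 2 (2 * E) + blockDepth t) :=
        Nat.pow_le_pow_right (by norm_num) levels_le
    _ = (2 ^ Nat.clog 2 (2 * E)) ^ 2 * (2 ^ Nat.clog 2 t) ^ 2 := by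
        rw [blockDepth, pow_add, ← pow_mul, ← pow_mul, mul_comm 2 (Nat.clog 2 (2 * E)),
          mul_comm 2 (Nat.clog 2 t)]
    _ ≤ _ := by
        gcongr
        · exact two_pow_clog_le (by omega)
        · exact two_pow_clog_le ht

variable {n t E D : ι → ℕ}

theorem isPoly_two_pow_levels (hY : ∀ i, 1 ≤ Y i) (ht : IsPoly Y t) (hE : IsPoly Y E)
    (ht2 : ∀ i, 2 ≤ t i) (hE1 : ∀ i, 0 < E i) : IsPoly Y fun i => 2 ^ levels (t i) (E i) :=
  (IsPoly.mul hY (((IsPoly.const hY 2).mul hY ((IsPoly.const hY 2).mul hY hE)).pow hY 2)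
    (((IsPoly.const hY 2).mul hY ht).pow hY 2)).mono
    fun i => two_pow_levels_le ((by omega : 1 ≤ 2).trans (ht2 i)) (hE1 i)

theorem isPoly_sampleUnit (hY : ∀ i, 1 ≤ Y i) (ht : IsPoly Y t) (hE : IsPoly Y E)
    (hD : IsPoly Y D) (hg : IsPoly Y fun i => Nat.clog 2 (n i + 3))
    (ht2 : ∀ i, 2 ≤ t i) (hE1 : ∀ i, 0 < E i) :
    IsPoly Y fun i => sampleUnit (n i) (t i) (E i) (D i) :=
  (((((isPoly_two_pow_levels hY ht hE ht2 hE1).mul hY (.const hY 2)).mul hY hg).add hY hD)).mono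
    fun _ => by rw [sampleUnit, pow_succ]

theorem isPoly_sampleSize (hY : ∀ i, 1 ≤ Y i) (ht : IsPoly Y t) (hE : IsPoly Y E)
    (hD : IsPoly Y D) (hg : IsPoly Y fun i => Nat.clog 2 (n i + 3))
    (ht2 : ∀ i, 2 ≤ t i) (hE1 : ∀ i, 0 < E i) :
    IsPoly Y fun i => sampleSize (n i) (t i) (E i) (D i) :=
  (isPoly_sampleUnit hY ht hE hD hg ht2 hE1).mul hY ((IsPoly.const hY 2).mul hY hE)

theorem isPoly_levels (hY : ∀ i, 1 ≤ Y i) (ht : IsPoly Y t) (hE : IsPoly Y E)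
    (ht2 : ∀ i, 2 ≤ t i) (hE1 : ∀ i, 0 < E i) : IsPoly Y fun i => levels (t i) (E i) :=
  (isPoly_two_pow_levels hY ht hE ht2 hE1).mono fun _ => Nat.lt_two_pow_self.le

theorem isPoly_blockDepth (hY : ∀ i, 1 ≤ Y i) (ht : IsPoly Y t) :
    IsPoly Y fun i => blockDepth (t i) :=
  ((IsPoly.const hY 2).mul hY ht).mono fun _ => Nat.mul_le_mul_left _ (clog_le_self _)

/-- The power `(4 * n + 1) ^ blockDepth`, from the cost search, is the only quantity that is not
already polynomial in `n`, `t`, `E` and `D`; it enters as the hypothesis `hcost`. -/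
theorem isPoly_runTime (hY : ∀ i, 1 ≤ Y i) (hn : IsPoly Y n) (ht : IsPoly Y t) (hE : IsPoly Y E)
    (hD : IsPoly Y D) (hcost : IsPoly Y fun i => (4 * n i + 1) ^ blockDepth (t i))
    (ht2 : ∀ i, 2 ≤ t i) (hE1 : ∀ i, 0 < E i) :
    IsPoly Y fun i => runTime (n i) (t i) (E i) (D i) := by
  have c := fun k => IsPoly.const hY k
  have hg : IsPoly Y fun i => Nat.clog 2 (n i + 3) :=
    (hn.add hY (c 3)).mono fun i => clog_le_self _
  have hl := isPoly_levels hY ht hE ht2 hE1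
  have hr : IsPoly Y fun i => rounds (t i) (E i) := hl.mono fun i => rounds_le (ht2 i)
  have hq := isPoly_sampleSize hY ht hE hD hg ht2 hE1
  have hb := isPoly_blockDepth hY ht
  have hct : IsPoly Y fun i => Nat.clog 2 (t i) := ht.mono fun i => clog_le_self _
  have hcE : IsPoly Y fun i => Nat.clog 2 (2 * E i) :=
    ((c 2).mul hY hE).mono fun i => clog_le_self _
  have h4 : IsPoly Y fun i => 4 ^ levels (t i) (E i) :=
    ((isPoly_two_pow_levels hY ht hE ht2 hE1).pow hY 2).mono fun i => by
      rw [← pow_mul, mul_comm, pow_mul]; norm_num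
  have hlab : IsPoly Y fun i => sampleSize (n i) (t i) (E i) (D i) *
      (60 * (levels (t i) (E i) + blockDepth (t i)) + 70) :=
    hq.mul hY (((c 60).mul hY (hl.add hY hb)).add hY (c 70))
  exact ((((c 40).mul hY ((((((hct.add hY hcE).add hY hr).add hY hl).add hY
    ((c 2).mul hY hg)).add hY ((c 2).mul hY hE)).add hY hq)).add hY (c 600)).add hY
    (h4.mul hY (((hcost.mul hY (hlab.add hY (c 300))).add hY hlab).add hY (c 300))))

/-- Separates the part of a number that is of order `n`, which must be charged by its logarithm `k`,
from a part `w` that is itself polynomial and may be charged in full. -/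
theorem size_le_add_clog {m w k : ℕ} (h : m ≤ w + 3 * 2 ^ k) : Nat.size m ≤ w + 2 + k := by
  rw [Nat.size_le]
  have h1 : w < 2 ^ w := Nat.lt_two_pow_self
  have h2 : 1 ≤ 2 ^ k := Nat.one_le_two_pow
  have h3 : 1 ≤ 2 ^ w := Nat.one_le_two_pow
  rw [pow_add, pow_add]
  nlinarith [Nat.mul_le_mul h3 h2]

/-- Here `n` may enter only through `clog (n + 3)`: it occurs in the capacity inside bit lengths of
values and, within the sample size, as that logarithm. -/
theorem isPoly_cap (hY : ∀ i, 1 ≤ Y i) {s : ι → ℕ} (hs : IsPoly Y s) (ht : IsPoly Y t)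
    (hE : IsPoly Y E) (hD : IsPoly Y D) (hg : IsPoly Y fun i => Nat.clog 2 (n i + 3))
    (ht2 : ∀ i, 2 ≤ t i) (hE1 : ∀ i, 0 < E i) :
    IsPoly Y fun i => (runLim (n i) (s i) (t i) (E i) (D i)).cap := by
  have c := fun k => IsPoly.const hY k
  have hl := isPoly_levels hY ht hE ht2 hE1
  have hp := isPoly_two_pow_levels hY ht hE ht2 hE1
  have hlen : IsPoly Y fun i => 2 ^ (levels (t i) (E i) + 1) :=
    (hp.mul hY (c 2)).mono fun i => by rw [pow_succ]
  have hq := isPoly_sampleSize hY ht hE hD hg ht2 hE1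
  have hu := isPoly_sampleUnit hY ht hE hD hg ht2 hE1
  have hb := isPoly_blockDepth hY ht
  have hct : IsPoly Y fun i => 2 ^ Nat.clog 2 (t i) :=
    ((c 2).mul hY ht).mono fun i => two_pow_clog_le ((by omega : 1 ≤ 2).trans (ht2 i))
  have hcE : IsPoly Y fun i => 2 ^ Nat.clog 2 (2 * E i) :=
    ((c 2).mul hY ((c 2).mul hY hE)).mono fun i => two_pow_clog_le (by have := hE1 i; omega)
  have haddr : IsPoly Y fun i => 5 * (levels (t i) (E i) + blockDepth (t i)) + 37 :=
    ((c 5).mul hY (hl.add hY hb)).add hY (c 37)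
  have hw : IsPoly Y fun i => 5 * (levels (t i) (E i) + blockDepth (t i)) + 37 +
      sampleSize (n i) (t i) (E i) (D i) + 2 * (t i + 1) + s i + E i + D i + 2 ^ Nat.clog 2 (t i) +
      2 ^ Nat.clog 2 (2 * E i) + 2 ^ (levels (t i) (E i) + 1) +
      sampleUnit (n i) (t i) (E i) (D i) :=
    ((((((((haddr.add hY hq).add hY ((c 2).mul hY (ht.add hY (c 1)))).add hY hs).add hY hE).add hY
      hD).add hY hct).add hY hcE).add hY hlen).add hY hu
  have hval : IsPoly Y fun i => Nat.size (runLim (n i) (s i) (t i) (E i) (D i)).val :=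
    ((hw.add hY (c 2)).add hY hg).mono fun i => size_le_add_clog (by
      have := Nat.le_pow_clog (b := 2) (by norm_num) (n i + 3)
      simp only [runLim]
      omega)
  have hsize : IsPoly Y fun i => Nat.size (runLim (n i) (s i) (t i) (E i) (D i)).addr :=
    haddr.mono fun i => Nat.size_le.2 Nat.lt_two_pow_self
  exact (hq.add hY (haddr.mul hY (hsize.add hY hval))).add hY (hlen.mul hY (hval.add hY (c 1)))

end Poly
end DTLearn

namespace DTLearn

/-! ### The parameters -/

/-- The parameters of a learning problem. -/
structure Params where
  n : ℕ
  s : ℕ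
  ε : ℝ
  δ : ℝ
  ε_pos : 0 < ε
  δ_pos : 0 < δ

namespace Params

noncomputable def accuracy (p : Params) : ℕ := ⌈1 / p.ε⌉₊

noncomputable def confidence (p : Params) : ℕ := ⌈Real.logb 2 (1 / p.δ)⌉₊

noncomputable def timeBase (p : Params) : ℝ :=
  1 + (p.n : ℝ) ^ Real.logb 2 p.s + 1 / p.ε + Real.posLog (1 / p.δ)

noncomputable def spaceBase (p : Params) : ℝ :=
  1 + p.s + Real.log p.n + 1 / p.ε + Real.posLog (1 / p.δ)

theorem accuracy_pos (p : Params) : 0 < p.accuracy :=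
  Nat.ceil_pos.2 (one_div_pos.2 p.ε_pos)

theorem one_div_accuracy_le (p : Params) : 1 / (p.accuracy : ℝ) ≤ p.ε := by
  have h := Nat.le_ceil (1 / p.ε)
  rw [one_div_le (by exact_mod_cast p.accuracy_pos) p.ε_pos]
  exact h

theorem one_le_mul_two_pow_confidence (p : Params) : 1 ≤ p.δ * 2 ^ p.confidence := by
  have h := Nat.le_ceil (Real.logb 2 (1 / p.δ))
  rw [Real.logb_le_iff_le_rpow (by norm_num) (one_div_pos.2 p.δ_pos), Real.rpow_natCast,
    div_le_iff₀ p.δ_pos, mul_comm] at h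
  exact h

theorem accuracy_le (p : Params) : (p.accuracy : ℝ) ≤ 1 / p.ε + 1 :=
  (Nat.ceil_lt_add_one (one_div_pos.2 p.ε_pos).le).le

theorem logb_two_le_two_mul {x y : ℝ} (h : Real.log x ≤ y) (hy : 0 ≤ y) :
    Real.logb 2 x ≤ 2 * y := by
  have := Real.log_two_gt_d9
  rw [Real.logb, div_le_iff₀ (by linarith)]
  nlinarith

theorem confidence_le (p : Params) : (p.confidence : ℝ) ≤ 2 * Real.posLog (1 / p.δ) + 1 := by
  have h0 := Real.posLog_nonneg (x := 1 / p.δ)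
  have h1 : Real.log (1 / p.δ) ≤ Real.posLog (1 / p.δ) := le_max_right _ _
  have h2 := Nat.ceil_mono (logb_two_le_two_mul h1 h0)
  exact le_trans (by exact_mod_cast h2) (Nat.ceil_lt_add_one (by linarith)).le

theorem clog_le_logb_add_one {x : ℕ} (hx : 1 ≤ x) : (Nat.clog 2 x : ℝ) ≤ Real.logb 2 x + 1 := by
  have h := Real.natCeil_logb_natCast 2 x
  rw [← h]
  exact (Nat.ceil_lt_add_one (Real.logb_nonneg (by norm_num) (by exact_mod_cast hx))).le

theorem clog_add_three_le (n : ℕ) : (Nat.clog 2 (n + 3) : ℝ) ≤ 2 * Real.log n + 3 := by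
  rcases Nat.eq_zero_or_pos n with rfl | hn
  · have : Nat.clog 2 (0 + 3) ≤ 2 := Nat.clog_le_of_le_pow (by norm_num)
    have : (Nat.clog 2 (0 + 3) : ℝ) ≤ 2 := by exact_mod_cast this
    simp only [Nat.cast_zero, Real.log_zero]
    linarith
  · have h1 : Nat.clog 2 (n + 3) ≤ Nat.clog 2 n + 2 := by
      refine Nat.clog_le_of_le_pow ?_
      have := Nat.le_pow_clog (b := 2) (by norm_num) n
      rw [pow_add]
      omega
    have h2 : (Nat.clog 2 (n + 3) : ℝ) ≤ Nat.clog 2 n + 2 := by exact_mod_cast h1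
    have h3 := clog_le_logb_add_one hn
    have h4 := logb_two_le_two_mul (le_refl (Real.log n)) (Real.log_natCast_nonneg n)
    linarith

theorem one_le_spaceBase (p : Params) : 1 ≤ p.spaceBase := by
  have h1 := Real.posLog_nonneg (x := 1 / p.δ)
  have h2 := one_div_pos.2 p.ε_pos
  have h3 := Real.log_natCast_nonneg p.n
  have h4 : (0 : ℝ) ≤ p.s := Nat.cast_nonneg _
  unfold spaceBase
  linarith

theorem one_le_timeBase (p : Params) : 1 ≤ p.timeBase := by
  have h1 := Real.posLog_nonneg (x := 1 / p.δ)
  have h2 := one_div_pos.2 p.ε_pos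
  have h3 : (0 : ℝ) ≤ (p.n : ℝ) ^ Real.logb 2 p.s := by positivity
  unfold timeBase
  linarith

theorem isPoly_accuracy_confidence {ι : Type*} (p : ι → Params) {Y : ι → ℝ}
    (h : ∀ i, 1 + 1 / (p i).ε + Real.posLog (1 / (p i).δ) ≤ Y i) :
    IsPoly Y (fun i => (p i).accuracy) ∧ IsPoly Y (fun i => (p i).confidence) := by
  have h1 := fun i => Real.posLog_nonneg (x := 1 / (p i).δ)
  have h2 := fun i => one_div_pos.2 (p i).ε_pos
  have hY : ∀ i, 1 ≤ Y i := fun i => by linarith [h i, h1 i, h2 i]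
  refine ⟨.of_le hY 1 1 fun i => ?_, .of_le hY 2 1 fun i => ?_⟩
  · have := (p i).accuracy_le
    push_cast
    linarith [h i, h1 i, h2 i]
  · have := (p i).confidence_le
    push_cast
    linarith [h i, h1 i, h2 i]

theorem isPoly_spaceBase : IsPoly spaceBase s ∧ IsPoly spaceBase accuracy ∧
    IsPoly spaceBase confidence ∧ IsPoly spaceBase fun p => Nat.clog 2 (p.n + 3) := by
  have hpos : ∀ p : Params, 0 ≤ Real.posLog (1 / p.δ) ∧ 0 < 1 / p.ε ∧ 0 ≤ Real.log p.n ∧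
      (0 : ℝ) ≤ p.s := fun p =>
    ⟨Real.posLog_nonneg, one_div_pos.2 p.ε_pos, Real.log_natCast_nonneg p.n, Nat.cast_nonneg _⟩
  obtain ⟨hE, hD⟩ := isPoly_accuracy_confidence (fun p : Params => p) (Y := spaceBase) fun p => by
    have := hpos p; unfold spaceBase; linarith
  refine ⟨.of_le one_le_spaceBase 1 1 fun p => ?_, hE, hD,
    .of_le one_le_spaceBase 3 1 fun p => ?_⟩
  · have := hpos p; unfold spaceBase; push_cast; linarith
  · have := hpos p
    have h := clog_add_three_le p.n
    unfold spaceBase; push_cast; linarith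

theorem exists_cap_le : ∃ C : ℕ, ∀ p : Params, 2 ≤ effectiveSize p.n p.s →
    ((runLim p.n p.s (effectiveSize p.n p.s) p.accuracy p.confidence).cap : ℝ)
      ≤ C * p.spaceBase ^ C := by
  have hY := one_le_spaceBase
  obtain ⟨hs, hE, hD, hg⟩ := isPoly_spaceBase
  -- The maximum with `2` makes the lower bound on the size hold for all parameters; it disappears
  -- again where the size is at least `2`.
  have ht : IsPoly spaceBase fun p => max 2 (effectiveSize p.n p.s) :=
    ((IsPoly.const hY 2).add hY hs).mono fun p => by
      unfold effectiveSize; split_ifs <;> omega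
  obtain ⟨C, hC⟩ := isPoly_cap hY hs ht hE hD hg (fun _ => le_max_left _ _) accuracy_pos
  refine ⟨C, fun p hp => ?_⟩
  have := hC p
  beta_reduce at this
  rwa [max_eq_right hp] at this

/-- From `4 * n + 1 ≤ n ^ 4` and `clog s ≤ 2 * log₂ s` the exponent is at most `4 * 2 * 2 * log₂ s`.
Both inequalities need the bounds by `2`. -/
theorem rpow_logb_bounds {n s : ℕ} (hn : 2 ≤ n) (hs : 2 ≤ s) :
    (n : ℝ) ≤ (n : ℝ) ^ Real.logb 2 s ∧ (s : ℝ) ≤ (n : ℝ) ^ Real.logb 2 s ∧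
      ((4 * n + 1 : ℕ) : ℝ) ^ blockDepth s ≤ ((n : ℝ) ^ Real.logb 2 s) ^ 16 := by
  have hn' : (2 : ℝ) ≤ n := by exact_mod_cast hn
  have hs' : (2 : ℝ) ≤ s := by exact_mod_cast hs
  have hL : 1 ≤ Real.logb 2 s := by
    rw [Real.le_logb_iff_rpow_le (by norm_num) (by linarith)]; simpa using hs'
  refine ⟨?_, ?_, ?_⟩
  · calc (n : ℝ) = (n : ℝ) ^ (1 : ℝ) := (Real.rpow_one _).symm
      _ ≤ _ := Real.rpow_le_rpow_of_exponent_le (by linarith) hL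
  · calc (s : ℝ) = 2 ^ Real.logb 2 s :=
          (Real.rpow_logb (by norm_num) (by norm_num) (by linarith)).symm
      _ ≤ _ := Real.rpow_le_rpow (by norm_num) hn' (by linarith)
  · have h1 : 4 * n + 1 ≤ n ^ 4 := by
      have : 2 ^ 3 ≤ n ^ 3 := Nat.pow_le_pow_left hn 3
      rw [pow_succ]
      nlinarith
    have h2 : (4 * n + 1) ^ blockDepth s ≤ n ^ (Nat.clog 2 s * 8) := by
      calc _ ≤ (n ^ 4) ^ blockDepth s := Nat.pow_le_pow_left h1 _
        _ = _ := by rw [← pow_mul, blockDepth]; congr 1; ring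
    have h3 : (Nat.clog 2 s : ℝ) ≤ Real.logb 2 s * 2 := by
      have := clog_le_logb_add_one ((by omega : 1 ≤ 2).trans hs)
      linarith
    have h4 : (n : ℝ) ^ Nat.clog 2 s ≤ ((n : ℝ) ^ Real.logb 2 s) ^ 2 := by
      rw [← Real.rpow_natCast, ← Real.rpow_natCast, ← Real.rpow_mul (by linarith)]
      exact Real.rpow_le_rpow_of_exponent_le (by linarith) (by exact_mod_cast h3)
    calc ((4 * n + 1 : ℕ) : ℝ) ^ blockDepth s ≤ (n : ℝ) ^ (Nat.clog 2 s * 8) := by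
          exact_mod_cast h2
      _ = ((n : ℝ) ^ Nat.clog 2 s) ^ 8 := pow_mul _ _ _
      _ ≤ (((n : ℝ) ^ Real.logb 2 s) ^ 2) ^ 8 := by gcongr
      _ = _ := by rw [← pow_mul]

theorem exists_runTime_le : ∃ C : ℕ, ∀ p : Params, 1 ≤ p.n → 2 ≤ p.s →
    ((runTime p.n (effectiveSize p.n p.s) p.accuracy p.confidence : ℕ) : ℝ)
      ≤ C * p.timeBase ^ C := by
  -- For `s = 1` the quantity `n ^ (log₂ s)` does not bound `n`, so polynomial boundedness is stated
  -- over the relevant parameters only.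
  let ι := {p : Params // 1 ≤ p.n ∧ 2 ≤ p.s}
  have hY : ∀ p : ι, 1 ≤ p.1.timeBase := fun p => one_le_timeBase p.1
  have hpos : ∀ p : Params, 0 ≤ Real.posLog (1 / p.δ) ∧ 0 < 1 / p.ε ∧
      (0 : ℝ) ≤ (p.n : ℝ) ^ Real.logb 2 p.s := fun p =>
    ⟨Real.posLog_nonneg, one_div_pos.2 p.ε_pos, by positivity⟩
  obtain ⟨hE, hD⟩ := isPoly_accuracy_confidence (fun p : ι => p.1) (Y := fun p => p.1.timeBase)
    fun p => by have := hpos p.1; unfold timeBase; linarith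
  have hB : ∀ p : Params, (p.n : ℝ) ^ Real.logb 2 p.s ≤ p.timeBase := fun p => by
    have := hpos p; unfold timeBase; linarith
  have hn : IsPoly (fun p : ι => p.1.timeBase) fun p => p.1.n := .of_le hY 1 1 fun p => by
    push_cast
    rw [one_mul, pow_one]
    rcases p.2.1.eq_or_lt with h | h
    · rw [← h, Nat.cast_one]; exact hY p
    · exact (rpow_logb_bounds h p.2.2).1.trans (hB _)
  have ht : IsPoly (fun p : ι => p.1.timeBase) fun p => effectiveSize p.1.n p.1.s :=
    .of_le hY 2 1 fun p => by
      have h1 := hY p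
      unfold effectiveSize
      split_ifs with h
      · push_cast; linarith
      · have := (rpow_logb_bounds (not_le.1 h) p.2.2).2.1.trans (hB _)
        push_cast; linarith
  have hcost : IsPoly (fun p : ι => p.1.timeBase)
      fun p => (4 * p.1.n + 1) ^ blockDepth (effectiveSize p.1.n p.1.s) :=
    -- The value 25 is `(4 * 1 + 1) ^ 2`, for `n = 1` and effective size `2`; the exponent 16 is
    -- that of `rpow_logb_bounds`.
    .of_le hY 25 16 fun p => by
      have h1 : 1 ≤ p.1.timeBase ^ 16 := one_le_pow₀ (hY p)
      unfold effectiveSize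
      split_ifs with h
      · have h2 : p.1.n = 1 := le_antisymm h p.2.1
        have h3 : Nat.clog 2 2 = 1 := by simpa using Nat.clog_pow 2 1 (by norm_num)
        rw [h2, blockDepth, h3]
        push_cast
        linarith
      · have h2 := (rpow_logb_bounds (not_le.1 h) p.2.2).2.2
        have h3 := pow_le_pow_left₀ (hpos p.1).2.2 (hB p.1) 16
        push_cast at h2 ⊢
        linarith
  obtain ⟨C, hC⟩ := isPoly_runTime hY hn ht hE hD hcost
    (fun p => by have := p.2.2; unfold effectiveSize; split_ifs <;> omega)
    fun p => p.1.accuracy_pos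
  exact ⟨C, fun p h1 h2 => hC ⟨p, h1, h2⟩⟩

end Params

/-! ### The learning algorithm -/

/-- The learner for trees with one leaf. -/
def constProg : Prog := .draw ;; .emit (.label (.const 0))

def learner : Prog :=
  .ite (reg 0) (.ite (.minus (reg 1) (.const 1)) mainProg constProg) constProg

def constLim (n s E D : ℕ) : Lim where
  addr := 4
  val := n + s + E + D + 1
  draws := 1
  len := 1

theorem learner_spec_const {n s : ℕ} {S : Fin 1 → Cube n × Bool} (E D : ℕ) (h : n = 0 ∨ s ≤ 1) :
    Ensures S (constLim n s E D) learner (State.start n s E D) 20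
      fun σ' => σ'.out = [(S 0).2.toNat] := by
  obtain ⟨e0, e1, -⟩ := start_mem n s E D
  have hw : (State.start n s E D).Within (constLim n s E D) := by
    apply start_within <;> simp only [constLim] <;> omega
  have hd : (State.start n s E D).drawn = 0 := rfl
  have ho : (State.start n s E D).out = [] := rfl
  have hc : Ensures S (constLim n s E D) constProg (State.start n s E D) 9
      fun σ' => σ'.out = [(S 0).2.toNat] := by
    refine Ensures.wp hw (by decide) ?_
    simp only [constProg, wp, Expr.eval]
    refine ⟨by omega, by simp only [constLim]; omega, ?_, by rw [ho]; simp [constLim], ?_⟩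
    · exact (labelVal_le_one _ _ _).trans (by simp only [constLim]; omega)
    · simp [ho, hd, labelVal]
  unfold learner
  refine (Ensures.ite (t := 15) (fun h0 => ?_) fun _ => hc.mono (by omega) fun _ _ h => h).mono
    (by simp [Expr.cost]) fun _ _ h => h
  refine (Ensures.ite (t := 9) (fun h1 => ?_) fun _ => hc).mono
    (by simp [Expr.cost]) fun _ _ h => h
  simp only [Expr.eval] at h0 h1
  omega

theorem learner_spec {n s E D q : ℕ} {S : Fin q → Cube n × Bool} (hn : 0 < n) (hs : 2 ≤ s)
    (hE : 0 < E) (hq : q = sampleSize n (effectiveSize n s) E D) :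
    Ensures S (runLim n s (effectiveSize n s) E D) learner (State.start n s E D)
      (runTime n (effectiveSize n s) E D + 20) fun σ' => σ'.out =
        tokens S (effectiveSize n s + 1) (blockDepth (effectiveSize n s))
          (levels (effectiveSize n s) E) (Finset.range q) := by
  obtain ⟨e0, e1, -⟩ := start_mem n s E D
  unfold learner
  refine (Ensures.ite (fun _ => Ensures.ite (fun _ => mainProg_spec hn hs hE hq) fun h => ?_)
    fun h => ?_).mono (by simp only [Expr.cost]; omega) fun _ _ h => h
  all_goals simp only [Expr.eval] at h; omega

theorem DTree.size_pos {n : ℕ} (T : DTree n) : 0 < T.size := by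
  induction T with
  | leaf b => exact Nat.one_pos
  | node v t0 t1 h0 h1 => exact Nat.add_pos_left h0 _

/-- A cube of dimension `0` has one point, and a tree with one leaf is constant; so a single example
determines `f`. -/
theorem ComputableBySize.apply_eq {n s : ℕ} {f : Cube n → Bool} (hf : ComputableBySize f s)
    (h : n = 0 ∨ s ≤ 1) (x y : Cube n) : f x = f y := by
  rcases h with rfl | h
  · rw [Subsingleton.elim x y]
  · obtain ⟨T, hT, hTf⟩ := hf
    rw [← hTf, ← hTf]
    cases T with
    | leaf b => rfl
    | node v t0 t1 =>
      have h0 := t0.size_pos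
      have h1 := t1.size_pos
      simp only [DTree.size] at hT
      omega

/-- For `n = 1` the quantity `n ^ (log₂ s)` is `1`, so the time may not grow with `s`. But two
leaves suffice for any function of one bit, and `s` can be replaced by `2`. -/
theorem ComputableBySize.effectiveSize {n s : ℕ} {f : Cube n → Bool} (hf : ComputableBySize f s)
    (hn : 0 < n) : ComputableBySize f (effectiveSize n s) := by
  unfold DTLearn.effectiveSize
  split_ifs with h
  swap
  · exact hf
  obtain rfl : n = 1 := le_antisymm h hn
  refine ⟨.node 0 (.leaf (f fun _ => false)) (.leaf (f fun _ => true)), le_rfl, fun x => ?_⟩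
  simp only [DTree.eval]
  split_ifs with hx <;> congr 1 <;> ext1 i <;> rw [Subsingleton.elim i 0] <;> simp [hx]

theorem uniformOn_real_univ {α : Type*} [Fintype α] [Nonempty α] [MeasurableSpace α]
    [MeasurableSingletonClass α] {A : Set α} (h : ∀ x, x ∈ A) :
    (ProbabilityTheory.uniformOn (Set.univ : Set α)).real A = 1 := by
  have : (Fintype.card α : ℝ) ≠ 0 := by exact_mod_cast Fintype.card_ne_zero
  classical
  rw [uniformOn_real_eq, Finset.filter_true_of_mem fun x _ => h x, Finset.card_univ, div_self this]

theorem error_eq_zero {n : ℕ} {g f : Cube n → Bool} (h : ∀ x, g x = f x) : error g f = 0 := by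
  rw [error_eq, Finset.filter_false_of_mem fun x _ => not_not.2 (h x)]
  simp

theorem exists_constLim_cap_le : ∃ C : ℕ, ∀ p : Params,
    ((constLim p.n p.s p.accuracy p.confidence).cap : ℝ) ≤ C * p.spaceBase ^ C := by
  have hY := Params.one_le_spaceBase
  have c := fun k => IsPoly.const hY k
  obtain ⟨hs, hE, hD, hg⟩ := Params.isPoly_spaceBase
  have hval : IsPoly Params.spaceBase
      fun p => Nat.size (constLim p.n p.s p.accuracy p.confidence).val :=
    ((((((hs.add hY hE).add hY hD).add hY (c 1)).add hY (c 2)).add hY hg)).mono fun p =>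
      size_le_add_clog (by
        have := Nat.le_pow_clog (b := 2) (by norm_num) (p.n + 3)
        simp only [constLim]
        omega)
  exact ((c 1).add hY ((c 4).mul hY ((c (Nat.size 4)).add hY hval))).add hY
    ((c 1).mul hY (hval.add hY (c 1)))

theorem sampleSize_le_cap (n s s' E D : ℕ) : sampleSize n s' E D ≤ (runLim n s s' E D).cap :=
  (Nat.le_add_right _ _).trans (Nat.le_add_right _ _)

theorem learner_succeeds_const {n s : ℕ} {ε δ : ℝ} (hε : 0 < ε) (hδ : 0 < δ)
    (h : n = 0 ∨ s ≤ 1) {f : Cube n → Bool} (hf : ComputableBySize f s) :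
    1 - δ ≤ (ProbabilityTheory.uniformOn (Set.univ : Set (Fin 1 → Cube n))).real
      {X | Succeeds learner s ε δ f X} := by
  rw [uniformOn_real_univ]
  · linarith
  intro X
  obtain ⟨σ, t, m, he, -, -, -, ho⟩ := learner_spec_const (S := labelled f X) ⌈1 / ε⌉₊
    ⌈Real.logb 2 (1 / δ)⌉₊ h
  refine ⟨σ, t, m, .leaf (f (X 0)), he, ho, ?_⟩
  exact (error_eq_zero fun x => hf.apply_eq h (X 0) x).trans_le hε.le

/-- The probability bound concerns the ideal tree `learnt`; on every sample the program writes its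
code, so the good event is contained in the event of success. -/
theorem learner_succeeds (p : Params) (hn : 0 < p.n) (hs : 2 ≤ p.s) {f : Cube p.n → Bool}
    (hf : ComputableBySize f p.s) {q : ℕ}
    (hq : q = sampleSize p.n (effectiveSize p.n p.s) p.accuracy p.confidence) :
    1 - p.δ ≤ (ProbabilityTheory.uniformOn (Set.univ : Set (Fin q → Cube p.n))).real
      {X | Succeeds learner p.s p.ε p.δ f X} := by
  have ht : 2 ≤ effectiveSize p.n p.s := by unfold effectiveSize; split_ifs <;> omega
  have hf' := hf.effectiveSize hn
  have hp := prob_error_learnt_le hf' (l := Nat.clog 2 (effectiveSize p.n p.s))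
    (k := rounds (effectiveSize p.n p.s) p.accuracy) (g := Nat.clog 2 (p.n + 3))
    (Nat.clog_pos (by norm_num) ht) (Nat.le_pow_clog (by norm_num) _) p.accuracy_pos
    ((Nat.le_pow_clog (by norm_num) _).trans (Nat.pow_le_pow_right (by norm_num) (le_rounds ht)))
    (Nat.le_pow_clog (by norm_num) _) hq p.one_div_accuracy_le p.one_le_mul_two_pow_confidence
  refine hp.trans (MeasureTheory.measureReal_mono fun X hX => ?_)
  obtain ⟨σ, t, m, he, -, -, -, ho⟩ :=
    learner_spec (S := labelled f X) hn hs p.accuracy_pos hq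
  exact ⟨σ, t, m, _, he, ho.trans (code_learnt hf' _ _ (Finset.Subset.refl _)).symm, hX⟩

end DTLearn

theorem theorem9 :
    ∃ (P : Prog) (C : ℕ), ∀ (n s : ℕ) (ε δ : ℝ), 0 < ε → 0 < δ →
      ∃ q : ℕ, (q : ℝ) ≤ spaceBound C n s ε δ ∧
        ∀ f : Cube n → Bool, ComputableBySize f s →
          (∀ X : Fin q → Cube n,
            RunsWithin P s ε δ f X (timeBound C n s ε δ) (spaceBound C n s ε δ)) ∧
          1 - δ ≤ (ProbabilityTheory.uniformOn (Set.univ : Set (Fin q → Cube n))).real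
            {X | Succeeds P s ε δ f X} := by
  obtain ⟨C₁, hC₁⟩ := Params.exists_cap_le
  obtain ⟨C₂, hC₂⟩ := Params.exists_runTime_le
  obtain ⟨C₃, hC₃⟩ := exists_constLim_cap_le
  -- The summand 20 absorbs the additive 20 steps of `learner` in `htime`, as well as the whole run
  -- in the constant case.
  let C := C₁ + C₂ + C₃ + 20
  have hspace (p : Params) {k m : ℕ} (hk : k ≤ C) (h : (m : ℝ) ≤ k * p.spaceBase ^ k) :
      (m : ℝ) ≤ spaceBound C p.n p.s p.ε p.δ :=
    h.trans (mul_pow_le_mul_pow p.one_le_spaceBase hk)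
  have htime (p : Params) {k m : ℕ} (hk : k + 20 ≤ C) (h : (m : ℝ) ≤ k * p.timeBase ^ k) :
      ((m + 20 : ℕ) : ℝ) ≤ timeBound C p.n p.s p.ε p.δ := by
    have h0 := p.one_le_timeBase
    have h1 : (1 : ℝ) ≤ p.timeBase ^ (k + 20) := one_le_pow₀ h0
    have h2 : p.timeBase ^ k ≤ p.timeBase ^ (k + 20) := pow_le_pow_right₀ h0 (by omega)
    refine le_trans ?_ (mul_pow_le_mul_pow h0 hk)
    push_cast
    rw [add_mul]
    exact add_le_add (h.trans (by gcongr)) (by linarith)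
  refine ⟨learner, C, fun n s ε δ hε hδ => ?_⟩
  let p : Params := ⟨n, s, ε, δ, hε, hδ⟩
  -- In the first case `f` is constant and one example suffices; `s = 0` is included, where no `f`
  -- is computable.
  by_cases h : n = 0 ∨ s ≤ 1
  · have hcap := hspace p (by omega : C₃ ≤ C) (hC₃ p)
    refine ⟨1, hspace p (k := 1) (by omega) ?_, fun f hf =>
      ⟨fun X => ?_, learner_succeeds_const hε hδ h hf⟩⟩
    · simpa using p.one_le_spaceBase
    · obtain ⟨σ, t, m, he, ht, hm, -⟩ := learner_spec_const (S := labelled f X) p.accuracy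
        p.confidence h
      refine ⟨σ, t, m, he, le_trans (by exact_mod_cast ht) (htime p (k := 0) (m := 0)
        (by omega) (by simp)), le_trans (by exact_mod_cast hm) hcap⟩
  · have hn : 0 < n := by omega
    have hs : 2 ≤ s := by omega
    have ht : 2 ≤ effectiveSize n s := by unfold effectiveSize; split_ifs <;> omega
    have hcap := hspace p (by omega : C₁ ≤ C) (hC₁ p ht)
    refine ⟨sampleSize n (effectiveSize n s) p.accuracy p.confidence,
      le_trans (by exact_mod_cast sampleSize_le_cap n s _ _ _) hcap,
      fun f hf => ⟨fun X => ?_, learner_succeeds p hn hs hf rfl⟩⟩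
    obtain ⟨σ, t, m, he, ht, hm, -⟩ := learner_spec (S := labelled f X) hn hs p.accuracy_pos rfl
    exact ⟨σ, t, m, he, le_trans (by exact_mod_cast ht) (htime p (by omega) (hC₂ p hn hs)),
      le_trans (by exact_mod_cast hm) hcap⟩
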